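/- **Setting.** A tracial $W^*$-algebra $\mathcal A=(A,\tau)$ is a von Neumann algebra $A$ with a faithful normal tracial state $\tau$; $L^2(\mathcal A)$ is its GNS Hilbert space, with $\langle a,b\rangle=\tau(a^*b)$, and $L^2(\mathcal A)_{\mathrm{sa}}$ is the closure of the self-adjoint part of $A$ in it. For $X\in L^2(\mathcal A)^d_{\mathrm{sa}}$ write $\arctan X=(\arctan X_1,\dots,\arctan X_d)\in A^d$ (functional calculus). $M_n(\mathbb C)$ carries $\mathrm{tr}_n=\frac1n\mathrm{Tr}$. Let $\mathrm{NCP}_d=\mathbb C\langle x_1,\dots,x_d\rangle$, with $$\partial_{x_j}(x_{i_1}\cdots x_{i_k})=\sum_{i_l=j}x_{i_1}\cdots x_{i_{l-1}}\otimes x_{i_{l+1}}\cdots x_{i_k},\qquad \mathcal D^\circ_{x_j}(x_{i_1}\cdots x_{i_k})=\sum_{i_l=j}x_{i_{l+1}}\cdots x_{i_k}x_{i_1}\cdots x_{i_{l-1}}.$$ Both extend to compositions with $\arctan$: $\partial f$ for a function $f$ of one variable is its divided difference $\frac{f(s)-f(t)}{s-t}$ with $s\leftrightarrow x\otimes1$,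 $t\leftrightarrow1\otimes x$, so with $r_s(x)=(1+\mathrm{i}sx)^{-1}$ one has $\partial r_s=-\mathrm{i}s\,r_s\otimes r_s$ and $\partial\arctan=\frac12\int_{-1}^1r_s\otimes r_s\,ds$. Thus $$\mathcal D^\circ_{x_j}(\phi\circ\arctan)(X)=\tfrac12\int_{-1}^1 r_s(X_j)\,\big[(\mathcal D^\circ_{x_j}\phi)(\arctan X)\big]\,r_s(X_j)\,ds\in L^2(\mathcal A),$$ and $\partial_{x_i}\mathcal D^\circ_{x_j}(\phi\circ\arctan)(X)\in L^2(\mathcal A\otimes\mathcal A,\tau\otimes\tau)$ is obtained by applying the Leibniz rule to this integral. **Cylindrical functions.** Let $g\in C^2(\mathbb R^m;\mathbb R)$, let $\phi_1,\dots,\phi_m\in\mathrm{NCP}_d$ be self-adjoint, and for every $\mathcal A$ and $X\in L^2(\mathcal A)^d_{\mathrm{sa}}$ put $$U_{\mathcal A}(X)=g\big(\tau(\phi_1(\arctan X)),\dots,\tau(\phi_m(\arctan X))\big).$$ Write $g_o,g_{oq}$ for the first and second partial derivatives of $g$ at $\big(\tau(\phi_1(\arctan X)),\dots,\tau(\phi_m(\arctan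 X))\big)$. The free Laplacian is $$\Theta_{\mathcal A}U(X)=\sum_{i=1}^d(\tau\otimes\tau)\Big(\sum_{o=1}^m g_o\,\partial_{x_i}\mathcal D^\circ_{x_i}(\phi_o\circ\arctan)(X)\Big).$$ On $M_n(\mathbb C)^d_{\mathrm{sa}}$ the GUE Laplacian is $$\widehat\Theta_{M_n(\mathbb C)}U(X)=\frac1{n^2}\sum_{l=1}^d\sum_{i,j=1}^n\mathrm{Hess}\,U_{M_n(\mathbb C)}(X)\big[\mathbf e^lE_{ij},\mathbf e^lE_{ij}\big],$$ where $\mathrm{Hess}$ is the second derivative, $\mathbf e^l E$ is the tuple with $E$ in position $l$ and $0$ elsewhere, and, with $e_{ij}$ the matrix units, $E_{ii}=\sqrt n\,e_{ii}$, $E_{ij}=\sqrt{n/2}\,(e_{ij}+e_{ji})$ for $i<j$ and $E_{ij}=\mathrm{i}\sqrt{n/2}\,(e_{ij}-e_{ji})$ for $i>j$; here $\mathrm{i}=\sqrt{-1}$. **Proposition.** (1) For every $n\ge1$, $U_{M_n(\mathbb C)}$ is twice continuously differentiable on $M_n(\mathbb C)^d_{\mathrm{sa}}$, and for every $X\in M_n(\mathbb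 C)^d_{\mathrm{sa}}$ $$\widehat\Theta_{M_n(\mathbb C)}U(X)=\Theta_{M_n(\mathbb C)}U(X)+\frac1{n^2}\sum_{l=1}^d\sum_{o=1}^m\sum_{q=1}^m g_{oq}\,\big\langle\mathcal D^\circ_{x_l}(\phi_o\circ\arctan)(X),\mathcal D^\circ_{x_l}(\phi_q\circ\arctan)(X)\big\rangle_{L^2(M_n(\mathbb C))}.$$ (2) Let $\mathcal A$ be a tracial $W^*$-algebra, $X\in L^2(\mathcal A)^d_{\mathrm{sa}}$, and let $X^n\in M_n(\mathbb C)^d_{\mathrm{sa}}$ converge in law to $X$, i.e. $\mathrm{tr}_n(p(\arctan X^n))\to\tau(p(\arctan X))$ for every $p\in\mathrm{NCP}_d$. Then $$\lim_{n\to\infty}\widehat\Theta_{M_n(\mathbb C)}U(X^n)=\Theta_{\mathcal A}U(X).$$ -/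

import Mathlib

open scoped Matrix.Norms.L2Operator MatrixOrder ComplexOrder TensorProduct

universe u

/-! ### Non-commutative polynomials and their derivatives -/

/-- Non-commutative polynomials `ℂ⟨x₁, …, x_d⟩`. -/
abbrev NCP (d : ℕ) : Type := FreeAlgebra ℂ (Fin d)

namespace NCP

variable {d : ℕ}

/-- The monomial attached to a word in the letters `x₁, …, x_d`. -/
noncomputable def monomial (w : List (Fin d)) : NCP d :=
  (w.map (FreeAlgebra.ι ℂ)).prod

/-- `φ` is self-adjoint for the conjugate-linear involution with `x_j* = x_j`: the coefficient of
the reversed word is the complex conjugate of the coefficient of the word.  (Mathlib's `star` on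
`FreeAlgebra` does not conjugate scalars, so it is not the involution wanted here.) -/
def SelfAdj (φ : NCP d) : Prop :=
  ∀ w : FreeMonoid (Fin d),
    (FreeAlgebra.basisFreeMonoid ℂ (Fin d)).repr φ w.reverse =
      star ((FreeAlgebra.basisFreeMonoid ℂ (Fin d)).repr φ w)

/-- Evaluation `φ ↦ φ(Y)` at a `d`-tuple of elements of a complex algebra. -/
noncomputable def eval {A : Type*} [Ring A] [Algebra ℂ A] (Y : Fin d → A) : NCP d →ₐ[ℂ] A :=
  FreeAlgebra.lift ℂ Y

/-- The free difference quotient `∂_{x_j} : NCP_d → NCP_d ⊗ NCP_d`,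
`∂_{x_j} (x_{i_1} ⋯ x_{i_m}) = ∑_{i_k = j} x_{i_1} ⋯ x_{i_{k-1}} ⊗ x_{i_{k+1}} ⋯ x_{i_m}`. -/
noncomputable def freeDiff (j : Fin d) : NCP d →ₗ[ℂ] NCP d ⊗[ℂ] NCP d :=
  (FreeAlgebra.basisFreeMonoid ℂ (Fin d)).constr ℂ fun w : FreeMonoid (Fin d) =>
    ∑ k : Fin w.toList.length,
      if w.toList.get k = j then
        monomial (w.toList.take k) ⊗ₜ[ℂ] monomial (w.toList.drop (k + 1))
      else 0

/-- The cyclic derivative `𝒟°_{x_j} : NCP_d → NCP_d`,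
`𝒟°_{x_j} (x_{i_1} ⋯ x_{i_m}) = ∑_{i_k = j} x_{i_{k+1}} ⋯ x_{i_m} x_{i_1} ⋯ x_{i_{k-1}}`. -/
noncomputable def cyclicDeriv (j : Fin d) : NCP d →ₗ[ℂ] NCP d :=
  (FreeAlgebra.basisFreeMonoid ℂ (Fin d)).constr ℂ fun w : FreeMonoid (Fin d) =>
    ∑ k : Fin w.toList.length,
      if w.toList.get k = j then
        monomial (w.toList.drop (k + 1) ++ w.toList.take k)
      else 0

end NCP

/-! ### Tracial `W*`-algebras and their `L²`-spaces -/

/-- `(A, τ)` is a tracial `W*`-algebra: `A` is a `C*`-algebra that is `*`-isomorphic to a von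
Neumann algebra `π(A) ⊆ B(H)`, and `τ` is a faithful tracial state on it which is normal, that is,
ultraweakly continuous: `τ(a) = ∑ₖ ⟨ξₖ, π(a) ηₖ⟩` with `∑ ‖ξₖ‖², ∑ ‖ηₖ‖² < ∞`. -/
structure IsTracialWStar {A : Type u} [CStarAlgebra A] [PartialOrder A] [StarOrderedRing A]
    (τ : A →ₚ[ℂ] ℂ) : Prop where
  map_one : τ 1 = 1
  faithful : ∀ a : A, τ (star a * a) = 0 → a = 0
  tracial : ∀ a b : A, τ (a * b) = τ (b * a)
  exists_normal_rep :
    ∃ (H : Type u) (_ : NormedAddCommGroup H) (_ : InnerProductSpace ℂ H) (_ : CompleteSpace H)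
      (S : VonNeumannAlgebra H) (π : A →⋆ₐ[ℂ] (H →L[ℂ] H)) (ξ η : ℕ → H),
      Function.Injective π ∧ Set.range π = (S : Set (H →L[ℂ] H)) ∧
      Summable (fun k => ‖ξ k‖ ^ 2) ∧ Summable (fun k => ‖η k‖ ^ 2) ∧
      ∀ a : A, HasSum (fun k => inner ℂ (ξ k) (π a (η k))) (τ a)

/-! The Hilbert space `L²(A)` is the GNS space `τ.GNS`; `A` acts on it from the left through
`τ.gnsStarAlgHom`. -/

section L2

variable {A : Type u} [CStarAlgebra A] [PartialOrder A] [StarOrderedRing A] (τ : A →ₚ[ℂ] ℂ)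

/-- The canonical map `A → L²(A)`. -/
noncomputable def toL2 (a : A) : τ.GNS := ((τ.toPreGNS a : τ.PreGNS) : τ.GNS)

/-- `L²(A)_sa`, the closure of the self-adjoint part of `A` in `L²(A)`. -/
def selfAdjointL2 : Set τ.GNS := closure (toL2 τ '' {a : A | IsSelfAdjoint a})

/-- `Φ : C_b(ℝ) → A` is the bounded continuous functional calculus `f ↦ f(X)` of the self-adjoint
`X ∈ L²(A)`: a unital `*`-homomorphism such that `f(X) · X = (t f(t))(X)` in `L²(A)` whenever `f`
and `t ↦ t f(t)` are both bounded and continuous. -/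
def IsFunctionalCalculus (X : τ.GNS) (Φ : BoundedContinuousFunction ℝ ℂ →⋆ₐ[ℂ] A) : Prop :=
  ∀ f h : BoundedContinuousFunction ℝ ℂ, (∀ t : ℝ, h t = (t : ℂ) * f t) →
    τ.gnsStarAlgHom (Φ f) X = toL2 τ (Φ h)

open Classical in
/-- `f(X) ∈ A` for `X ∈ L²(A)_sa` and `f` bounded and continuous on `ℝ`. -/
noncomputable def funCalc (X : τ.GNS) (f : BoundedContinuousFunction ℝ ℂ) : A :=
  if h : ∃ Φ, IsFunctionalCalculus τ X Φ then h.choose f else 0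

/-- The function `arctan` on `ℝ`. -/
noncomputable def arctanBCF : BoundedContinuousFunction ℝ ℂ :=
  BoundedContinuousFunction.ofNormedAddCommGroup (fun t : ℝ => (Real.arctan t : ℂ))
    (Complex.continuous_ofReal.comp Real.continuous_arctan) (Real.pi / 2) (fun t => by
      rw [Complex.norm_real, Real.norm_eq_abs]
      exact (abs_lt.2 ⟨Real.neg_pi_div_two_lt_arctan t, Real.arctan_lt_pi_div_two t⟩).le)

theorem one_le_norm_one_add_I_mul (s t : ℝ) : 1 ≤ ‖(1 + Complex.I * s * t : ℂ)‖ := by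
  have h := Complex.abs_re_le_norm (1 + Complex.I * s * t : ℂ)
  simpa using h

theorem one_add_I_mul_ne_zero (s t : ℝ) : (1 + Complex.I * s * t : ℂ) ≠ 0 := by
  intro h
  have := one_le_norm_one_add_I_mul s t
  rw [h, norm_zero] at this
  linarith

theorem continuous_resolvent_left (t : ℝ) :
    Continuous fun s : ℝ => (1 + Complex.I * s * t : ℂ)⁻¹ :=
  Continuous.inv₀ (by fun_prop) (fun s => one_add_I_mul_ne_zero s t)

/-- The function `t ↦ (1 + i s t)⁻¹` on `ℝ`. -/
noncomputable def resolventBCF (s : ℝ) : BoundedContinuousFunction ℝ ℂ :=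
  BoundedContinuousFunction.ofNormedAddCommGroup (fun t : ℝ => (1 + Complex.I * s * t : ℂ)⁻¹)
    (Continuous.inv₀ (by fun_prop) (fun t => one_add_I_mul_ne_zero s t)) 1 (fun t => by
      rw [norm_inv]
      exact inv_le_one_of_one_le₀ (one_le_norm_one_add_I_mul s t))

/-- `arctan(X) ∈ A`. -/
noncomputable def arctanL2 (X : τ.GNS) : A := funCalc τ X arctanBCF

/-- `(1 + i s X)⁻¹ ∈ A`. -/
noncomputable def resolventL2 (X : τ.GNS) (s : ℝ) : A := funCalc τ X (resolventBCF s)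

/-- The Hilbert space `L²(A ⊗ A, τ ⊗ τ)`. -/
abbrev L2Tensor : Type u := UniformSpace.Completion (τ.GNS ⊗[ℂ] τ.GNS)

/-- The canonical map `A ⊗ A → L²(A ⊗ A, τ ⊗ τ)` from the algebraic tensor product. -/
noncomputable def toL2Tensor (z : A ⊗[ℂ] A) : L2Tensor τ :=
  ((TensorProduct.map
      ((UniformSpace.Completion.toComplₗᵢ (𝕜 := ℂ) (E := τ.PreGNS)).toLinearMap ∘ₗ
        τ.toPreGNS.toLinearMap)
      ((UniformSpace.Completion.toComplₗᵢ (𝕜 := ℂ) (E := τ.PreGNS)).toLinearMap ∘ₗ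
        τ.toPreGNS.toLinearMap) z : τ.GNS ⊗[ℂ] τ.GNS) : L2Tensor τ)

/-- The functional `τ ⊗ τ`, extended from `A ⊗ A` to `L²(A ⊗ A, τ ⊗ τ)`. -/
noncomputable def tensorTrace (Z : L2Tensor τ) : ℂ :=
  inner ℂ (toL2Tensor τ (1 ⊗ₜ[ℂ] 1)) Z

end L2

/-! ### Extension of the derivatives to compositions with `arctan`

The free difference quotient of a function `f` of one variable is its divided difference
`(f(s) - f(t)) / (s - t)`, with `s ↔ x ⊗ 1` and `t ↔ 1 ⊗ x`.  For `r_s(x) = (1 + i s x)⁻¹` this is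
`∂ r_s = - i s r_s ⊗ r_s`, and for `arctan` it is `∂ arctan = ½ ∫_{-1}^{1} r_s ⊗ r_s ds`, by
`arctan_sub_arctan_eq`.  The derivatives of `φ ∘ arctan` are obtained from these two identities and
the Leibniz rule. -/

theorem integral_resolvent_eq_arctan (t : ℝ) :
    (1 / 2 : ℂ) * ∫ s in (-1 : ℝ)..1, (t : ℂ) * (1 + Complex.I * s * t : ℂ)⁻¹ =
      (Real.arctan t : ℂ) := by
  have hd : ∀ s : ℝ, HasDerivAt
      (fun s : ℝ => ((Real.arctan (s * t) : ℝ) : ℂ) -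
        Complex.I / 2 * ((Real.log (1 + (s * t) ^ 2) : ℝ) : ℂ))
      ((t : ℂ) * (1 + Complex.I * s * t : ℂ)⁻¹) s := by
    intro s
    have hp : (0 : ℝ) < 1 + (s * t) ^ 2 := by positivity
    have h0 : HasDerivAt (fun s : ℝ => s * t) t s := by simpa using (hasDerivAt_id s).mul_const t
    have h1 := h0.arctan.ofReal_comp
    have h2 := (((h0.pow 2).const_add 1).log hp.ne').ofReal_comp
    have h3 := h1.sub (h2.const_mul (Complex.I / 2))
    refine h3.congr_deriv ?_
    have e1 := one_add_I_mul_ne_zero s t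
    have e2 : (1 + ((s : ℂ) * t) ^ 2) ≠ 0 := by exact_mod_cast hp.ne'
    have e3 : (1 + ((s : ℂ) * t) ^ 2) = (1 + Complex.I * s * t) * (1 - Complex.I * (s * t)) := by
      linear_combination (((s : ℂ) * t) ^ 2) * Complex.I_sq
    have e4 : (1 - Complex.I * ((s : ℂ) * t)) ≠ 0 := right_ne_zero_of_mul (e3 ▸ e2)
    simp only [Pi.pow_apply, Complex.ofReal_mul, Complex.ofReal_div,
      Complex.ofReal_add, Complex.ofReal_pow, Complex.ofReal_one]
    rw [e3]
    generalize 1 + Complex.I * (s : ℂ) * t = a at *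
    have e5 : Complex.I * ((s : ℂ) * t) = 1 - (1 - Complex.I * (s * t)) := by ring
    generalize (1 - Complex.I * ((s : ℂ) * t)) = b at *
    field_simp
    push_cast
    linear_combination (-2 * (t : ℂ)) * e5
  have hi : IntervalIntegrable (fun s : ℝ => (t : ℂ) * (1 + Complex.I * s * t : ℂ)⁻¹)
      MeasureTheory.volume (-1) 1 :=
    (continuous_const.mul (continuous_resolvent_left t)).intervalIntegrable _ _
  rw [intervalIntegral.integral_eq_sub_of_hasDerivAt (fun s _ => hd s) hi]
  simp only [one_mul, neg_mul, Real.arctan_neg, even_two, Even.neg_pow, Complex.ofReal_neg]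
  ring

theorem arctan_sub_arctan_eq (s t : ℝ) :
    ((Real.arctan s : ℂ) - Real.arctan t) =
      (s - t) * ((1 / 2 : ℂ) *
        ∫ v in (-1 : ℝ)..1, (1 + Complex.I * v * s : ℂ)⁻¹ * (1 + Complex.I * v * t : ℂ)⁻¹) := by
  have hi : ∀ t : ℝ, IntervalIntegrable (fun s : ℝ => (t : ℂ) * (1 + Complex.I * s * t : ℂ)⁻¹)
      MeasureTheory.volume (-1) 1 := fun t =>
    (continuous_const.mul (continuous_resolvent_left t)).intervalIntegrable _ _
  rw [← integral_resolvent_eq_arctan, ← integral_resolvent_eq_arctan, ← mul_sub,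
    ← intervalIntegral.integral_sub (hi s) (hi t), mul_left_comm,
    ← intervalIntegral.integral_const_mul ((s : ℂ) - t)]
  congr 1
  refine intervalIntegral.integral_congr fun v _ => ?_
  have e1 := one_add_I_mul_ne_zero v s
  have e2 := one_add_I_mul_ne_zero v t
  have e3 : (s : ℂ) * (1 + Complex.I * v * t) - t * (1 + Complex.I * v * s) = s - t := by ring
  simp_rw [← e3]
  generalize (1 + Complex.I * (v : ℂ) * s) = a at *
  generalize (1 + Complex.I * (v : ℂ) * t) = b at *
  field_simp

section ArctanDerivatives

variable {A : Type u} [CStarAlgebra A] [PartialOrder A] [StarOrderedRing A] (τ : A →ₚ[ℂ] ℂ)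
  {d : ℕ}

/-- `ψ(X) = (arctan X₁, …, arctan X_d)`. -/
noncomputable def arctanTuple (X : Fin d → τ.GNS) : Fin d → A := fun j => arctanL2 τ (X j)

/-- The cyclic derivative `𝒟°_{x_j}(φ ∘ arctan)(X) = ½ ∫_{-1}^{1} r_s W r_s ds ∈ L²(A)`, where
`r_s = (1 + i s X_j)⁻¹` and `W = (𝒟°_{x_j} φ)(arctan X)`. -/
noncomputable def cyclicDerivArctan (j : Fin d) (φ : NCP d) (X : Fin d → τ.GNS) : τ.GNS :=
  (1 / 2 : ℂ) • ∫ s in (-1 : ℝ)..1,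
    toL2 τ (resolventL2 τ (X j) s * NCP.eval (arctanTuple τ X) (NCP.cyclicDeriv j φ) *
      resolventL2 τ (X j) s)

/-- For `p ∈ NCP_d` and `r ∈ A`: the image of `∂_{x_i} p`, evaluated at `Y`, under
`a ⊗ b ↦ a r ⊗ r b`. -/
noncomputable def freeDiffInsert (i : Fin d) (p : NCP d) (Y : Fin d → A) (r : A) : A ⊗[ℂ] A :=
  TensorProduct.map (LinearMap.mulRight ℂ r ∘ₗ (NCP.eval Y).toLinearMap)
    (LinearMap.mulLeft ℂ r ∘ₗ (NCP.eval Y).toLinearMap) (NCP.freeDiff i p)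

/-- `∂_{x_i} 𝒟°_{x_j}(φ ∘ arctan)(X) ∈ L²(A ⊗ A, τ ⊗ τ)`: the Leibniz rule applied to the three
factors of `½ ∫_{-1}^{1} r_s W r_s ds`, with `r_s = (1 + i s X_j)⁻¹`, `W = (𝒟°_{x_j} φ)(arctan X)`.
-/
noncomputable def freeDiffCyclicArctan (i j : Fin d) (φ : NCP d) (X : Fin d → τ.GNS) :
    L2Tensor τ :=
  let Y : Fin d → A := arctanTuple τ X
  let W : A := NCP.eval Y (NCP.cyclicDeriv j φ)
  let r : ℝ → A := fun s => resolventL2 τ (X j) s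
  let ρ : ℝ → A := fun v => resolventL2 τ (X i) v
  (1 / 2 : ℂ) • ∫ s in (-1 : ℝ)..1,
    ((if i = j then
        (-(Complex.I * (s : ℂ))) •
          toL2Tensor τ (r s ⊗ₜ[ℂ] (r s * W * r s) + (r s * W * r s) ⊗ₜ[ℂ] r s)
      else 0) +
      (1 / 2 : ℂ) • ∫ v in (-1 : ℝ)..1,
        toL2Tensor τ ((r s ⊗ₜ[ℂ] (1 : A)) * freeDiffInsert i (NCP.cyclicDeriv j φ) Y (ρ v) *
          ((1 : A) ⊗ₜ[ℂ] r s)))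

end ArctanDerivatives

/-! ### Cylindrical functions and the free Laplacian -/

section Cylindrical

variable {A : Type u} [CStarAlgebra A] [PartialOrder A] [StarOrderedRing A] (τ : A →ₚ[ℂ] ℂ)
  {d m : ℕ} (g : (Fin m → ℝ) → ℝ) (φ : Fin m → NCP d)

/-- The partial derivative `g_o`. -/
noncomputable def partialDeriv (o : Fin m) (y : Fin m → ℝ) : ℝ := fderiv ℝ g y (Pi.single o 1)

/-- The second partial derivative `g_{oq}`. -/
noncomputable def partialDeriv₂ (o q : Fin m) (y : Fin m → ℝ) : ℝ :=
  partialDeriv (partialDeriv g o) q y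

/-- The functional `p ↦ τ(p(arctan X))`, that is, the non-commutative law of `arctan X`. -/
noncomputable def arctanLaw (X : Fin d → τ.GNS) (p : NCP d) : ℂ :=
  τ (NCP.eval (arctanTuple τ X) p)

/-- The vector `(τ(φ₁(arctan X)), …, τ(φ_m(arctan X)))`, whose entries are real for self-adjoint
`φ_o`. -/
noncomputable def cylArgs (X : Fin d → τ.GNS) : Fin m → ℝ := fun o => (arctanLaw τ X (φ o)).re

/-- The cylindrical function `U_A(X) = g(τ(φ₁(arctan X)), …, τ(φ_m(arctan X)))`. -/
noncomputable def cylindrical (X : Fin d → τ.GNS) : ℝ := g (cylArgs τ φ X)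

/-- `∂_{x_i}(∇U_A)^j(X) = ∑_o g_o ∂_{x_i} 𝒟°_{x_j}(φ_o ∘ arctan)(X)`. -/
noncomputable def ncDerivGradient (i j : Fin d) (X : Fin d → τ.GNS) : L2Tensor τ :=
  ∑ o, (partialDeriv g o (cylArgs τ φ X) : ℂ) • freeDiffCyclicArctan τ i j (φ o) X

/-- The free Laplacian `Θ_A U(X) = ∑_i (τ ⊗ τ)(∂_{x_i}(∇U_A)^i(X))`. -/
noncomputable def freeLaplacian (X : Fin d → τ.GNS) : ℂ :=
  ∑ i, tensorTrace τ (ncDerivGradient τ g φ i i X)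

end Cylindrical

/-! ### Matrices and the GUE Laplacian -/

/-- The normalized trace `tr_n = n⁻¹ Tr` on `M_n(ℂ)`. -/
noncomputable def normTrace (n : ℕ) : Matrix (Fin n) (Fin n) ℂ →ₚ[ℂ] ℂ :=
  PositiveLinearMap.mk₀ ((n : ℂ)⁻¹ • Matrix.traceLinearMap (Fin n) ℂ ℂ) (fun a ha => by
    have h := (Matrix.nonneg_iff_posSemidef.1 ha).trace_nonneg
    have hn : (0 : ℂ) ≤ (n : ℂ)⁻¹ := by
      rw [inv_nonneg]
      exact Nat.cast_nonneg n
    simpa using mul_nonneg hn h)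

/-- `d`-tuples of self-adjoint matrices `M_n(ℂ)_sa^d`. -/
abbrev SAMatrices (n d : ℕ) : Type := Fin d → selfAdjoint (Matrix (Fin n) (Fin n) ℂ)

/-- The inclusion `M_n(ℂ)_sa^d → L²(M_n(ℂ))^d`. -/
noncomputable def matL2 {n d : ℕ} (X : SAMatrices n d) : Fin d → (normTrace n).GNS :=
  fun j => toL2 (normTrace n) (X j : Matrix (Fin n) (Fin n) ℂ)

/-- The basis `E_{ij}` of `M_n(ℂ)_sa`, as matrices; it is orthonormal for the inner product of the
normalized trace. -/
noncomputable def gueBasisMatrix {n : ℕ} (i j : Fin n) : Matrix (Fin n) (Fin n) ℂ :=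
  if i = j then (Real.sqrt n : ℂ) • Matrix.single i i 1
  else if i < j then
    ((Real.sqrt n / Real.sqrt 2 : ℝ) : ℂ) • (Matrix.single i j 1 + Matrix.single j i 1)
  else
    (Complex.I * ((Real.sqrt n / Real.sqrt 2 : ℝ) : ℂ)) •
      (Matrix.single i j 1 - Matrix.single j i 1)

theorem isSelfAdjoint_gueBasisMatrix {n : ℕ} (i j : Fin n) :
    IsSelfAdjoint (gueBasisMatrix i j) := by
  rw [IsSelfAdjoint, Matrix.star_eq_conjTranspose, gueBasisMatrix]
  split_ifs
  · simp [Matrix.conjTranspose_single]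
  · simp [Matrix.conjTranspose_single, add_comm]
  · rw [Matrix.conjTranspose_smul, Matrix.conjTranspose_sub, Matrix.conjTranspose_single,
      Matrix.conjTranspose_single, star_one, ← neg_sub (Matrix.single i j (1 : ℂ)), smul_neg,
      ← neg_smul]
    congr 1
    simp

/-- The basis `E_{ij}` of `M_n(ℂ)_sa`. -/
noncomputable def gueBasis {n : ℕ} (i j : Fin n) : selfAdjoint (Matrix (Fin n) (Fin n) ℂ) :=
  ⟨gueBasisMatrix i j, isSelfAdjoint_gueBasisMatrix i j⟩

/-- The Hessian of a real function on `M_n(ℂ)_sa^d`: its second Fréchet derivative, as a bilinear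
form. -/
noncomputable def matHessian {n d : ℕ} (U : SAMatrices n d → ℝ) (X A B : SAMatrices n d) : ℝ :=
  fderiv ℝ (fderiv ℝ U) X A B

/-- The Laplacian of the `GUE(n)` Brownian motion,
`n⁻² ∑_l ∑_{i,j} Hess U(X)[e^l E_{ij}, e^l E_{ij}]`. -/
noncomputable def gueLaplacian {n d : ℕ} (U : SAMatrices n d → ℝ) (X : SAMatrices n d) : ℝ :=
  1 / (n : ℝ) ^ 2 * ∑ l : Fin d, ∑ i : Fin n, ∑ j : Fin n,
    matHessian U X (Pi.single l (gueBasis i j)) (Pi.single l (gueBasis i j))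

/-- The cylindrical function `U_{M_n(ℂ)}` on `M_n(ℂ)_sa^d`. -/
noncomputable def matCylindrical {d m : ℕ} (g : (Fin m → ℝ) → ℝ) (φ : Fin m → NCP d) (n : ℕ) :
    SAMatrices n d → ℝ :=
  fun X => cylindrical (normTrace n) g φ (matL2 X)

/-- Convergence in law of `Xⁿ ∈ M_n(ℂ)_sa^d` to `X ∈ L²(A)_sa^d`:
`tr_n(p(arctan Xⁿ)) → τ(p(arctan X))` for every non-commutative polynomial `p`. -/
def MatConvergesInLaw {A : Type u} [CStarAlgebra A] [PartialOrder A] [StarOrderedRing A]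
    (τ : A →ₚ[ℂ] ℂ) {d : ℕ} (Xn : (n : ℕ) → SAMatrices n d) (X : Fin d → τ.GNS) : Prop :=
  ∀ p : NCP d, Filter.Tendsto (fun n => arctanLaw (normTrace n) (matL2 (Xn n)) p) Filter.atTop
    (nhds (arctanLaw τ X p))

-- Part (1) is a second-order Taylor expansion. In the Banach algebra of continuous paths `[-1, 1] →
-- A`, the resolvents `r_s = (1 + i s a)⁻¹` are the inverse of a path affine in `a`. Hence `arctan a
-- = ½ ∫ r_s a ds` is smooth on self-adjoint elements, with derivative `e ↦ ½ ∫ r_s e r_s ds`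
-- (`hasDerivAt_arctanPath`). By the Leibniz rule and cyclicity of the trace, the derivative of
-- `τ(φ_o(arctan X))` in a direction `e` of the variable `l` is `τ(G_o e)`, where `G_o` is the
-- cyclic derivative `½ ∫ r_s W r_s ds`. Differentiating again and applying the chain rule to `g`
-- gives the Hessian as a sum of terms `g_o τ(G_o' e)` and `g_{oq} τ(G_o e) τ(G_q e)`
-- (`hessian_cylindrical`).
--
-- The GUE basis satisfies `∑ E ⊗ E = n ∑ e_ij ⊗ e_ji` (`sum_bilin_gueBasisMatrix`), hence `∑ tr(a E
-- b E) = n² tr(a) tr(b)` and `∑ tr(a E) tr(b E) = tr(a b)`. The first identity splits the trace in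
-- `τ(G_o' e)` and produces `n²` times `τ ⊗ τ` of the free difference quotient of `G_o`
-- (`sum_state_hessianPath`). The second turns the products into inner products.
--
-- In part (2) the correction term is `n⁻²` times a bounded quantity, so the free Laplacian has to
-- be shown continuous under convergence in law (`tendsto_freeLaplacian`). It is a double integral
-- over `s, v` of products of traces of the form `τ(r_s p(arctan X) r_v)`. With `y = arctan t` the
-- resolvent is a continuous function of `y ∈ [-π/2, π/2]`, hence a uniform limit of polynomials in
-- `arctan` (`resolventBCF_mem_closure`). So these traces converge, and dominated convergence
-- applies with bounds that do not depend on the algebra.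
--
-- For a general `X ∈ L²(A)_sa` all this presupposes that the functional calculus exists. It is
-- built as a `2`-norm limit of the calculi of self-adjoint elements of `A` tending to `X`
-- (`IsTracialWStar.exists_isFunctionalCalculus`), and the limits lie in `A` because bounded sets of
-- a tracial `W*`-algebra are `2`-norm complete.

universe v

/-! ### Elementary facts on `L²(A)` -/

section L2Basics

variable {A : Type u} [CStarAlgebra A] [PartialOrder A] [StarOrderedRing A] (τ : A →ₚ[ℂ] ℂ)

theorem toL2_add (a b : A) : toL2 τ (a + b) = toL2 τ a + toL2 τ b := by
  simp [toL2, UniformSpace.Completion.coe_add]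

theorem toL2_smul (c : ℂ) (a : A) : toL2 τ (c • a) = c • toL2 τ a := by
  simp [toL2, UniformSpace.Completion.coe_smul]

theorem toL2_sub (a b : A) : toL2 τ (a - b) = toL2 τ a - toL2 τ b := by
  simp [toL2, UniformSpace.Completion.coe_sub]

theorem inner_toL2 (a b : A) : inner ℂ (toL2 τ a) (toL2 τ b) = τ (star a * b) := by
  rw [toL2, toL2, UniformSpace.Completion.inner_coe, PositiveLinearMap.preGNS_inner_def]
  simp

theorem gns_toL2 (a b : A) : τ.gnsStarAlgHom a (toL2 τ b) = toL2 τ (a * b) := by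
  simp [toL2]

theorem denseRange_toL2 : DenseRange (toL2 τ) :=
  (UniformSpace.Completion.denseRange_coe (α := τ.PreGNS)).comp
    τ.toPreGNS.surjective.denseRange (UniformSpace.Completion.continuous_coe _)

theorem norm_gns_apply_le (a : A) (x : τ.GNS) : ‖τ.gnsStarAlgHom a x‖ ≤ ‖a‖ * ‖x‖ :=
  ((τ.gnsStarAlgHom a).le_opNorm x).trans
    (mul_le_mul_of_nonneg_right (NonUnitalStarAlgHom.norm_apply_le _ a) (norm_nonneg _))

theorem norm_toL2_mul_le (a b : A) : ‖toL2 τ (a * b)‖ ≤ ‖a‖ * ‖toL2 τ b‖ := by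
  rw [← gns_toL2]
  exact norm_gns_apply_le τ a _

/-- The canonical map `A → L²(A)` as a continuous linear map. -/
noncomputable def toL2CLM : A →L[ℂ] τ.GNS :=
  LinearMap.mkContinuous ⟨⟨toL2 τ, toL2_add τ⟩, toL2_smul τ⟩ ‖toL2 τ 1‖ fun a => by
    have := norm_toL2_mul_le τ a 1
    rwa [mul_one, mul_comm] at this

theorem toL2CLM_apply (a : A) : toL2CLM τ a = toL2 τ a := rfl

theorem norm_toL2_sq (a : A) : (‖toL2 τ a‖ : ℂ) ^ 2 = τ (star a * a) := by
  rw [← inner_toL2, inner_self_eq_norm_sq_to_K]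
  rfl

variable {τ}

theorem norm_toL2_one (h1 : τ 1 = 1) : ‖toL2 τ 1‖ = 1 := by
  have h := norm_toL2_sq τ 1
  rw [star_one, one_mul, h1] at h
  have h' : ‖toL2 τ (1 : A)‖ ^ 2 = 1 := by exact_mod_cast h
  exact (pow_eq_one_iff_of_nonneg (norm_nonneg _) two_ne_zero).1 h'

theorem norm_toL2_le (h1 : τ 1 = 1) (a : A) : ‖toL2 τ a‖ ≤ ‖a‖ := by
  simpa [norm_toL2_one h1] using norm_toL2_mul_le τ a 1

theorem norm_state_apply_le (h1 : τ 1 = 1) (a : A) : ‖τ a‖ ≤ ‖a‖ := by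
  have h := norm_inner_le_norm (𝕜 := ℂ) (toL2 τ 1) (toL2 τ a)
  rw [inner_toL2, star_one, one_mul, norm_toL2_one h1, one_mul] at h
  exact h.trans (norm_toL2_le h1 a)

/-- A state as a continuous linear map. -/
noncomputable def stateCLM (h1 : τ 1 = 1) : A →L[ℂ] ℂ :=
  LinearMap.mkContinuous τ.toLinearMap 1 fun a => by
    simpa using norm_state_apply_le h1 a

theorem stateCLM_apply (h1 : τ 1 = 1) (a : A) : stateCLM h1 a = τ a := rfl

theorem toL2_injective (hf : ∀ a : A, τ (star a * a) = 0 → a = 0) :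
    Function.Injective (toL2 τ) := by
  intro a b hab
  refine sub_eq_zero.1 (hf _ ?_)
  rw [← norm_toL2_sq, toL2_sub, hab, sub_self, norm_zero]
  simp

theorem norm_toL2_star (ht : ∀ a b : A, τ (a * b) = τ (b * a)) (a : A) :
    ‖toL2 τ (star a)‖ = ‖toL2 τ a‖ := by
  have h : (‖toL2 τ (star a)‖ : ℂ) ^ 2 = (‖toL2 τ a‖ : ℂ) ^ 2 := by
    rw [norm_toL2_sq, norm_toL2_sq, star_star, ht]
  have h' : ‖toL2 τ (star a)‖ ^ 2 = ‖toL2 τ a‖ ^ 2 := by exact_mod_cast h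
  exact (sq_eq_sq₀ (norm_nonneg _) (norm_nonneg _)).1 h'

/-- The adjoint is a `2`-norm isometry for a trace, which carries the bound for left multiplication
over to right multiplication. -/
theorem norm_toL2_mul_right_le (ht : ∀ a b : A, τ (a * b) = τ (b * a)) (a b : A) :
    ‖toL2 τ (a * b)‖ ≤ ‖toL2 τ a‖ * ‖b‖ := by
  rw [← norm_toL2_star ht (a * b), star_mul, ← norm_toL2_star ht a, mul_comm, ← norm_star b]
  exact norm_toL2_mul_le τ _ _

end L2Basics

/-! ### Bounded sets of a tracial `W*`-algebra are complete in the `2`-norm -/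

section BoundedCompleteness

open Filter Topology

/-- A bounded sequence of operators has a weak operator limit along every ultrafilter. -/
theorem exists_weakOperator_limit {H : Type*} [NormedAddCommGroup H] [InnerProductSpace ℂ H]
    [CompleteSpace H] (T : ℕ → H →L[ℂ] H) (C : ℝ) (hT : ∀ n, ‖T n‖ ≤ C) (U : Ultrafilter ℕ) :
    ∃ S : H →L[ℂ] H, ∀ x y, Tendsto (fun n => inner ℂ x (T n y)) U (𝓝 (inner ℂ x (S y))) := by
  have hbd : ∀ n x y, ‖inner ℂ x (T n y)‖ ≤ C * ‖x‖ * ‖y‖ := fun n x y =>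
    calc ‖inner ℂ x (T n y)‖ ≤ ‖x‖ * ‖T n y‖ := norm_inner_le_norm _ _
      _ ≤ ‖x‖ * (C * ‖y‖) := by
        gcongr
        exact ((T n).le_opNorm y).trans (mul_le_mul_of_nonneg_right (hT n) (norm_nonneg _))
      _ = C * ‖x‖ * ‖y‖ := by ring
  have hex : ∀ x y, ∃ c ∈ Metric.closedBall (0 : ℂ) (C * ‖x‖ * ‖y‖),
      Tendsto (fun n => inner ℂ x (T n y)) U (𝓝 c) := by
    intro x y
    -- The matrix coefficients stay in a compact disc, so they converge along the ultrafilter; the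
    -- limits form a bounded sesquilinear form.
    have := (isCompact_closedBall (0 : ℂ) (C * ‖x‖ * ‖y‖)).ultrafilter_le_nhds
      (U.map fun n => inner ℂ x (T n y))
      (le_principal_iff.2 (mem_map.2 (univ_mem' fun n => by simpa using hbd n x y)))
    simpa [Tendsto] using this
  choose B hB hlim using hex
  let B' : H →L⋆[ℂ] H →L[ℂ] ℂ := LinearMap.mkContinuous₂
    (LinearMap.mk₂'ₛₗ (starRingEnd ℂ) (RingHom.id ℂ) B
      (fun x x' y => tendsto_nhds_unique (hlim (x + x') y) <| by
        simpa only [inner_add_left] using (hlim x y).add (hlim x' y))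
      (fun c x y => tendsto_nhds_unique (hlim (c • x) y) <| by
        simpa only [inner_smul_left, smul_eq_mul] using (hlim x y).const_mul (starRingEnd ℂ c))
      (fun x y y' => tendsto_nhds_unique (hlim x (y + y')) <| by
        simpa only [map_add, inner_add_right] using (hlim x y).add (hlim x y'))
      (fun c x y => tendsto_nhds_unique (hlim x (c • y)) <| by
        simpa only [map_smul, inner_smul_right, smul_eq_mul, RingHom.id_apply] using (hlim x y).const_mul c)) C
    (fun x y => by simpa using hB x y)
  refine ⟨ContinuousLinearMap.adjoint (InnerProductSpace.continuousLinearMapOfBilin B'),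
    fun x y => ?_⟩
  rw [ContinuousLinearMap.adjoint_inner_right,
    InnerProductSpace.continuousLinearMapOfBilin_apply]
  exact hlim x y

variable {A : Type u} [CStarAlgebra A] [PartialOrder A] [StarOrderedRing A] {τ : A →ₚ[ℂ] ℂ}

/-- A weak operator limit of `π (b n)` along an ultrafilter stays in the von Neumann algebra, so it
is some `π a`. Normality writes `τ` as a summable series of vector functionals, so `⟨c, b n⟩ → ⟨c,
a⟩` for every `c`, which identifies `a` with `x`. -/
theorem IsTracialWStar.exists_toL2_eq_of_tendsto (h : IsTracialWStar τ) {b : ℕ → A} {C : ℝ}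
    (hb : ∀ n, ‖b n‖ ≤ C) {x : τ.GNS} (hx : Tendsto (fun n => toL2 τ (b n)) atTop (𝓝 x)) :
    ∃ a, toL2 τ a = x := by
  obtain ⟨H, _, _, _, S, π, ξ, η, hinj, hrange, hξ, hη, hτ⟩ := h.exists_normal_rep
  have hπ : ∀ a : A, ‖π a‖ ≤ ‖a‖ := fun a => NonUnitalStarAlgHom.norm_apply_le π a
  let U : Ultrafilter ℕ := Ultrafilter.of atTop
  have hU : (U : Filter ℕ) ≤ atTop := Ultrafilter.of_le atTop
  obtain ⟨T, hT⟩ := exists_weakOperator_limit (fun n => π (b n)) C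
    (fun n => (hπ _).trans (hb n)) U
  have hTS : T ∈ (S : Set (H →L[ℂ] H)) := by
    -- Bicommutant: commuting with each `R` in the commutant is a weakly closed condition, so it
    -- passes to the limit `T`.
    rw [← S.centralizer_centralizer, Set.mem_centralizer_iff]
    intro R hR
    refine ContinuousLinearMap.ext fun y => ext_inner_left ℂ fun z => ?_
    refine tendsto_nhds_unique (f := fun n => inner ℂ z (π (b n) (R y))) (l := (U : Filter ℕ))
      ?_ (hT z (R y))
    have h1 := hT (ContinuousLinearMap.adjoint R z) y
    simp only [ContinuousLinearMap.adjoint_inner_left] at h1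
    refine h1.congr fun n => ?_
    have hn : π (b n) ∈ (S : Set (H →L[ℂ] H)) := hrange ▸ Set.mem_range_self _
    have := Set.mem_centralizer_iff.1 hR _ hn
    exact congrArg (inner ℂ z) (DFunLike.congr_fun this y).symm
  rw [← hrange] at hTS
  obtain ⟨a, ha⟩ := hTS
  refine ⟨a, ?_⟩
  have hsum : Summable fun k => ‖ξ k‖ * ‖η k‖ := by
    refine Summable.of_nonneg_of_le (fun k => by positivity) (fun k => ?_)
      ((hξ.add hη))
    nlinarith [sq_nonneg (‖ξ k‖ - ‖η k‖), sq_nonneg ‖ξ k‖, sq_nonneg ‖η k‖]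
  refine ext_inner_left ℂ fun z => (denseRange_toL2 τ).induction_on z
    (isClosed_eq (by fun_prop) (by fun_prop)) fun c => ?_
  have h1 : Tendsto (fun n => inner ℂ (toL2 τ c) (toL2 τ (b n))) U
      (𝓝 (inner ℂ (toL2 τ c) x)) := tendsto_const_nhds.inner (hx.mono_left hU)
  refine tendsto_nhds_unique ?_ h1
  simp only [inner_toL2, ← (hτ _).tsum_eq]
  -- Weak convergence handles each vector functional, and `‖ξ k‖ ‖η k‖` dominates the series.
  refine tendsto_tsum_of_dominated_convergence (hsum.mul_left (‖c‖ * C)) (fun k => ?_)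
    (Eventually.of_forall fun n k => ?_)
  · have h2 := hT (π c (ξ k)) (η k)
    rw [← ha] at h2
    have h3 : ∀ e : A, inner ℂ (π c (ξ k)) (π e (η k)) =
        inner ℂ (ξ k) (π (star c * e) (η k)) := by
      intro e
      rw [map_mul, map_star, ContinuousLinearMap.star_eq_adjoint,
        mul_apply_eq_comp, ContinuousLinearMap.adjoint_inner_right]
    simpa only [h3] using h2
  · calc ‖inner ℂ (ξ k) (π (star c * b n) (η k))‖ ≤ ‖ξ k‖ * (‖star c * b n‖ * ‖η k‖) := by
          refine (norm_inner_le_norm _ _).trans ?_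
          gcongr
          exact ((π _).le_opNorm _).trans (by gcongr; exact hπ _)
      _ ≤ ‖ξ k‖ * ((‖c‖ * C) * ‖η k‖) := by
          gcongr
          refine (norm_mul_le _ _).trans ?_
          rw [norm_star]
          gcongr
          exact hb n
      _ = ‖c‖ * C * (‖ξ k‖ * ‖η k‖) := by ring

end BoundedCompleteness

/-! ### Resolvents generate the bounded continuous functional calculus -/

section ResolventFunctions

open Filter Topology
open scoped BoundedContinuousFunction

theorem resolventBCF_apply (s t : ℝ) : resolventBCF s t = (1 + Complex.I * s * t : ℂ)⁻¹ := rfl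

theorem arctanBCF_apply (t : ℝ) : arctanBCF t = (Real.arctan t : ℂ) := rfl

theorem norm_resolventBCF_le (s : ℝ) : ‖resolventBCF s‖ ≤ 1 :=
  BoundedContinuousFunction.norm_ofNormedAddCommGroup_le _ zero_le_one _

theorem norm_arctanBCF_le : ‖arctanBCF‖ ≤ Real.pi / 2 :=
  BoundedContinuousFunction.norm_ofNormedAddCommGroup_le _ (by positivity) _

theorem resolventBCF_zero : resolventBCF 0 = 1 := by
  ext t
  simp [resolventBCF_apply]

theorem star_resolventBCF (s : ℝ) : star (resolventBCF s) = resolventBCF (-s) := by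
  ext t
  simp [resolventBCF_apply]

theorem star_arctanBCF : star arctanBCF = arctanBCF := by
  ext t
  exact Complex.conj_ofReal _

/-- The function `t ↦ t (1 + i s t)⁻¹` for `s ≠ 0`. -/
noncomputable def idMulResolventBCF (s : ℝ) : ℝ →ᵇ ℂ := (Complex.I * s)⁻¹ • (1 - resolventBCF s)

theorem idMulResolventBCF_apply {s : ℝ} (hs : s ≠ 0) (t : ℝ) :
    idMulResolventBCF s t = t * resolventBCF s t := by
  have h1 := one_add_I_mul_ne_zero s t
  have h2 : (s : ℂ) ≠ 0 := by exact_mod_cast hs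
  simp only [idMulResolventBCF, BoundedContinuousFunction.coe_smul, BoundedContinuousFunction.coe_sub,
    BoundedContinuousFunction.coe_one, Pi.sub_apply, Pi.one_apply, resolventBCF_apply, smul_eq_mul]
  have h3 := Complex.I_ne_zero
  field_simp
  ring

theorem tendsto_resolventBCF_cocompact {s : ℝ} (hs : s ≠ 0) :
    Tendsto (resolventBCF s) (cocompact ℝ) (𝓝 0) := by
  have h : Tendsto (fun t : ℝ => ‖(1 + Complex.I * s * t : ℂ)‖) (cocompact ℝ) atTop := by
    have h2 : Tendsto (fun t : ℝ => |s| * ‖t‖) (cocompact ℝ) atTop :=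
      (tendsto_norm_cocompact_atTop).const_mul_atTop (abs_pos.2 hs)
    refine tendsto_atTop_mono (fun t => ?_) h2
    have := Complex.abs_im_le_norm (1 + Complex.I * s * t : ℂ)
    simpa [abs_mul] using this
  rw [tendsto_zero_iff_norm_tendsto_zero]
  refine h.inv_tendsto_atTop.congr fun t => ?_
  rw [resolventBCF_apply, norm_inv, Pi.inv_apply]

/-- Restriction of continuous functions on the one-point compactification of `ℝ`. -/
noncomputable def onePointRestrict : C(OnePoint ℝ, ℂ) →⋆ₐ[ℂ] (ℝ →ᵇ ℂ) where
  toFun f := BoundedContinuousFunction.ofNormedAddCommGroup (fun t : ℝ => f t)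
    (f.continuous.comp OnePoint.continuous_coe) ‖f‖ (fun t => f.norm_coe_le_norm t)
  map_one' := rfl
  map_mul' _ _ := rfl
  map_zero' := rfl
  map_add' _ _ := rfl
  commutes' _ := rfl
  map_star' _ := rfl

theorem onePointRestrict_apply (f : C(OnePoint ℝ, ℂ)) (t : ℝ) : onePointRestrict f t = f t := rfl

theorem exists_onePointRestrict_eq (f : ℝ →ᵇ ℂ) (h : Tendsto f (cocompact ℝ) (𝓝 0)) :
    ∃ F : C(OnePoint ℝ, ℂ), onePointRestrict F = f ∧ F OnePoint.infty = 0 :=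
  ⟨OnePoint.continuousMapMk f.toContinuousMap 0 (by rwa [coclosedCompact_eq_cocompact]),
    by ext t; rfl, rfl⟩

/-- A closed `*`-subalgebra of `C_b(ℝ)` containing a resolvent contains the ideal it generates. -/
theorem mul_resolventBCF_mem (K : StarSubalgebra ℂ (ℝ →ᵇ ℂ)) (hK : IsClosed (K : Set (ℝ →ᵇ ℂ)))
    (h1 : resolventBCF 1 ∈ K) (f : ℝ →ᵇ ℂ) : f * resolventBCF 1 ∈ K := by
  have hcont : Continuous (onePointRestrict : C(OnePoint ℝ, ℂ) → (ℝ →ᵇ ℂ)) :=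
    AddMonoidHomClass.continuous_of_bound onePointRestrict 1
      fun f => by simpa using NonUnitalStarAlgHom.norm_apply_le onePointRestrict f
  have hlim := tendsto_resolventBCF_cocompact one_ne_zero
  have hclosed : IsClosed (K.comap onePointRestrict : Set C(OnePoint ℝ, ℂ)) :=
    hK.preimage hcont
  -- The resolvent is injective and nonzero on `ℝ` and tends to `0` at infinity, so this one
  -- function separates all points of the compactification and Stone–Weierstrass applies.
  have hsep : (K.comap onePointRestrict).SeparatesPoints := by
    obtain ⟨F, hF, hF0⟩ := exists_onePointRestrict_eq _ hlim
    have hFt : ∀ t : ℝ, F t = (1 + Complex.I * (1 : ℝ) * t : ℂ)⁻¹ := fun t => by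
      rw [← onePointRestrict_apply, hF, resolventBCF_apply]
    intro x y hxy
    refine ⟨F, ⟨F, ?_, rfl⟩, fun hFxy => hxy ?_⟩
    · show onePointRestrict F ∈ K
      rwa [hF]
    · induction x using OnePoint.rec with
      | infty =>
        induction y using OnePoint.rec with
        | infty => rfl
        | coe y =>
          rw [hF0, hFt] at hFxy
          exact absurd hFxy.symm (inv_ne_zero (one_add_I_mul_ne_zero 1 y))
      | coe x =>
        induction y using OnePoint.rec with
        | infty =>
          rw [hF0, hFt] at hFxy
          exact absurd hFxy (inv_ne_zero (one_add_I_mul_ne_zero 1 x))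
        | coe y =>
          rw [hFt, hFt, inv_inj] at hFxy
          have : (x : ℂ) = y := by simpa using hFxy
          rw [Complex.ofReal_injective this]
  have htop : K.comap onePointRestrict = ⊤ := by
    rw [← ContinuousMap.starSubalgebra_topologicalClosure_eq_top_of_separatesPoints _ hsep]
    exact SetLike.coe_injective (by
      rw [StarSubalgebra.topologicalClosure_coe, hclosed.closure_eq])
  obtain ⟨F, hF, -⟩ := exists_onePointRestrict_eq (f * resolventBCF 1) (by
    have := isBoundedUnder_le_mul_tendsto_zero (l := cocompact ℝ) (f := f)
      ⟨‖f‖, eventually_map.2 (Eventually.of_forall fun t => f.norm_coe_le_norm t)⟩ hlim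
    exact this)
  rw [← hF]
  have : F ∈ K.comap onePointRestrict := htop ▸ StarSubalgebra.mem_top
  exact this

end ResolventFunctions

/-! ### Calculus of self-adjoint elements: resolvents and uniqueness. -/

section FunctionalCalculus

open Filter Topology
open scoped BoundedContinuousFunction

theorem norm_starAlgHom_le {A : Type*} [CStarAlgebra A] (Φ : (ℝ →ᵇ ℂ) →⋆ₐ[ℂ] A) (f : ℝ →ᵇ ℂ) :
    ‖Φ f‖ ≤ ‖f‖ :=
  NonUnitalStarAlgHom.norm_apply_le Φ f

theorem continuous_starAlgHom {A : Type*} [CStarAlgebra A] (Φ : (ℝ →ᵇ ℂ) →⋆ₐ[ℂ] A) :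
    Continuous Φ :=
  AddMonoidHomClass.continuous_of_bound Φ 1 fun f => by simpa using norm_starAlgHom_le Φ f

theorem resolvent_mul_eq_one {A : Type*} [CStarAlgebra A] {a : A} {Φ : (ℝ →ᵇ ℂ) →⋆ₐ[ℂ] A}
    (h : ∀ f k : ℝ →ᵇ ℂ, (∀ t : ℝ, k t = t * f t) → Φ f * a = Φ k) (s : ℝ) :
    Φ (resolventBCF s) * (1 + (Complex.I * s) • a) = 1 := by
  rcases eq_or_ne s 0 with rfl | hs
  · simp [resolventBCF_zero]
  · rw [mul_add, mul_one, mul_smul_comm, h _ _ (idMulResolventBCF_apply hs),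
      idMulResolventBCF, map_smul, smul_smul, mul_inv_cancel₀, one_smul, map_sub, map_one,
      add_sub_cancel]
    exact mul_ne_zero Complex.I_ne_zero (by exact_mod_cast hs)

/-- Adjoint of the left-inverse identity at `-s`. -/
theorem mul_resolvent_eq_one {A : Type*} [CStarAlgebra A] {a : A} (ha : IsSelfAdjoint a)
    {Φ : (ℝ →ᵇ ℂ) →⋆ₐ[ℂ] A}
    (h : ∀ f k : ℝ →ᵇ ℂ, (∀ t : ℝ, k t = t * f t) → Φ f * a = Φ k) (s : ℝ) :
    (1 + (Complex.I * s) • a) * Φ (resolventBCF s) = 1 := by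
  have := congrArg star (resolvent_mul_eq_one h (-s))
  simpa [← map_star, star_resolventBCF, ha.star_eq] using this

/-- The bounded continuous functional calculus of a self-adjoint element of a `C*`-algebra. -/
noncomputable def selfAdjointCalculus {A : Type*} [CStarAlgebra A] {a : A} (ha : IsSelfAdjoint a) : (ℝ →ᵇ ℂ) →⋆ₐ[ℂ] A :=
  (cfcHom (R := ℂ) ha.isStarNormal).comp
    ((ContinuousMap.compStarAlgHom' ℂ ℂ
      (⟨fun z => (z : ℂ).re, by fun_prop⟩ : C(spectrum ℂ a, ℝ))).comp
      (BoundedContinuousFunction.toContinuousMapStarₐ ℂ))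

theorem selfAdjointCalculus_apply {A : Type*} [CStarAlgebra A] {a : A} (ha : IsSelfAdjoint a) (f : ℝ →ᵇ ℂ) :
    selfAdjointCalculus ha f = cfcHom (R := ℂ) ha.isStarNormal
      ⟨fun z => f (z : ℂ).re, by fun_prop⟩ := rfl

theorem selfAdjointCalculus_mul {A : Type*} [CStarAlgebra A] {a : A} (ha : IsSelfAdjoint a) (f k : ℝ →ᵇ ℂ)
    (hk : ∀ t : ℝ, k t = t * f t) :
    selfAdjointCalculus ha f * a = selfAdjointCalculus ha k := by
  conv_lhs => arg 2; rw [← cfcHom_id (R := ℂ) ha.isStarNormal]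
  rw [selfAdjointCalculus_apply, selfAdjointCalculus_apply, ← map_mul]
  congr 1
  ext z
  have hz : ((z : ℂ).re : ℂ) = z := (ha.mem_spectrum_eq_re z.2).symm
  simp only [ContinuousMap.mul_apply, ContinuousMap.coe_mk, hk]
  rw [hz, mul_comm]
  rfl

variable {A : Type u} [CStarAlgebra A] [PartialOrder A] [StarOrderedRing A] {τ : A →ₚ[ℂ] ℂ}

/-- `(1 + i X) f(X) = ((1 + i t) f)(X)` in the form `(f r₁)(X) (1 + i X) = f(X)`. -/
theorem IsFunctionalCalculus.gns_mul_resolvent {X : τ.GNS} {Φ : (ℝ →ᵇ ℂ) →⋆ₐ[ℂ] A}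
    (h : IsFunctionalCalculus τ X Φ) (f : ℝ →ᵇ ℂ) :
    τ.gnsStarAlgHom (Φ (f * resolventBCF 1)) (toL2 τ 1 + Complex.I • X) = toL2 τ (Φ f) := by
  have h1 := h (f * resolventBCF 1) (f * idMulResolventBCF 1) fun t => by
    simp only [BoundedContinuousFunction.coe_mul, Pi.mul_apply,
      idMulResolventBCF_apply one_ne_zero]
    ring
  rw [map_add, map_smul, h1, gns_toL2, mul_one, ← toL2_smul, ← toL2_add, ← map_smul, ← map_add]
  congr 2
  ext t
  have h2 := one_add_I_mul_ne_zero 1 t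
  simp only [BoundedContinuousFunction.coe_add, BoundedContinuousFunction.coe_smul,
    BoundedContinuousFunction.coe_mul, Pi.add_apply, Pi.mul_apply,
    idMulResolventBCF_apply one_ne_zero, resolventBCF_apply, smul_eq_mul]
  field_simp
  push_cast
  ring

theorem IsFunctionalCalculus.mul_eq {a : A} {Φ : (ℝ →ᵇ ℂ) →⋆ₐ[ℂ] A}
    (hf : ∀ a : A, τ (star a * a) = 0 → a = 0)
    (h : IsFunctionalCalculus τ (toL2 τ a) Φ) (f k : ℝ →ᵇ ℂ) (hk : ∀ t : ℝ, k t = t * f t) :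
    Φ f * a = Φ k := by
  have := h f k hk
  rw [gns_toL2] at this
  exact toL2_injective hf this

/-- The bounded continuous functional calculus of a self-adjoint element of `A` is unique. -/
theorem IsFunctionalCalculus.unique {a : A} (ha : IsSelfAdjoint a) {Φ Ψ : (ℝ →ᵇ ℂ) →⋆ₐ[ℂ] A}
    (hf : ∀ a : A, τ (star a * a) = 0 → a = 0)
    (hΦ : IsFunctionalCalculus τ (toL2 τ a) Φ) (hΨ : IsFunctionalCalculus τ (toL2 τ a) Ψ) :
    Φ = Ψ := by
  -- One is a left inverse and the other a right inverse of the same element `1 + i a`.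
  have hres : Φ (resolventBCF 1) = Ψ (resolventBCF 1) :=
    left_inv_eq_right_inv (resolvent_mul_eq_one (hΦ.mul_eq hf) 1) (mul_resolvent_eq_one ha (hΨ.mul_eq hf) 1)
  ext f
  have hmem := mul_resolventBCF_mem (StarAlgHom.equalizer Φ Ψ)
    (isClosed_eq (continuous_starAlgHom Φ) (continuous_starAlgHom Ψ)) hres f
  have h2 : Φ (f * resolventBCF 1) = Ψ (f * resolventBCF 1) := hmem
  rw [map_mul, map_mul, ← hres] at h2
  -- The calculi agree on the ideal generated by the resolvent; multiplying by `1 + i a` removes the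
  -- resolvent factor.
  have h3 := congrArg (· * (1 + (Complex.I * (1 : ℝ)) • a)) h2
  simpa only [mul_assoc, resolvent_mul_eq_one (hΦ.mul_eq hf), mul_one] using h3

theorem isFunctionalCalculus_selfAdjointCalculus {a : A} (ha : IsSelfAdjoint a) :
    IsFunctionalCalculus τ (toL2 τ a) (selfAdjointCalculus ha) := by
  intro f k hk
  rw [gns_toL2, selfAdjointCalculus_mul ha f k hk]

theorem exists_funCalc_eq {X : τ.GNS}
    (h : ∃ Φ : (ℝ →ᵇ ℂ) →⋆ₐ[ℂ] A, IsFunctionalCalculus τ X Φ) :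
    ∃ Φ : (ℝ →ᵇ ℂ) →⋆ₐ[ℂ] A, IsFunctionalCalculus τ X Φ ∧ ∀ f, funCalc τ X f = Φ f :=
  ⟨h.choose, h.choose_spec, fun f => by rw [funCalc, dif_pos h]⟩

theorem funCalc_toL2 (hf : ∀ a : A, τ (star a * a) = 0 → a = 0) {a : A} (ha : IsSelfAdjoint a)
    (f : ℝ →ᵇ ℂ) : funCalc τ (toL2 τ a) f = selfAdjointCalculus ha f := by
  obtain ⟨Φ, hΦ, h⟩ := exists_funCalc_eq ⟨_, isFunctionalCalculus_selfAdjointCalculus (τ := τ) ha⟩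
  rw [h, hΦ.unique ha hf (isFunctionalCalculus_selfAdjointCalculus ha)]

end FunctionalCalculus

/-! ### Existence of the bounded continuous functional calculus on `L²(A)_sa` -/

section ExistenceOfCalculus

open Filter Topology
open scoped BoundedContinuousFunction

variable {A : Type u} [CStarAlgebra A] [PartialOrder A] [StarOrderedRing A] {τ : A →ₚ[ℂ] ℂ}

/-- Joint continuity of the action on bounded sets in the `2`-norm. Replacing `y` by some `e ∈ A`
makes `(b n - c) e` small, since right multiplication by `e` is `2`-norm bounded for a trace; the
two remaining errors use the operator bound `C`. -/
theorem tendsto_gns_apply (ht : ∀ a b : A, τ (a * b) = τ (b * a)) {b : ℕ → A} {C : ℝ}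
    (hb : ∀ n, ‖b n‖ ≤ C) {c : A} (hc : Tendsto (fun n => toL2 τ (b n)) atTop (𝓝 (toL2 τ c)))
    {x : ℕ → τ.GNS} {y : τ.GNS} (hx : Tendsto x atTop (𝓝 y)) :
    Tendsto (fun n => τ.gnsStarAlgHom (b n) (x n)) atTop (𝓝 (τ.gnsStarAlgHom c y)) := by
  have hC : 0 ≤ C := (norm_nonneg _).trans (hb 0)
  rw [Metric.tendsto_atTop]
  intro ε hε
  obtain ⟨e, he⟩ : ∃ e : A, ‖y - toL2 τ e‖ < ε / (4 * (C + ‖c‖ + 1)) := by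
    obtain ⟨_, ⟨e, rfl⟩, he⟩ :=
      Metric.mem_closure_iff.1 (denseRange_toL2 τ y) (ε / (4 * (C + ‖c‖ + 1))) (by positivity)
    exact ⟨e, by rwa [← dist_eq_norm]⟩
  have h1 : ∀ᶠ n in atTop, ‖x n - y‖ < ε / (4 * (C + 1)) :=
    (tendsto_iff_norm_sub_tendsto_zero.1 hx).eventually_lt_const (by positivity)
  have h2 : ∀ᶠ n in atTop, ‖toL2 τ (b n) - toL2 τ c‖ < ε / (4 * (‖e‖ + 1)) :=
    (tendsto_iff_norm_sub_tendsto_zero.1 hc).eventually_lt_const (by positivity)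
  obtain ⟨N, hN⟩ := eventually_atTop.1 (h1.and h2)
  refine ⟨N, fun n hn => ?_⟩
  obtain ⟨h1, h2⟩ := hN n hn
  have e1 : τ.gnsStarAlgHom (b n) (x n) - τ.gnsStarAlgHom c y =
      τ.gnsStarAlgHom (b n) (x n - y) + τ.gnsStarAlgHom (b n - c) (y - toL2 τ e) +
        toL2 τ ((b n - c) * e) := by
    rw [← gns_toL2]
    simp only [map_sub, sub_apply]
    abel
  have i1 : ‖τ.gnsStarAlgHom (b n) (x n - y)‖ ≤ C * (ε / (4 * (C + 1))) :=
    (norm_gns_apply_le τ _ _).trans (mul_le_mul (hb n) h1.le (norm_nonneg _) hC)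
  have i2 : ‖τ.gnsStarAlgHom (b n - c) (y - toL2 τ e)‖ ≤
      (C + ‖c‖) * (ε / (4 * (C + ‖c‖ + 1))) :=
    (norm_gns_apply_le τ _ _).trans (mul_le_mul
      ((norm_sub_le _ _).trans (by gcongr; exact hb n)) he.le (norm_nonneg _) (by positivity))
  have i3 : ‖toL2 τ ((b n - c) * e)‖ ≤ ε / (4 * (‖e‖ + 1)) * ‖e‖ := by
    refine (norm_toL2_mul_right_le ht _ _).trans ?_
    rw [toL2_sub]
    gcongr
  have j : ∀ r : ℝ, 0 ≤ r → r * (ε / (4 * (r + 1))) ≤ ε / 4 := fun r hr => by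
    rw [mul_div_assoc', div_le_div_iff₀ (by positivity) (by positivity)]
    nlinarith
  rw [dist_eq_norm, e1]
  have := norm_add₃_le (a := τ.gnsStarAlgHom (b n) (x n - y))
    (b := τ.gnsStarAlgHom (b n - c) (y - toL2 τ e)) (c := toL2 τ ((b n - c) * e))
  have j1 := j C hC
  have j2 := j (C + ‖c‖) (by positivity)
  have j3 := j ‖e‖ (norm_nonneg _)
  linarith

/-- Second resolvent identity; it makes `a ↦ (1 + i a)⁻¹` a contraction for the `2`-norm. -/
theorem selfAdjointCalculus_resolvent_sub {A : Type*} [CStarAlgebra A] {a b : A}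
    (ha : IsSelfAdjoint a) (hb : IsSelfAdjoint b) :
    selfAdjointCalculus ha (resolventBCF 1) - selfAdjointCalculus hb (resolventBCF 1) =
      selfAdjointCalculus ha (resolventBCF 1) * ((-Complex.I) • (a - b)) *
        selfAdjointCalculus hb (resolventBCF 1) := by
  have h1 := resolvent_mul_eq_one (selfAdjointCalculus_mul ha) 1
  have h2 := mul_resolvent_eq_one hb (selfAdjointCalculus_mul hb) 1
  generalize selfAdjointCalculus ha (resolventBCF 1) = r at *
  generalize selfAdjointCalculus hb (resolventBCF 1) = r' at *
  have h3 : (-Complex.I) • (a - b) =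
      (1 + (Complex.I * (1 : ℝ)) • b) - (1 + (Complex.I * (1 : ℝ)) • a) := by
    simp [smul_sub, neg_add_eq_sub]
  rw [h3, mul_sub, sub_mul, h1, one_mul, mul_assoc, h2, mul_one]

/-- Every element of `L²(A)_sa` has a bounded continuous functional calculus. -/
theorem IsTracialWStar.exists_isFunctionalCalculus (h : IsTracialWStar τ) {X : τ.GNS}
    (hX : X ∈ selfAdjointL2 τ) : ∃ Φ : (ℝ →ᵇ ℂ) →⋆ₐ[ℂ] A, IsFunctionalCalculus τ X Φ := by
  obtain ⟨x, hx, hlim⟩ := mem_closure_iff_seq_limit.1 hX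
  choose a ha hax using hx
  obtain rfl : (fun n => toL2 τ (a n)) = x := funext hax
  have ht := h.tracial
  let Ψ : ℕ → (ℝ →ᵇ ℂ) →⋆ₐ[ℂ] A := fun n => selfAdjointCalculus (ha n)
  have hΨ : ∀ n f, ‖Ψ n f‖ ≤ ‖f‖ := fun n f => norm_starAlgHom_le _ f
  have hmul : ∀ {f g : ℝ →ᵇ ℂ} {b c : A},
      Tendsto (fun n => toL2 τ (Ψ n f)) atTop (𝓝 (toL2 τ b)) →
      Tendsto (fun n => toL2 τ (Ψ n g)) atTop (𝓝 (toL2 τ c)) →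
      Tendsto (fun n => toL2 τ (Ψ n (f * g))) atTop (𝓝 (toL2 τ (b * c))) := by
    intro f g b c hb hc
    rw [← gns_toL2]
    refine (tendsto_gns_apply ht (fun n => hΨ n f) hb hc).congr fun n => ?_
    rw [gns_toL2, map_mul]
  have hadd : ∀ {f g : ℝ →ᵇ ℂ} {b c : A},
      Tendsto (fun n => toL2 τ (Ψ n f)) atTop (𝓝 (toL2 τ b)) →
      Tendsto (fun n => toL2 τ (Ψ n g)) atTop (𝓝 (toL2 τ c)) →
      Tendsto (fun n => toL2 τ (Ψ n (f + g))) atTop (𝓝 (toL2 τ (b + c))) := by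
    intro f g b c hb hc
    simpa only [map_add, toL2_add] using hb.add hc
  have hscalar : ∀ r : ℂ, Tendsto (fun n => toL2 τ (Ψ n (algebraMap ℂ _ r))) atTop
      (𝓝 (toL2 τ (algebraMap ℂ A r))) := by
    intro r
    simp only [AlgHomClass.commutes, tendsto_const_nhds_iff]
  have hstar : ∀ {f : ℝ →ᵇ ℂ} {b : A},
      Tendsto (fun n => toL2 τ (Ψ n f)) atTop (𝓝 (toL2 τ b)) →
      Tendsto (fun n => toL2 τ (Ψ n (star f))) atTop (𝓝 (toL2 τ (star b))) := by
    intro f b hb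
    rw [tendsto_iff_norm_sub_tendsto_zero] at hb ⊢
    refine hb.congr fun n => ?_
    rw [map_star, ← toL2_sub, ← toL2_sub, ← star_sub, norm_toL2_star ht]
  have hex : ∀ {f : ℝ →ᵇ ℂ}, CauchySeq (fun n => toL2 τ (Ψ n f)) →
      ∃ b, Tendsto (fun n => toL2 τ (Ψ n f)) atTop (𝓝 (toL2 τ b)) := by
    intro f hf
    obtain ⟨y, hy⟩ := cauchySeq_tendsto_of_complete hf
    obtain ⟨b, rfl⟩ := h.exists_toL2_eq_of_tendsto (fun n => hΨ n f) hy
    exact ⟨b, hy⟩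
  -- The functions whose values at the approximants converge in `2`-norm to an element of `A`. Once
  -- this closed `*`-algebra contains the resolvent, it contains every `f * resolventBCF 1`.
  let K : StarSubalgebra ℂ (ℝ →ᵇ ℂ) :=
    { carrier := {f | ∃ b, Tendsto (fun n => toL2 τ (Ψ n f)) atTop (𝓝 (toL2 τ b))}
      mul_mem' := fun ⟨b, hb⟩ ⟨c, hc⟩ => ⟨b * c, hmul hb hc⟩
      add_mem' := fun ⟨b, hb⟩ ⟨c, hc⟩ => ⟨b + c, hadd hb hc⟩
      algebraMap_mem' := fun r => ⟨_, hscalar r⟩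
      star_mem' := fun ⟨b, hb⟩ => ⟨star b, hstar hb⟩ }
  have hK : IsClosed (K : Set (ℝ →ᵇ ℂ)) := by
    refine isClosed_of_closure_subset fun f hf => hex ?_
    rw [Metric.cauchySeq_iff']
    intro ε hε
    obtain ⟨g, ⟨b, hb⟩, hg⟩ := Metric.mem_closure_iff.1 hf (ε / 3) (by positivity)
    obtain ⟨N, hN⟩ := Metric.cauchySeq_iff'.1 hb.cauchySeq (ε / 3) (by positivity)
    have hfg : ∀ n, dist (toL2 τ (Ψ n f)) (toL2 τ (Ψ n g)) < ε / 3 := fun n => by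
      rw [dist_eq_norm, ← toL2_sub, ← map_sub]
      refine (norm_toL2_le h.map_one _).trans_lt ((hΨ n _).trans_lt ?_)
      rwa [← dist_eq_norm]
    refine ⟨N, fun n hn => ?_⟩
    have h1 := dist_triangle4 (toL2 τ (Ψ n f)) (toL2 τ (Ψ n g)) (toL2 τ (Ψ N g))
      (toL2 τ (Ψ N f))
    have h2 := hfg N
    rw [dist_comm] at h2
    linarith [hfg n, hN n hn]
  have h1K : resolventBCF 1 ∈ K := by
    refine hex ?_
    rw [Metric.cauchySeq_iff]
    intro ε hε
    obtain ⟨N, hN⟩ := Metric.cauchySeq_iff.1 hlim.cauchySeq ε hε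
    refine ⟨N, fun m hm n hn => lt_of_le_of_lt ?_ (hN m hm n hn)⟩
    have hr : ∀ n, ‖Ψ n (resolventBCF 1)‖ ≤ 1 := fun n =>
      (hΨ n _).trans (norm_resolventBCF_le 1)
    rw [dist_eq_norm, dist_eq_norm, ← toL2_sub, ← toL2_sub,
      selfAdjointCalculus_resolvent_sub (ha m) (ha n)]
    refine (norm_toL2_mul_right_le ht _ _).trans ?_
    refine (mul_le_of_le_one_right (norm_nonneg _) (hr n)).trans ?_
    refine (norm_toL2_mul_le τ _ _).trans ?_
    refine (mul_le_of_le_one_left (norm_nonneg _) (hr m)).trans ?_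
    rw [toL2_smul, norm_smul, norm_neg, Complex.norm_I, one_mul]
  -- For general `f`, write `f(aₙ) = (f r₁)(aₙ) (1 + i aₙ)` in `L²(A)`: the first factor is bounded
  -- and converges since `f r₁ ∈ K`, the second converges in `L²(A)`.
  have hall : ∀ f : ℝ →ᵇ ℂ, ∃ b, Tendsto (fun n => toL2 τ (Ψ n f)) atTop (𝓝 (toL2 τ b)) := by
    intro f
    obtain ⟨b, hb⟩ := mul_resolventBCF_mem K hK h1K f
    refine hex ?_
    have h2 := tendsto_gns_apply ht (fun n => hΨ n _) hb
      (tendsto_const_nhds (x := toL2 τ 1) |>.add (hlim.const_smul Complex.I))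
    refine Tendsto.cauchySeq (h2.congr fun n => ?_)
    exact (isFunctionalCalculus_selfAdjointCalculus (ha n)).gns_mul_resolvent f
  choose Φ hΦ using hall
  -- Faithfulness makes the limits unique in `A`, so each algebraic law passes from the approximants
  -- to `Φ`.
  have huniq : ∀ {f : ℝ →ᵇ ℂ} {b : A},
      Tendsto (fun n => toL2 τ (Ψ n f)) atTop (𝓝 (toL2 τ b)) → Φ f = b := fun hb =>
    toL2_injective h.faithful (tendsto_nhds_unique (hΦ _) hb)
  refine ⟨{ toFun := Φ
            map_one' := huniq (by simp)
            map_mul' := fun f g => huniq (hmul (hΦ f) (hΦ g))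
            map_zero' := huniq (by simp)
            map_add' := fun f g => huniq (hadd (hΦ f) (hΦ g))
            commutes' := fun r => huniq (hscalar r)
            map_star' := fun f => huniq (hstar (hΦ f)) }, fun f k hk => ?_⟩
  refine tendsto_nhds_unique (tendsto_gns_apply ht (fun n => hΨ n f) (hΦ f) hlim) ?_
  refine (hΦ k).congr fun n => ?_
  exact (isFunctionalCalculus_selfAdjointCalculus (ha n) f k hk).symm

end ExistenceOfCalculus

/-! ### The free Laplacian as a scalar integral -/

section ResolventContinuity

open Filter Topology MeasureTheory

theorem norm_idMulResolventBCF_le (s : ℝ) : ‖idMulResolventBCF s‖ ≤ |s|⁻¹ * 2 := by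
  rw [idMulResolventBCF, norm_smul, norm_inv, norm_mul, Complex.norm_I, one_mul,
    Complex.norm_real, Real.norm_eq_abs]
  gcongr
  have h1 : ‖(1 : BoundedContinuousFunction ℝ ℂ)‖ ≤ 1 := norm_one.le
  linarith [norm_sub_le (1 : BoundedContinuousFunction ℝ ℂ) (resolventBCF s),
    norm_resolventBCF_le s]

theorem resolventBCF_sub_resolventBCF (s : ℝ) {v : ℝ} (hv : v ≠ 0) :
    resolventBCF s - resolventBCF v =
      (Complex.I * (v - s : ℝ)) • (resolventBCF s * idMulResolventBCF v) := by
  ext t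
  have h1 := one_add_I_mul_ne_zero s t
  have h2 := one_add_I_mul_ne_zero v t
  simp only [BoundedContinuousFunction.coe_sub, BoundedContinuousFunction.coe_smul,
    BoundedContinuousFunction.coe_mul, Pi.sub_apply, Pi.mul_apply,
    idMulResolventBCF_apply hv, resolventBCF_apply, smul_eq_mul]
  rw [inv_sub_inv h1 h2, div_eq_mul_inv, mul_inv]
  push_cast
  ring

/-- The point `0` must be left out: `‖1 - resolventBCF s‖ = 1` for every `s ≠ 0`. The later
measurability arguments therefore work off this null set. -/
theorem continuousOn_resolventBCF : ContinuousOn resolventBCF {0}ᶜ := by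
  intro v hv
  refine ContinuousAt.continuousWithinAt ?_
  rw [ContinuousAt, tendsto_iff_norm_sub_tendsto_zero]
  have h : Tendsto (fun s : ℝ => |v - s| * (|v|⁻¹ * 2)) (𝓝 v) (𝓝 0) := by
    have : Tendsto (fun s : ℝ => |v - s| * (|v|⁻¹ * 2)) (𝓝 v) (𝓝 (|v - v| * (|v|⁻¹ * 2))) :=
      Continuous.tendsto (by fun_prop) v
    simpa using this
  refine squeeze_zero (fun _ => norm_nonneg _) (fun s => ?_) h
  rw [resolventBCF_sub_resolventBCF s hv, norm_smul, norm_mul, Complex.norm_I, one_mul,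
    Complex.norm_real, Real.norm_eq_abs]
  gcongr
  refine (norm_mul_le _ _).trans ?_
  exact (mul_le_of_le_one_left (norm_nonneg _) (norm_resolventBCF_le s)).trans
    (norm_idMulResolventBCF_le v)

theorem intervalIntegrable_of_continuousOn_compl_zero {E : Type*} [NormedAddCommGroup E]
    {f : ℝ → E} (hf : ContinuousOn f {0}ᶜ) {C : ℝ} (hC : ∀ s ∈ Set.Icc (-1 : ℝ) 1, ‖f s‖ ≤ C) :
    IntervalIntegrable f volume (-1) 1 := by
  rw [intervalIntegrable_iff_integrableOn_Ioc_of_le (by norm_num)]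
  refine IntegrableOn.of_bound (by simp) ?_ C ?_
  · have h1 := hf.aestronglyMeasurable (μ := volume) (measurableSet_singleton 0).compl
    rw [Measure.restrict_eq_self_of_ae_mem (by simp [ae_iff])] at h1
    exact h1.restrict
  · exact (ae_restrict_mem measurableSet_Ioc).mono fun s hs => hC s ⟨hs.1.le, hs.2⟩

theorem aestronglyMeasurable_of_continuousOn_compl_zero_prod {E : Type*} [NormedAddCommGroup E]
    {f : ℝ × ℝ → E} (hf : ContinuousOn f ({0}ᶜ ×ˢ {0}ᶜ)) (S T : Set ℝ) :
    AEStronglyMeasurable f ((volume.restrict S).prod (volume.restrict T)) := by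
  have h1 := hf.aestronglyMeasurable (μ := (volume : Measure ℝ).prod volume)
    ((measurableSet_singleton 0).compl.prod (measurableSet_singleton 0).compl)
  rw [← Measure.prod_restrict, Measure.restrict_eq_self_of_ae_mem (by simp [ae_iff])] at h1
  rw [Measure.prod_restrict]
  exact h1.restrict

end ResolventContinuity

/-! ### The functional `τ ⊗ τ` and sandwiched tensors. -/

section TensorTrace

variable {A : Type u} [CStarAlgebra A] [PartialOrder A] [StarOrderedRing A] (τ : A →ₚ[ℂ] ℂ)
  {d : ℕ}

/-- The functional `τ ⊗ τ` on the algebraic tensor product. -/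
noncomputable def tensorState : A ⊗[ℂ] A →ₗ[ℂ] ℂ :=
  LinearMap.mul' ℂ ℂ ∘ₗ TensorProduct.map τ.toLinearMap τ.toLinearMap

theorem tensorState_tmul (a b : A) : tensorState τ (a ⊗ₜ b) = τ a * τ b := rfl

/-- The canonical map `A ⊗ A → L²(A ⊗ A)` as a linear map. -/
noncomputable def toL2TensorLinear : A ⊗[ℂ] A →ₗ[ℂ] L2Tensor τ :=
  (UniformSpace.Completion.toComplₗᵢ (𝕜 := ℂ) (E := τ.GNS ⊗[ℂ] τ.GNS)).toLinearMap ∘ₗ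
    TensorProduct.map (toL2CLM τ).toLinearMap (toL2CLM τ).toLinearMap

theorem toL2Tensor_eq (z : A ⊗[ℂ] A) : toL2Tensor τ z = toL2TensorLinear τ z := rfl

theorem toL2Tensor_tmul (a b : A) :
    toL2Tensor τ (a ⊗ₜ b) = ((toL2 τ a ⊗ₜ[ℂ] toL2 τ b : τ.GNS ⊗[ℂ] τ.GNS) : L2Tensor τ) := rfl

theorem norm_toL2Tensor_tmul (a b : A) :
    ‖toL2Tensor τ (a ⊗ₜ b)‖ = ‖toL2 τ a‖ * ‖toL2 τ b‖ := by
  rw [toL2Tensor_tmul, UniformSpace.Completion.norm_coe, TensorProduct.norm_tmul]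

theorem tensorTrace_toL2Tensor (z : A ⊗[ℂ] A) :
    tensorTrace τ (toL2Tensor τ z) = tensorState τ z := by
  induction z with
  | zero => simp [toL2Tensor_eq, tensorTrace]
  | add x y hx hy =>
    rw [toL2Tensor_eq, map_add, map_add, ← hx, ← hy, tensorTrace, inner_add_right]
    rfl
  | tmul a b =>
    rw [tensorTrace, toL2Tensor_tmul, toL2Tensor_tmul, UniformSpace.Completion.inner_coe,
      TensorProduct.inner_tmul, inner_toL2, inner_toL2, star_one, one_mul, one_mul,
      tensorState_tmul]

theorem continuousOn_toL2Tensor_tmul {S : Type*} [TopologicalSpace S] {T : Set S} {f g : S → A}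
    (hf : ContinuousOn f T) (hg : ContinuousOn g T) :
    ContinuousOn (fun x => toL2Tensor τ (f x ⊗ₜ g x)) T := by
  have h1 : ContinuousOn (fun x => toL2 τ (f x)) T := (toL2CLM τ).continuous.comp_continuousOn hf
  have h2 : ContinuousOn (fun x => toL2 τ (g x)) T := (toL2CLM τ).continuous.comp_continuousOn hg
  have h3 : ContinuousOn (fun x => toL2 τ (f x) ⊗ₜ[ℂ] toL2 τ (g x)) T :=
    (TensorProduct.continuous_tmul ..).comp_continuousOn (h1.prodMk h2)
  simp only [toL2Tensor_tmul]
  exact (UniformSpace.Completion.continuous_coe _).comp_continuousOn h3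

/-- The image of `z` under `a ⊗ b ↦ r a(Y) ρ ⊗ ρ b(Y) r`. -/
noncomputable def sandwichTensor {A : Type*} [Ring A] [Algebra ℂ A] (Y : Fin d → A) (r ρ : A) :
    NCP d ⊗[ℂ] NCP d →ₗ[ℂ] A ⊗[ℂ] A :=
  LinearMap.mulRight ℂ ((1 : A) ⊗ₜ[ℂ] r) ∘ₗ LinearMap.mulLeft ℂ (r ⊗ₜ[ℂ] (1 : A)) ∘ₗ
    TensorProduct.map (LinearMap.mulRight ℂ ρ ∘ₗ (NCP.eval Y).toLinearMap)
      (LinearMap.mulLeft ℂ ρ ∘ₗ (NCP.eval Y).toLinearMap)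

theorem sandwichTensor_tmul {A : Type*} [Ring A] [Algebra ℂ A] (Y : Fin d → A) (r ρ : A)
    (p q : NCP d) : sandwichTensor Y r ρ (p ⊗ₜ q) =
      (r * (NCP.eval Y p * ρ)) ⊗ₜ (ρ * NCP.eval Y q * r) := by
  simp [sandwichTensor]

theorem sandwichTensor_freeDiff {A : Type u} [CStarAlgebra A] (Y : Fin d → A) (r ρ : A)
    (i : Fin d) (p : NCP d) :
    (r ⊗ₜ[ℂ] (1 : A)) * freeDiffInsert i p Y ρ * ((1 : A) ⊗ₜ[ℂ] r) =
      sandwichTensor Y r ρ (NCP.freeDiff i p) := rfl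

theorem continuousOn_toL2Tensor_sandwichTensor {S : Type*} [TopologicalSpace S] {T : Set S}
    {f g : S → A} (hf : ContinuousOn f T) (hg : ContinuousOn g T) (Y : Fin d → A)
    (z : NCP d ⊗[ℂ] NCP d) :
    ContinuousOn (fun x => toL2Tensor τ (sandwichTensor Y (f x) (g x) z)) T := by
  induction z with
  | zero => simpa only [map_zero] using continuousOn_const
  | add x y hx hy =>
    simp only [map_add, toL2Tensor_eq] at *
    exact hx.add hy
  | tmul a b =>
    simp only [sandwichTensor_tmul]
    exact continuousOn_toL2Tensor_tmul τ (by fun_prop) (by fun_prop)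

end TensorTrace

/-! ### Bounds that are uniform over all algebras. -/

section Bounds

variable {d : ℕ}

/-- A noncommutative polynomial is bounded on bounded sets, uniformly over all algebras. -/
theorem NCP.exists_norm_eval_le (M : ℝ) (p : NCP d) :
    ∃ C : ℝ, 0 ≤ C ∧ ∀ (A : Type u) [CStarAlgebra A] [Nontrivial A] (Y : Fin d → A), (∀ j, ‖Y j‖ ≤ M) →
      ‖NCP.eval Y p‖ ≤ C := by
  induction p using FreeAlgebra.induction with
  | grade0 r =>
    refine ⟨‖r‖, norm_nonneg _, fun A _ _ Y _ => ?_⟩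
    rw [AlgHom.commutes]
    exact (norm_algebraMap' A r).le
  | grade1 j =>
    refine ⟨|M|, abs_nonneg _, fun A _ _ Y hY => ?_⟩
    rw [NCP.eval, FreeAlgebra.lift_ι_apply]
    exact (hY j).trans (le_abs_self M)
  | mul p q hp hq =>
    obtain ⟨C, hC, hp⟩ := hp
    obtain ⟨D, hD, hq⟩ := hq
    refine ⟨C * D, by positivity, fun A _ _ Y hY => ?_⟩
    rw [map_mul]
    exact (norm_mul_le _ _).trans
      (mul_le_mul (hp A Y hY) (hq A Y hY) (norm_nonneg _) hC)
  | add p q hp hq =>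
    obtain ⟨C, hC, hp⟩ := hp
    obtain ⟨D, hD, hq⟩ := hq
    refine ⟨C + D, by positivity, fun A _ _ Y hY => ?_⟩
    rw [map_add]
    exact (norm_add_le _ _).trans (add_le_add (hp A Y hY) (hq A Y hY))

/-- The constant is chosen before the algebra and the state, so it dominates the integrands for all
matrix sizes at once. -/
theorem exists_norm_toL2Tensor_sandwichTensor_le (M : ℝ) (z : NCP d ⊗[ℂ] NCP d) :
    ∃ C : ℝ, 0 ≤ C ∧ ∀ (A : Type u) [CStarAlgebra A] [PartialOrder A] [StarOrderedRing A]
      [Nontrivial A] (τ : A →ₚ[ℂ] ℂ), τ 1 = 1 → ∀ (Y : Fin d → A) (r ρ : A), (∀ j, ‖Y j‖ ≤ M) →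
      ‖r‖ ≤ 1 → ‖ρ‖ ≤ 1 → ‖toL2Tensor τ (sandwichTensor Y r ρ z)‖ ≤ C := by
  induction z with
  | zero => exact ⟨0, le_rfl, fun A _ _ _ _ τ _ Y r ρ _ _ _ => by simp [toL2Tensor_eq]⟩
  | add x y hx hy =>
    obtain ⟨C, hC, hx⟩ := hx
    obtain ⟨D, hD, hy⟩ := hy
    refine ⟨C + D, by positivity, fun A _ _ _ _ τ h1 Y r ρ hY hr hρ => ?_⟩
    rw [map_add, toL2Tensor_eq, map_add]
    exact (norm_add_le _ _).trans
      (add_le_add (hx A τ h1 Y r ρ hY hr hρ) (hy A τ h1 Y r ρ hY hr hρ))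
  | tmul p q =>
    obtain ⟨C, hC, hp⟩ := NCP.exists_norm_eval_le.{u} M p
    obtain ⟨D, hD, hq⟩ := NCP.exists_norm_eval_le.{u} M q
    refine ⟨C * D, by positivity, fun A _ _ _ _ τ h1 Y r ρ hY hr hρ => ?_⟩
    rw [sandwichTensor_tmul, norm_toL2Tensor_tmul]
    refine mul_le_mul ((norm_toL2_le h1 _).trans ?_) ((norm_toL2_le h1 _).trans ?_)
      (norm_nonneg _) hC
    · calc ‖r * (NCP.eval Y p * ρ)‖ ≤ 1 * (C * 1) := by
            refine (norm_mul_le _ _).trans (mul_le_mul hr ?_ (norm_nonneg _) zero_le_one)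
            exact (norm_mul_le _ _).trans (mul_le_mul (hp A Y hY) hρ (norm_nonneg _) hC)
        _ = C := by ring
    · calc ‖ρ * NCP.eval Y q * r‖ ≤ (1 * D) * 1 := by
            refine (norm_mul_le _ _).trans (mul_le_mul ?_ hr (norm_nonneg _) (by positivity))
            exact (norm_mul_le _ _).trans (mul_le_mul hρ (hq A Y hY) (norm_nonneg _) zero_le_one)
        _ = D := by ring

end Bounds

/-! ### Integral formula for the free Laplacian of a tuple with a functional calculus. -/

section LaplacianDensity

open Filter Topology MeasureTheory
open scoped BoundedContinuousFunction

variable {A : Type u} [CStarAlgebra A] [PartialOrder A] [StarOrderedRing A] {τ : A →ₚ[ℂ] ℂ}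
  {d : ℕ}

theorem nontrivial_of_map_one {A : Type*} [Ring A] [PartialOrder A] [Module ℂ A]
    {τ : A →ₚ[ℂ] ℂ} (h1 : τ 1 = 1) : Nontrivial A := by
  refine ⟨1, 0, fun h => ?_⟩
  rw [h, map_zero] at h1
  exact zero_ne_one h1

/-- Every entry of the tuple `X` has a bounded continuous functional calculus. -/
def HasCalculus (X : Fin d → τ.GNS) : Prop :=
  ∀ j, ∃ Φ : (ℝ →ᵇ ℂ) →⋆ₐ[ℂ] A, ∀ f, funCalc τ (X j) f = Φ f

theorem HasCalculus.norm_arctanTuple_le {X : Fin d → τ.GNS} (hX : HasCalculus X) (j : Fin d) :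
    ‖arctanTuple τ X j‖ ≤ Real.pi / 2 := by
  obtain ⟨Φ, hΦ⟩ := hX j
  rw [arctanTuple, arctanL2, hΦ]
  exact (norm_starAlgHom_le Φ _).trans norm_arctanBCF_le

theorem HasCalculus.norm_resolventL2_le {X : Fin d → τ.GNS} (hX : HasCalculus X) (j : Fin d)
    (s : ℝ) : ‖resolventL2 τ (X j) s‖ ≤ 1 := by
  obtain ⟨Φ, hΦ⟩ := hX j
  rw [resolventL2, hΦ]
  exact (norm_starAlgHom_le Φ _).trans (norm_resolventBCF_le s)

theorem HasCalculus.continuousOn_resolventL2 {X : Fin d → τ.GNS} (hX : HasCalculus X) (j : Fin d) :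
    ContinuousOn (resolventL2 τ (X j)) {0}ᶜ := by
  obtain ⟨Φ, hΦ⟩ := hX j
  have : resolventL2 τ (X j) = fun s => Φ (resolventBCF s) := funext fun s => hΦ _
  rw [this]
  exact (continuous_starAlgHom Φ).comp_continuousOn continuousOn_resolventBCF

variable (τ) in
/-- The scalar integrand of `(τ ⊗ τ)(∂_{x_i} 𝒟°_{x_i}(φ ∘ arctan)(X))`. -/
noncomputable def laplacianDensity (i : Fin d) (φ : NCP d) (X : Fin d → τ.GNS) (s : ℝ) : ℂ :=
  -(Complex.I * (s : ℂ)) * (2 * (τ (resolventL2 τ (X i) s) * τ (resolventL2 τ (X i) s *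
      NCP.eval (arctanTuple τ X) (NCP.cyclicDeriv i φ) * resolventL2 τ (X i) s))) +
    (1 / 2 : ℂ) * ∫ v in (-1 : ℝ)..1, tensorState τ (sandwichTensor (arctanTuple τ X)
      (resolventL2 τ (X i) s) (resolventL2 τ (X i) v) (NCP.freeDiff i (NCP.cyclicDeriv i φ)))

theorem tensorTrace_eq_innerSL (Z : L2Tensor τ) :
    tensorTrace τ Z = innerSL ℂ (toL2Tensor τ (1 ⊗ₜ[ℂ] 1)) Z := rfl

theorem norm_tensorTrace_le (h1 : τ 1 = 1) (Z : L2Tensor τ) : ‖tensorTrace τ Z‖ ≤ ‖Z‖ := by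
  refine (norm_inner_le_norm _ _).trans ?_
  rw [norm_toL2Tensor_tmul, norm_toL2_one h1, one_mul, one_mul]

/-- The integrand of `freeDiffCyclicArctan`. -/
noncomputable def freeDiffCyclicDensity (i : Fin d) (φ : NCP d) (X : Fin d → τ.GNS) (s : ℝ) :
    L2Tensor τ :=
  (-(Complex.I * (s : ℂ))) • toL2Tensor τ (resolventL2 τ (X i) s ⊗ₜ[ℂ] (resolventL2 τ (X i) s *
      NCP.eval (arctanTuple τ X) (NCP.cyclicDeriv i φ) * resolventL2 τ (X i) s) +
      (resolventL2 τ (X i) s * NCP.eval (arctanTuple τ X) (NCP.cyclicDeriv i φ) *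
        resolventL2 τ (X i) s) ⊗ₜ[ℂ] resolventL2 τ (X i) s) +
    (1 / 2 : ℂ) • ∫ v in (-1 : ℝ)..1, toL2Tensor τ (sandwichTensor (arctanTuple τ X)
      (resolventL2 τ (X i) s) (resolventL2 τ (X i) v) (NCP.freeDiff i (NCP.cyclicDeriv i φ)))

theorem freeDiffCyclicArctan_self (i : Fin d) (φ : NCP d) (X : Fin d → τ.GNS) :
    freeDiffCyclicArctan τ i i φ X =
      (1 / 2 : ℂ) • ∫ s in (-1 : ℝ)..1, freeDiffCyclicDensity i φ X s := by
  simp only [freeDiffCyclicArctan, if_true, sandwichTensor_freeDiff, freeDiffCyclicDensity]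

theorem HasCalculus.intervalIntegrable_sandwich (h1 : τ 1 = 1) {X : Fin d → τ.GNS}
    (hX : HasCalculus X) (i : Fin d) (z : NCP d ⊗[ℂ] NCP d) (s : ℝ) :
    IntervalIntegrable (fun v => toL2Tensor τ (sandwichTensor (arctanTuple τ X)
      (resolventL2 τ (X i) s) (resolventL2 τ (X i) v) z)) volume (-1) 1 := by
  have := nontrivial_of_map_one h1
  obtain ⟨C, -, hC⟩ := exists_norm_toL2Tensor_sandwichTensor_le.{u} (Real.pi / 2) z
  exact intervalIntegrable_of_continuousOn_compl_zero
    (continuousOn_toL2Tensor_sandwichTensor τ continuousOn_const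
      (hX.continuousOn_resolventL2 i) _ z)
    (fun v _ => hC A τ h1 _ _ _ hX.norm_arctanTuple_le (hX.norm_resolventL2_le i s)
      (hX.norm_resolventL2_le i v))

theorem HasCalculus.tensorTrace_density (h1 : τ 1 = 1) {X : Fin d → τ.GNS}
    (hX : HasCalculus X) (i : Fin d) (φ : NCP d) (s : ℝ) :
    tensorTrace τ (freeDiffCyclicDensity i φ X s) = laplacianDensity τ i φ X s := by
  rw [freeDiffCyclicDensity, laplacianDensity, tensorTrace_eq_innerSL, map_add, map_smul,
    map_smul, ← ContinuousLinearMap.intervalIntegral_comp_comm _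
      (hX.intervalIntegrable_sandwich h1 i _ s)]
  simp only [← tensorTrace_eq_innerSL, tensorTrace_toL2Tensor, map_add, tensorState_tmul,
    smul_eq_mul]
  ring

theorem exists_norm_freeDiffCyclicDensity_le (i : Fin d) (φ : NCP d) :
    ∃ C : ℝ, 0 ≤ C ∧ ∀ (A : Type u) [CStarAlgebra A] [PartialOrder A] [StarOrderedRing A]
      (τ : A →ₚ[ℂ] ℂ), τ 1 = 1 → ∀ X : Fin d → τ.GNS, HasCalculus X →
      ∀ s ∈ Set.Icc (-1 : ℝ) 1, ‖freeDiffCyclicDensity i φ X s‖ ≤ C := by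
  obtain ⟨C, hC0, hC⟩ := exists_norm_toL2Tensor_sandwichTensor_le.{u} (Real.pi / 2)
    (NCP.freeDiff i (NCP.cyclicDeriv i φ))
  obtain ⟨D, hD0, hD⟩ := NCP.exists_norm_eval_le.{u} (Real.pi / 2) (NCP.cyclicDeriv i φ)
  -- `|s| ≤ 1` times two elementary tensors of norm at most `D`, plus `½` times `C` times the length
  -- `2` of the interval.
  refine ⟨1 * (D + D) + 1 / 2 * (C * 2), by positivity, fun A _ _ _ τ h1 X hX s hs => ?_⟩
  have := nontrivial_of_map_one h1
  have hr := hX.norm_resolventL2_le i s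
  have hW := hD A _ hX.norm_arctanTuple_le
  have hrW : ‖resolventL2 τ (X i) s * NCP.eval (arctanTuple τ X) (NCP.cyclicDeriv i φ) *
        resolventL2 τ (X i) s‖ ≤ D := by
    calc _ ≤ (1 * D) * 1 := by
          refine (norm_mul_le _ _).trans (mul_le_mul ?_ hr (norm_nonneg _) (by positivity))
          exact (norm_mul_le _ _).trans (mul_le_mul hr hW (norm_nonneg _) zero_le_one)
      _ = D := by ring
  rw [freeDiffCyclicDensity]
  refine (norm_add_le _ _).trans (add_le_add ?_ ?_)
  · rw [norm_smul]
    refine mul_le_mul ?_ ?_ (norm_nonneg _) zero_le_one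
    · rw [norm_neg, norm_mul, Complex.norm_I, one_mul, Complex.norm_real, Real.norm_eq_abs]
      exact abs_le.2 hs
    · rw [toL2Tensor_eq, map_add]
      refine (norm_add_le _ _).trans (add_le_add ?_ ?_)
      · rw [← toL2Tensor_eq, norm_toL2Tensor_tmul]
        exact (mul_le_mul ((norm_toL2_le h1 _).trans hr) ((norm_toL2_le h1 _).trans hrW)
          (norm_nonneg _) zero_le_one).trans_eq (one_mul D)
      · rw [← toL2Tensor_eq, norm_toL2Tensor_tmul]
        exact (mul_le_mul ((norm_toL2_le h1 _).trans hrW) ((norm_toL2_le h1 _).trans hr)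
          (norm_nonneg _) hD0).trans_eq (mul_one D)
  · rw [norm_smul]
    refine mul_le_mul (by norm_num) ?_ (norm_nonneg _) (by norm_num)
    refine (intervalIntegral.norm_integral_le_of_norm_le_const fun v _ =>
      hC A τ h1 _ _ _ hX.norm_arctanTuple_le hr (hX.norm_resolventL2_le i v)).trans_eq ?_
    norm_num

/-- The Leibniz terms at the outer resolvents are continuous off `s = 0`. The remaining one is an
integral over `v` of a function continuous off the two axes, so its measurability in `s` comes from
joint measurability. -/
theorem HasCalculus.aestronglyMeasurable_density {X : Fin d → τ.GNS}
    (hX : HasCalculus X) (i : Fin d) (φ : NCP d) :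
    AEStronglyMeasurable (freeDiffCyclicDensity i φ X) (volume.restrict (Set.Ioc (-1) 1)) := by
  have hr := hX.continuousOn_resolventL2 i
  have hrW : ContinuousOn (fun s => resolventL2 τ (X i) s *
      NCP.eval (arctanTuple τ X) (NCP.cyclicDeriv i φ) * resolventL2 τ (X i) s) {0}ᶜ := by
    fun_prop
  have hsplit : freeDiffCyclicDensity i φ X = (fun s : ℝ => (-(Complex.I * (s : ℂ))) •
      toL2Tensor τ (resolventL2 τ (X i) s ⊗ₜ[ℂ] (resolventL2 τ (X i) s *
        NCP.eval (arctanTuple τ X) (NCP.cyclicDeriv i φ) * resolventL2 τ (X i) s) +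
        (resolventL2 τ (X i) s * NCP.eval (arctanTuple τ X) (NCP.cyclicDeriv i φ) *
          resolventL2 τ (X i) s) ⊗ₜ[ℂ] resolventL2 τ (X i) s)) +
      (1 / 2 : ℂ) • fun s : ℝ => ∫ v in (-1 : ℝ)..1, toL2Tensor τ (sandwichTensor
        (arctanTuple τ X) (resolventL2 τ (X i) s) (resolventL2 τ (X i) v)
        (NCP.freeDiff i (NCP.cyclicDeriv i φ))) := rfl
  rw [hsplit]
  refine AEStronglyMeasurable.add ?_ (AEStronglyMeasurable.const_smul ?_ _)
  · have hI : Continuous fun s : ℝ => -(Complex.I * (s : ℂ)) := by fun_prop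
    have hc : ContinuousOn (fun s : ℝ => (-(Complex.I * (s : ℂ))) •
        (toL2Tensor τ (resolventL2 τ (X i) s ⊗ₜ[ℂ] (resolventL2 τ (X i) s *
          NCP.eval (arctanTuple τ X) (NCP.cyclicDeriv i φ) * resolventL2 τ (X i) s)) +
        toL2Tensor τ ((resolventL2 τ (X i) s *
          NCP.eval (arctanTuple τ X) (NCP.cyclicDeriv i φ) * resolventL2 τ (X i) s) ⊗ₜ[ℂ]
          resolventL2 τ (X i) s))) {0}ᶜ :=
      hI.continuousOn.smul
        ((continuousOn_toL2Tensor_tmul τ hr hrW).add (continuousOn_toL2Tensor_tmul τ hrW hr))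
    have h2 := hc.aestronglyMeasurable (μ := volume) (measurableSet_singleton 0).compl
    rw [Measure.restrict_eq_self_of_ae_mem (by simp [ae_iff])] at h2
    simpa only [toL2Tensor_eq, map_add] using h2.restrict
  · have h3 : ContinuousOn (fun x : ℝ × ℝ => toL2Tensor τ (sandwichTensor (arctanTuple τ X)
        (resolventL2 τ (X i) x.1) (resolventL2 τ (X i) x.2)
        (NCP.freeDiff i (NCP.cyclicDeriv i φ)))) ({0}ᶜ ×ˢ {0}ᶜ) :=
      continuousOn_toL2Tensor_sandwichTensor τ
        (hr.comp continuousOn_fst fun x hx => hx.1)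
        (hr.comp continuousOn_snd fun x hx => hx.2) _ _
    have h4 := (aestronglyMeasurable_of_continuousOn_compl_zero_prod h3 (Set.Ioc (-1) 1)
      (Set.Ioc (-1) 1)).integral_prod_right'
    simpa only [intervalIntegral.integral_of_le (show (-1 : ℝ) ≤ 1 by norm_num)] using h4

theorem HasCalculus.intervalIntegrable_density (h1 : τ 1 = 1) {X : Fin d → τ.GNS}
    (hX : HasCalculus X) (i : Fin d) (φ : NCP d) :
    IntervalIntegrable (freeDiffCyclicDensity i φ X) volume (-1) 1 := by
  obtain ⟨C, -, hC⟩ := exists_norm_freeDiffCyclicDensity_le.{u} i φ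
  rw [intervalIntegrable_iff_integrableOn_Ioc_of_le (by norm_num)]
  refine IntegrableOn.of_bound (by simp) (hX.aestronglyMeasurable_density i φ) C ?_
  exact (ae_restrict_mem measurableSet_Ioc).mono fun s hs => hC A τ h1 X hX s ⟨hs.1.le, hs.2⟩

theorem HasCalculus.tensorTrace_freeDiffCyclicArctan (h1 : τ 1 = 1) {X : Fin d → τ.GNS}
    (hX : HasCalculus X) (i : Fin d) (φ : NCP d) :
    tensorTrace τ (freeDiffCyclicArctan τ i i φ X) =
      (1 / 2 : ℂ) * ∫ s in (-1 : ℝ)..1, laplacianDensity τ i φ X s := by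
  rw [freeDiffCyclicArctan_self, tensorTrace_eq_innerSL, map_smul,
    ← ContinuousLinearMap.intervalIntegral_comp_comm _ (hX.intervalIntegrable_density h1 i φ)]
  simp only [← tensorTrace_eq_innerSL, hX.tensorTrace_density h1, smul_eq_mul]

theorem HasCalculus.aestronglyMeasurable_laplacianDensity (h1 : τ 1 = 1) {X : Fin d → τ.GNS}
    (hX : HasCalculus X) (i : Fin d) (φ : NCP d) :
    AEStronglyMeasurable (laplacianDensity τ i φ X) (volume.restrict (Set.Ioc (-1) 1)) := by
  have h := (innerSL ℂ (toL2Tensor τ (1 ⊗ₜ[ℂ] 1))).continuous.comp_aestronglyMeasurable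
    (hX.aestronglyMeasurable_density i φ)
  exact h.congr (ae_of_all _ fun s => hX.tensorTrace_density h1 i φ s)

theorem exists_norm_laplacianDensity_le (i : Fin d) (φ : NCP d) :
    ∃ C : ℝ, 0 ≤ C ∧ ∀ (A : Type u) [CStarAlgebra A] [PartialOrder A] [StarOrderedRing A]
      (τ : A →ₚ[ℂ] ℂ), τ 1 = 1 → ∀ X : Fin d → τ.GNS, HasCalculus X →
      ∀ s ∈ Set.Icc (-1 : ℝ) 1, ‖laplacianDensity τ i φ X s‖ ≤ C := by
  obtain ⟨C, hC0, hC⟩ := exists_norm_freeDiffCyclicDensity_le.{u} i φ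
  refine ⟨C, hC0, fun A _ _ _ τ h1 X hX s hs => ?_⟩
  rw [← hX.tensorTrace_density h1]
  exact (norm_tensorTrace_le h1 _).trans (hC A τ h1 X hX s hs)

theorem HasCalculus.freeLaplacian_eq (h1 : τ 1 = 1) {X : Fin d → τ.GNS} (hX : HasCalculus X)
    {m : ℕ} (g : (Fin m → ℝ) → ℝ) (φ : Fin m → NCP d) :
    freeLaplacian τ g φ X = ∑ i, ∑ o, (partialDeriv g o (cylArgs τ φ X) : ℂ) *
      ((1 / 2 : ℂ) * ∫ s in (-1 : ℝ)..1, laplacianDensity τ i (φ o) X s) := by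
  simp only [freeLaplacian, ncDerivGradient, ← hX.tensorTrace_freeDiffCyclicArctan h1]
  simp only [tensorTrace_eq_innerSL, map_sum, map_smul, smul_eq_mul]

end LaplacianDensity

/-! ### Resolvents as limits of polynomials in `arctan` -/

section ArctanPolynomials

open Filter Topology
open scoped BoundedContinuousFunction

/-- The polynomials in `arctan`, as a `*`-subalgebra of `C_b(ℝ)`. -/
noncomputable def arctanPolynomials : StarSubalgebra ℂ (ℝ →ᵇ ℂ) :=
  { (Polynomial.aeval (R := ℂ) arctanBCF).range with
    star_mem' := by
      rintro _ ⟨P, rfl⟩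
      -- `arctan` is real, so taking adjoints only conjugates the coefficients.
      refine ⟨P.map (starRingEnd ℂ), ?_⟩
      induction P using Polynomial.induction_on' with
      | add P Q hP hQ =>
        simp only [AlgHom.toRingHom_eq_coe, RingHom.coe_coe, Polynomial.map_add, map_add,
          star_add] at *
        rw [hP, hQ]
      | monomial n c =>
        simp [Polynomial.aeval_monomial, star_arctanBCF, Algebra.algebraMap_eq_smul_one] }

theorem mem_arctanPolynomials {f : ℝ →ᵇ ℂ} :
    f ∈ arctanPolynomials ↔ ∃ P : Polynomial ℂ, Polynomial.aeval arctanBCF P = f := Iff.rfl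

theorem arctan_mem_Icc (t : ℝ) : Real.arctan t ∈ Set.Icc (-(Real.pi / 2)) (Real.pi / 2) :=
  ⟨(Real.neg_pi_div_two_lt_arctan t).le, (Real.arctan_lt_pi_div_two t).le⟩

/-- Composition with `arctan`. -/
noncomputable def compArctan : C(Set.Icc (-(Real.pi / 2)) (Real.pi / 2), ℂ) →⋆ₐ[ℂ] (ℝ →ᵇ ℂ) where
  toFun f := BoundedContinuousFunction.ofNormedAddCommGroup
    (fun t : ℝ => f ⟨Real.arctan t, arctan_mem_Icc t⟩)
    (f.continuous.comp (Real.continuous_arctan.subtype_mk _)) ‖f‖ (fun _ => f.norm_coe_le_norm _)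
  map_one' := rfl
  map_mul' _ _ := rfl
  map_zero' := rfl
  map_add' _ _ := rfl
  commutes' _ := rfl
  map_star' _ := rfl

theorem compArctan_apply (f : C(Set.Icc (-(Real.pi / 2)) (Real.pi / 2), ℂ)) (t : ℝ) :
    compArctan f t = f ⟨Real.arctan t, arctan_mem_Icc t⟩ := rfl

/-- Stone–Weierstrass on `[-π/2, π/2]`: the coordinate function, whose composition with `arctan` is
`arctan` itself, separates points. -/
theorem compArctan_mem_closure (f : C(Set.Icc (-(Real.pi / 2)) (Real.pi / 2), ℂ)) :
    compArctan f ∈ arctanPolynomials.topologicalClosure := by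
  have hcont : Continuous compArctan :=
    AddMonoidHomClass.continuous_of_bound compArctan 1
      fun f => by simpa using NonUnitalStarAlgHom.norm_apply_le compArctan f
  have hclosed : IsClosed (arctanPolynomials.topologicalClosure.comap compArctan :
      Set C(Set.Icc (-(Real.pi / 2)) (Real.pi / 2), ℂ)) :=
    (StarSubalgebra.isClosed_topologicalClosure _).preimage hcont
  have hsep : (arctanPolynomials.topologicalClosure.comap compArctan).SeparatesPoints := by
    let F : C(Set.Icc (-(Real.pi / 2)) (Real.pi / 2), ℂ) := ⟨fun y => ((y : ℝ) : ℂ), by fun_prop⟩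
    intro x y hxy
    refine ⟨F, ⟨F, ?_, rfl⟩, fun hFxy => hxy (Subtype.ext (Complex.ofReal_injective hFxy))⟩
    refine StarSubalgebra.le_topologicalClosure _ (mem_arctanPolynomials.2 ⟨Polynomial.X, ?_⟩)
    rw [Polynomial.aeval_X]
    rfl
  have htop : arctanPolynomials.topologicalClosure.comap compArctan = ⊤ := by
    rw [← ContinuousMap.starSubalgebra_topologicalClosure_eq_top_of_separatesPoints _ hsep]
    exact SetLike.coe_injective (by
      rw [StarSubalgebra.topologicalClosure_coe, hclosed.closure_eq])
  have : f ∈ arctanPolynomials.topologicalClosure.comap compArctan :=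
    htop ▸ StarSubalgebra.mem_top
  exact this

/-- With `y = arctan t`, `(1 + i s t)⁻¹ = cos y / (cos y + i s sin y)`. For `s ≠ 0` the denominator
never vanishes, so this is continuous up to `y = ±π/2`; for `s = 0` the function is the constant
`1`. -/
theorem resolventBCF_mem_closure (s : ℝ) :
    resolventBCF s ∈ arctanPolynomials.topologicalClosure := by
  rcases eq_or_ne s 0 with rfl | hs
  · rw [resolventBCF_zero]
    exact one_mem _
  have hne : ∀ y : ℝ, (Real.cos y : ℂ) + Complex.I * s * Real.sin y ≠ 0 := by
    intro y h
    have hre := congrArg Complex.re h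
    have him := congrArg Complex.im h
    simp only [Complex.add_re, Complex.add_im, Complex.mul_re, Complex.mul_im, Complex.I_re,
      Complex.I_im, Complex.ofReal_re, Complex.ofReal_im, Complex.zero_re, Complex.zero_im] at hre him
    have h1 : Real.cos y = 0 := by linarith
    have h2 : s * Real.sin y = 0 := by linarith
    have h3 : Real.sin y = 0 := (mul_eq_zero.1 h2).resolve_left hs
    have := Real.sin_sq_add_cos_sq y
    rw [h1, h3] at this
    norm_num at this
  let F : C(Set.Icc (-(Real.pi / 2)) (Real.pi / 2), ℂ) :=
    ⟨fun y => (Real.cos y : ℂ) / (Real.cos y + Complex.I * s * Real.sin y),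
      Continuous.div (by fun_prop) (by fun_prop) fun y => hne y⟩
  have hF : resolventBCF s = compArctan F := by
    ext t
    have hc : (Real.cos (Real.arctan t) : ℂ) ≠ 0 := by
      exact_mod_cast (Real.cos_arctan_pos t).ne'
    have hst : (Real.sin (Real.arctan t) : ℂ) = t * Real.cos (Real.arctan t) := by
      have h := Real.tan_mul_cos (Real.cos_arctan_pos t).ne'
      rw [Real.tan_arctan] at h
      exact_mod_cast h.symm
    have h1 := one_add_I_mul_ne_zero s t
    rw [compArctan_apply, resolventBCF_apply]
    simp only [F, ContinuousMap.coe_mk]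
    rw [hst]
    generalize (Real.cos (Real.arctan t) : ℂ) = c at *
    rw [show c + Complex.I * s * (t * c) = c * (1 + Complex.I * s * t) by ring,
      div_mul_eq_div_div, div_self hc, one_div]
  rw [hF]
  exact compArctan_mem_closure F

end ArctanPolynomials

/-! ### The free Laplacian is continuous with respect to convergence in law -/

section LimitInLaw

open Filter Topology MeasureTheory
open scoped BoundedContinuousFunction

variable {d : ℕ} {B : ℕ → Type v} [∀ n, CStarAlgebra (B n)] [∀ n, PartialOrder (B n)]
  [∀ n, StarOrderedRing (B n)] {σ : ∀ n, B n →ₚ[ℂ] ℂ} {Z : ∀ n, Fin d → (σ n).GNS}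
  {A : Type u} [CStarAlgebra A] [PartialOrder A] [StarOrderedRing A] {τ : A →ₚ[ℂ] ℂ}
  {X : Fin d → τ.GNS}

theorem eval_aeval_ι {A : Type*} [Ring A] [Algebra ℂ A] (Y : Fin d → A) (i : Fin d)
    (P : Polynomial ℂ) :
    NCP.eval Y (Polynomial.aeval (FreeAlgebra.ι ℂ i) P) = Polynomial.aeval (Y i) P := by
  rw [← Polynomial.aeval_algHom_apply, NCP.eval, FreeAlgebra.lift_ι_apply]

/-- Since `arctan X` is defined through the same chosen homomorphism, no uniqueness of the calculus
on `L²(A)_sa` is needed. -/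
theorem HasCalculus.funCalc_aeval (hX : HasCalculus X) (i : Fin d) (P : Polynomial ℂ) :
    funCalc τ (X i) (Polynomial.aeval arctanBCF P) =
      NCP.eval (arctanTuple τ X) (Polynomial.aeval (FreeAlgebra.ι ℂ i) P) := by
  obtain ⟨Φ, hΦ⟩ := hX i
  rw [eval_aeval_ι, arctanTuple, arctanL2, hΦ, hΦ, Polynomial.aeval_algHom_apply]

theorem HasCalculus.norm_eval_mul_funCalc_sub_le (h1 : τ 1 = 1) (hX : HasCalculus X) (i : Fin d)
    {p : NCP d} {C : ℝ} (hC : ‖NCP.eval (arctanTuple τ X) p‖ ≤ C) (h k : ℝ →ᵇ ℂ) :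
    ‖τ (NCP.eval (arctanTuple τ X) p * funCalc τ (X i) h) -
      τ (NCP.eval (arctanTuple τ X) p * funCalc τ (X i) k)‖ ≤ C * ‖h - k‖ := by
  obtain ⟨Φ, hΦ⟩ := hX i
  rw [hΦ, hΦ, ← map_sub, ← mul_sub, ← map_sub]
  refine (norm_state_apply_le h1 _).trans ((norm_mul_le _ _).trans ?_)
  exact mul_le_mul hC (norm_starAlgHom_le Φ _) (norm_nonneg _) ((norm_nonneg _).trans hC)

/-- Approximate `h` uniformly by a polynomial in `arctan`, for which the claim is convergence in
law. The approximation error is uniform in `n`, as every calculus is contractive and `p(arctan Z n)`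
is bounded independently of `n`. -/
theorem tendsto_eval_mul_funCalc (hσ : ∀ n, σ n 1 = 1) (h1 : τ 1 = 1)
    (hZ : ∀ n, HasCalculus (Z n)) (hX : HasCalculus X)
    (hlaw : ∀ p, Tendsto (fun n => arctanLaw (σ n) (Z n) p) atTop (𝓝 (arctanLaw τ X p)))
    {h : ℝ →ᵇ ℂ} (hh : h ∈ arctanPolynomials.topologicalClosure) (i : Fin d) (p : NCP d) :
    Tendsto (fun n => σ n (NCP.eval (arctanTuple (σ n) (Z n)) p * funCalc (σ n) (Z n i) h)) atTop
      (𝓝 (τ (NCP.eval (arctanTuple τ X) p * funCalc τ (X i) h))) := by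
  obtain ⟨C, hC0, hC⟩ := NCP.exists_norm_eval_le.{v} (Real.pi / 2) p
  obtain ⟨D, hD0, hD⟩ := NCP.exists_norm_eval_le.{u} (Real.pi / 2) p
  have := nontrivial_of_map_one h1
  have := fun n => nontrivial_of_map_one (hσ n)
  rw [Metric.tendsto_atTop]
  intro ε hε
  obtain ⟨k, hk, hhk⟩ := Metric.mem_closure_iff.1 hh (ε / (3 * (C + D + 1))) (by positivity)
  obtain ⟨P, rfl⟩ := mem_arctanPolynomials.1 hk
  have hlim := hlaw (p * Polynomial.aeval (FreeAlgebra.ι ℂ i) P)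
  simp only [arctanLaw, map_mul] at hlim
  simp only [← (hZ _).funCalc_aeval, ← hX.funCalc_aeval] at hlim
  obtain ⟨N, hN⟩ := Metric.tendsto_atTop.1 hlim (ε / 3) (by positivity)
  refine ⟨N, fun n hn => ?_⟩
  have e1 := (hZ n).norm_eval_mul_funCalc_sub_le (hσ n) i
    (hC (B n) _ (hZ n).norm_arctanTuple_le) h (Polynomial.aeval arctanBCF P)
  have e2 := hX.norm_eval_mul_funCalc_sub_le h1 i
    (hD A _ hX.norm_arctanTuple_le) h (Polynomial.aeval arctanBCF P)
  rw [dist_eq_norm] at hhk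
  have key : ∀ r, 0 ≤ r → r ≤ C + D → r * ‖h - Polynomial.aeval arctanBCF P‖ ≤ ε / 3 := by
    intro r hr hr'
    calc r * ‖h - Polynomial.aeval arctanBCF P‖
        ≤ (C + D + 1) * (ε / (3 * (C + D + 1))) :=
          mul_le_mul (by linarith) hhk.le (norm_nonneg _) (by positivity)
      _ = ε / 3 := by field_simp
  have k1 := key C hC0 (by linarith)
  have k2 := key D hD0 (by linarith)
  rw [← dist_eq_norm] at e1 e2
  rw [dist_comm] at e2
  have := dist_triangle4
    (σ n (NCP.eval (arctanTuple (σ n) (Z n)) p * funCalc (σ n) (Z n i) h))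
    (σ n (NCP.eval (arctanTuple (σ n) (Z n)) p * funCalc (σ n) (Z n i)
      (Polynomial.aeval arctanBCF P)))
    (τ (NCP.eval (arctanTuple τ X) p * funCalc τ (X i) (Polynomial.aeval arctanBCF P)))
    (τ (NCP.eval (arctanTuple τ X) p * funCalc τ (X i) h))
  linarith [hN n hn]

/-- Traciality brings the two resolvents together into a single function of `X i`. -/
theorem HasCalculus.state_sandwich (ht : ∀ a b : A, τ (a * b) = τ (b * a)) (hX : HasCalculus X)
    (i : Fin d) (s v : ℝ) (a : A) :
    τ (resolventL2 τ (X i) s * a * resolventL2 τ (X i) v) =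
      τ (a * funCalc τ (X i) (resolventBCF v * resolventBCF s)) := by
  obtain ⟨Φ, hΦ⟩ := hX i
  rw [resolventL2, resolventL2, hΦ, hΦ, hΦ, mul_assoc, ht, map_mul Φ, mul_assoc]

theorem tendsto_state_sandwich (hσ : ∀ n, σ n 1 = 1) (h1 : τ 1 = 1)
    (htσ : ∀ n, ∀ a b : B n, σ n (a * b) = σ n (b * a)) (ht : ∀ a b : A, τ (a * b) = τ (b * a))
    (hZ : ∀ n, HasCalculus (Z n)) (hX : HasCalculus X)
    (hlaw : ∀ p, Tendsto (fun n => arctanLaw (σ n) (Z n) p) atTop (𝓝 (arctanLaw τ X p)))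
    (i : Fin d) (s v : ℝ) (p : NCP d) :
    Tendsto (fun n => σ n (resolventL2 (σ n) (Z n i) s *
        NCP.eval (arctanTuple (σ n) (Z n)) p * resolventL2 (σ n) (Z n i) v)) atTop
      (𝓝 (τ (resolventL2 τ (X i) s * NCP.eval (arctanTuple τ X) p * resolventL2 τ (X i) v))) := by
  simp only [(hZ _).state_sandwich (htσ _), hX.state_sandwich ht]
  exact tendsto_eval_mul_funCalc hσ h1 hZ hX hlaw
    (mul_mem (resolventBCF_mem_closure v) (resolventBCF_mem_closure s)) i p

theorem tendsto_tensorState_sandwich (hσ : ∀ n, σ n 1 = 1) (h1 : τ 1 = 1)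
    (htσ : ∀ n, ∀ a b : B n, σ n (a * b) = σ n (b * a)) (ht : ∀ a b : A, τ (a * b) = τ (b * a))
    (hZ : ∀ n, HasCalculus (Z n)) (hX : HasCalculus X)
    (hlaw : ∀ p, Tendsto (fun n => arctanLaw (σ n) (Z n) p) atTop (𝓝 (arctanLaw τ X p)))
    (i : Fin d) (s v : ℝ) (z : NCP d ⊗[ℂ] NCP d) :
    Tendsto (fun n => tensorState (σ n) (sandwichTensor (arctanTuple (σ n) (Z n))
        (resolventL2 (σ n) (Z n i) s) (resolventL2 (σ n) (Z n i) v) z)) atTop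
      (𝓝 (tensorState τ (sandwichTensor (arctanTuple τ X)
        (resolventL2 τ (X i) s) (resolventL2 τ (X i) v) z))) := by
  induction z with
  | zero => simp only [map_zero, tendsto_const_nhds_iff]
  | add x y hx hy => simpa only [map_add] using hx.add hy
  | tmul a b =>
    simp only [sandwichTensor_tmul, tensorState_tmul, ← mul_assoc]
    exact (tendsto_state_sandwich hσ h1 htσ ht hZ hX hlaw i s v a).mul
      (tendsto_state_sandwich hσ h1 htσ ht hZ hX hlaw i v s b)

theorem tendsto_laplacianDensity (hσ : ∀ n, σ n 1 = 1) (h1 : τ 1 = 1)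
    (htσ : ∀ n, ∀ a b : B n, σ n (a * b) = σ n (b * a)) (ht : ∀ a b : A, τ (a * b) = τ (b * a))
    (hZ : ∀ n, HasCalculus (Z n)) (hX : HasCalculus X)
    (hlaw : ∀ p, Tendsto (fun n => arctanLaw (σ n) (Z n) p) atTop (𝓝 (arctanLaw τ X p)))
    (i : Fin d) (φ : NCP d) (s : ℝ) :
    Tendsto (fun n => laplacianDensity (σ n) i φ (Z n) s) atTop
      (𝓝 (laplacianDensity τ i φ X s)) := by
  have := fun n => nontrivial_of_map_one (hσ n)
  obtain ⟨C, -, hC⟩ := exists_norm_toL2Tensor_sandwichTensor_le.{v} (Real.pi / 2)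
    (NCP.freeDiff i (NCP.cyclicDeriv i φ))
  have hr : Tendsto (fun n => σ n (resolventL2 (σ n) (Z n i) s)) atTop
      (𝓝 (τ (resolventL2 τ (X i) s))) := by
    simpa only [map_one, one_mul, resolventL2] using
      tendsto_eval_mul_funCalc hσ h1 hZ hX hlaw (resolventBCF_mem_closure s) i 1
  refine Tendsto.add (((hr.mul
    (tendsto_state_sandwich hσ h1 htσ ht hZ hX hlaw i s s _)).const_mul 2).const_mul _)
    (Tendsto.const_mul _ ?_)
  refine intervalIntegral.tendsto_integral_filter_of_dominated_convergence (fun _ => C)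
    (Eventually.of_forall fun n => ?_)
    (Eventually.of_forall fun n => Eventually.of_forall fun v _ => ?_)
    intervalIntegrable_const
    (Eventually.of_forall fun v _ =>
      tendsto_tensorState_sandwich hσ h1 htσ ht hZ hX hlaw i s v _)
  · simp only [← tensorTrace_toL2Tensor, tensorTrace_eq_innerSL]
    rw [Set.uIoc_of_le (by norm_num)]
    have h := ((hZ n).intervalIntegrable_sandwich (hσ n) i
      (NCP.freeDiff i (NCP.cyclicDeriv i φ)) s).aestronglyMeasurable
    exact (innerSL ℂ _).continuous.comp_aestronglyMeasurable h
  · rw [← tensorTrace_toL2Tensor]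
    exact (norm_tensorTrace_le (hσ n) _).trans (hC (B n) (σ n) (hσ n) _ _ _
      (hZ n).norm_arctanTuple_le ((hZ n).norm_resolventL2_le i s)
      ((hZ n).norm_resolventL2_le i v))

theorem tendsto_cylArgs {m : ℕ} (φ : Fin m → NCP d)
    (hlaw : ∀ p, Tendsto (fun n => arctanLaw (σ n) (Z n) p) atTop (𝓝 (arctanLaw τ X p))) :
    Tendsto (fun n => cylArgs (σ n) φ (Z n)) atTop (𝓝 (cylArgs τ φ X)) :=
  tendsto_pi_nhds.2 fun o => (Complex.continuous_re.tendsto _).comp (hlaw (φ o))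

theorem continuous_partialDeriv {m : ℕ} {g : (Fin m → ℝ) → ℝ} (hg : ContDiff ℝ 1 g) (o : Fin m) :
    Continuous (partialDeriv g o) :=
  (hg.continuous_fderiv one_ne_zero).clm_apply continuous_const

theorem tendsto_freeLaplacian (hσ : ∀ n, σ n 1 = 1) (h1 : τ 1 = 1)
    (htσ : ∀ n, ∀ a b : B n, σ n (a * b) = σ n (b * a)) (ht : ∀ a b : A, τ (a * b) = τ (b * a))
    (hZ : ∀ n, HasCalculus (Z n)) (hX : HasCalculus X)
    (hlaw : ∀ p, Tendsto (fun n => arctanLaw (σ n) (Z n) p) atTop (𝓝 (arctanLaw τ X p)))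
    {m : ℕ} {g : (Fin m → ℝ) → ℝ} (hg : ContDiff ℝ 1 g) (φ : Fin m → NCP d) :
    Tendsto (fun n => freeLaplacian (σ n) g φ (Z n)) atTop (𝓝 (freeLaplacian τ g φ X)) := by
  simp only [(hZ _).freeLaplacian_eq (hσ _), hX.freeLaplacian_eq h1]
  refine tendsto_finsetSum _ fun i _ => tendsto_finsetSum _ fun o _ => Tendsto.mul ?_ ?_
  · exact (Complex.continuous_ofReal.tendsto _).comp
      (((continuous_partialDeriv hg o).tendsto _).comp (tendsto_cylArgs φ hlaw))
  · obtain ⟨C, -, hC⟩ := exists_norm_laplacianDensity_le.{v} i (φ o)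
    refine Tendsto.const_mul _ ?_
    refine intervalIntegral.tendsto_integral_filter_of_dominated_convergence (fun _ => C)
      (Eventually.of_forall fun n => ?_)
      (Eventually.of_forall fun n => Eventually.of_forall fun s hs => ?_)
      intervalIntegrable_const
      (Eventually.of_forall fun s _ =>
        tendsto_laplacianDensity hσ h1 htσ ht hZ hX hlaw i (φ o) s)
    · rw [Set.uIoc_of_le (by norm_num)]
      exact (hZ n).aestronglyMeasurable_laplacianDensity (hσ n) i (φ o)
    · rw [Set.uIoc_of_le (by norm_num)] at hs
      exact hC (B n) (σ n) (hσ n) (Z n) (hZ n) s ⟨hs.1.le, hs.2⟩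

end LimitInLaw

/-! ### Differentiation of `arctan` on the self-adjoint part of a `C*`-algebra

The resolvents `s ↦ (1 + i s a)⁻¹`, `s ∈ [-1, 1]`, form an element of the Banach algebra
`C([-1, 1], A)`, namely the inverse of an element that is affine in `a`. -/

section ResolventPath

open Filter Topology MeasureTheory

variable {A : Type*} [CStarAlgebra A]

/-- The Banach algebra `C([-1, 1], A)`. -/
abbrev PathAlgebra (A : Type*) [TopologicalSpace A] : Type _ := C(Set.Icc (-1 : ℝ) 1, A)

/-- Constant paths. -/
noncomputable def constPath : A →L[ℝ] PathAlgebra A :=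
  LinearMap.mkContinuous
    { toFun := ContinuousMap.const _
      map_add' := fun _ _ => rfl
      map_smul' := fun _ _ => rfl } 1 fun a => by
    rw [one_mul]
    exact (ContinuousMap.norm_le _ (norm_nonneg a)).2 fun _ => le_rfl

theorem constPath_apply (a : A) (s : Set.Icc (-1 : ℝ) 1) : constPath a s = a := rfl

/-- The scalar path `s ↦ i s`. -/
noncomputable def imaginaryPath (A : Type*) [CStarAlgebra A] : PathAlgebra A :=
  ⟨fun s => (Complex.I * (s : ℝ)) • (1 : A), by fun_prop⟩

theorem imaginaryPath_apply (s : Set.Icc (-1 : ℝ) 1) :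
    imaginaryPath A s = (Complex.I * (s : ℝ)) • (1 : A) := rfl

theorem imaginaryPath_mul_apply (x : PathAlgebra A) (s : Set.Icc (-1 : ℝ) 1) :
    (imaginaryPath A * x) s = (Complex.I * (s : ℝ)) • x s := by
  simp [imaginaryPath]

theorem imaginaryPath_comm (x : PathAlgebra A) : imaginaryPath A * x = x * imaginaryPath A := by
  ext s
  simp [imaginaryPath]

/-- The path `s ↦ 1 + i s a`. -/
noncomputable def pencil (a : A) : PathAlgebra A := 1 + imaginaryPath A * constPath a

theorem pencil_apply (a : A) (s : Set.Icc (-1 : ℝ) 1) :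
    pencil a s = 1 + (Complex.I * (s : ℝ)) • a := by
  rw [pencil, ContinuousMap.add_apply, imaginaryPath_mul_apply, constPath_apply,
    ContinuousMap.one_apply]

theorem isUnit_pencil {a : A} (ha : IsSelfAdjoint a) : IsUnit (pencil a) := by
  rw [ContinuousMap.isUnit_iff_forall_isUnit]
  intro s
  rw [pencil_apply]
  exact ⟨⟨_, _, mul_resolvent_eq_one ha (selfAdjointCalculus_mul ha) s,
    resolvent_mul_eq_one (selfAdjointCalculus_mul ha) s⟩, rfl⟩

/-- The path `s ↦ (1 + i s a)⁻¹`. -/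
noncomputable def resolventPath (a : A) : PathAlgebra A := Ring.inverse (pencil a)

theorem resolventPath_mul_pencil {a : A} (ha : IsSelfAdjoint a) :
    resolventPath a * pencil a = 1 :=
  Ring.inverse_mul_cancel _ (isUnit_pencil ha)

theorem resolventPath_apply {a : A} (ha : IsSelfAdjoint a) (s : Set.Icc (-1 : ℝ) 1) :
    resolventPath a s = selfAdjointCalculus ha (resolventBCF s) := by
  refine left_inv_eq_right_inv (a := pencil a s) ?_ ?_
  · exact DFunLike.congr_fun (resolventPath_mul_pencil ha) s
  · rw [pencil_apply]
    exact mul_resolvent_eq_one ha (selfAdjointCalculus_mul ha) s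

/-- The averaging map `x ↦ ½ ∫_{-1}^{1} x(s) ds`. -/
noncomputable def pathMean : PathAlgebra A →L[ℝ] A :=
  LinearMap.mkContinuous
    { toFun := fun x => (1 / 2 : ℝ) • ∫ s in (-1 : ℝ)..1, x (Set.projIcc (-1) 1 (by norm_num) s)
      map_add' := fun x y => by
        rw [← smul_add, ← intervalIntegral.integral_add]
        · rfl
        all_goals exact Continuous.intervalIntegrable (by fun_prop) _ _
      map_smul' := fun c x => by
        simp only [ContinuousMap.smul_apply, intervalIntegral.integral_smul, RingHom.id_apply]
        rw [smul_comm] } 1 fun x => by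
    have h := intervalIntegral.norm_integral_le_of_norm_le_const (a := -1) (b := 1) (C := ‖x‖)
      (f := fun s => x (Set.projIcc (-1) 1 (by norm_num) s)) fun s _ => x.norm_coe_le_norm _
    simp only [LinearMap.coe_mk, AddHom.coe_mk, norm_smul]
    norm_num at h ⊢
    linarith

theorem pathMean_eq (x : PathAlgebra A) :
    pathMean x = (1 / 2 : ℝ) • ∫ s in (-1 : ℝ)..1, x (Set.projIcc (-1) 1 (by norm_num) s) := rfl

theorem continuous_path_projIcc {B : Type*} [TopologicalSpace B] (x : PathAlgebra B) :
    Continuous fun s : ℝ => x (Set.projIcc (-1) 1 (by norm_num) s) := by fun_prop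

/-- Passes between the real average of a path on `[-1, 1]` and the complex-scalar integrals over `ℝ`
used in the definitions. -/
theorem pathMean_eq_of_forall {x : PathAlgebra A} {f : ℝ → A}
    (h : ∀ s : Set.Icc (-1 : ℝ) 1, f s = x s) :
    pathMean x = (1 / 2 : ℂ) • ∫ s in (-1 : ℝ)..1, f s := by
  rw [pathMean_eq, ← Complex.coe_smul]
  congr 1
  · push_cast; rfl
  · refine intervalIntegral.integral_congr fun s hs => ?_
    rw [Set.uIcc_of_le (by norm_num)] at hs
    simp only [Set.projIcc_of_mem _ hs]
    exact (h ⟨s, hs⟩).symm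

/-- Continuous complex-linear maps commute with averages. -/
theorem map_pathMean {B : Type*} [NormedAddCommGroup B] [NormedSpace ℂ B] [CompleteSpace B]
    (L : A →L[ℂ] B) {x : PathAlgebra A} {f : ℝ → A}
    (h : ∀ s : Set.Icc (-1 : ℝ) 1, f s = x s) :
    L (pathMean x) = (1 / 2 : ℂ) • ∫ s in (-1 : ℝ)..1, L (f s) := by
  rw [pathMean_eq_of_forall (f := fun s => x (Set.projIcc (-1) 1 (by norm_num) s))
    (fun s => by rw [Set.projIcc_val]), map_smul, ← ContinuousLinearMap.intervalIntegral_comp_comm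
      _ ((continuous_path_projIcc x).intervalIntegrable _ _)]
  congr 1
  refine intervalIntegral.integral_congr fun s hs => ?_
  rw [Set.uIcc_of_le (by norm_num)] at hs
  simp only [Set.projIcc_of_mem _ hs]
  exact congrArg L (h ⟨s, hs⟩).symm

theorem pathMean_mul_constPath (x : PathAlgebra A) (b : A) :
    pathMean (x * constPath b) = pathMean x * b := by
  have h := map_pathMean ((ContinuousLinearMap.mul ℂ A).flip b) (x := x)
    (f := fun s => x (Set.projIcc (-1) 1 (by norm_num) s)) (fun s => by rw [Set.projIcc_val])
  simp only [ContinuousLinearMap.flip_apply, ContinuousLinearMap.mul_apply'] at h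
  rw [h]
  exact pathMean_eq_of_forall fun s => by rw [Set.projIcc_val]; rfl

theorem pathMean_constPath_mul (x : PathAlgebra A) (b : A) :
    pathMean (constPath b * x) = b * pathMean x := by
  have h := map_pathMean (ContinuousLinearMap.mul ℂ A b) (x := x)
    (f := fun s => x (Set.projIcc (-1) 1 (by norm_num) s)) (fun s => by rw [Set.projIcc_val])
  simp only [ContinuousLinearMap.mul_apply'] at h
  rw [h]
  exact pathMean_eq_of_forall fun s => by rw [Set.projIcc_val]; rfl

/-- `arctan a` as an integral of resolvents. -/
noncomputable def arctanPath (a : A) : A := pathMean (resolventPath a * constPath a)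

/-- The functions `t (1 + i s t)⁻¹` form a continuous path in `C(spectrum ℂ a, ℂ)` with mean
`arctan`; the functional calculus is continuous and linear, so it commutes with the mean. -/
theorem selfAdjointCalculus_arctan {a : A} (ha : IsSelfAdjoint a) :
    selfAdjointCalculus ha arctanBCF = arctanPath a := by
  let x : PathAlgebra C(spectrum ℂ a, ℂ) := ContinuousMap.curry
    ⟨fun p => ((p.2 : ℂ).re : ℂ) * (1 + Complex.I * (p.1 : ℝ) * ((p.2 : ℂ).re : ℝ) : ℂ)⁻¹,
      Continuous.mul (by fun_prop)
        (Continuous.inv₀ (by fun_prop) fun p => one_add_I_mul_ne_zero _ _)⟩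
  have hmean : pathMean x = ⟨fun z => arctanBCF (z : ℂ).re, by fun_prop⟩ := by
    ext z
    have h := map_pathMean (ContinuousMap.evalCLM ℂ z) (x := x)
      (f := fun s => x (Set.projIcc (-1) 1 (by norm_num) s)) (fun s => by rw [Set.projIcc_val])
    refine h.trans ?_
    change _ = arctanBCF (z : ℂ).re
    rw [arctanBCF_apply, ← integral_resolvent_eq_arctan, smul_eq_mul]
    congr 1
    refine intervalIntegral.integral_congr fun s hs => ?_
    rw [Set.uIcc_of_le (by norm_num)] at hs
    simp only [Set.projIcc_of_mem _ hs]
    rfl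
  rw [selfAdjointCalculus_apply, ← hmean]
  have h := map_pathMean (cfcL (R := ℂ) ha.isStarNormal) (x := x)
    (f := fun s => x (Set.projIcc (-1) 1 (by norm_num) s)) (fun s => by rw [Set.projIcc_val])
  refine h.trans (Eq.symm ?_)
  refine pathMean_eq_of_forall fun s => ?_
  rw [Set.projIcc_val, ContinuousMap.mul_apply, constPath_apply, resolventPath_apply ha,
    selfAdjointCalculus_apply]
  have hid := cfcHom_id (R := ℂ) ha.isStarNormal
  conv_rhs => arg 2; rw [← hid]
  rw [← map_mul]
  refine congrArg (cfcHom (R := ℂ) ha.isStarNormal) ?_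
  ext z
  have hz : ((z : ℂ).re : ℂ) = z := (ha.mem_spectrum_eq_re z.2).symm
  exact (mul_comm _ _).trans (congrArg (fun w => resolventBCF s (z : ℂ).re * w) hz)

theorem hasDerivAt_constPath {a : ℝ → A} {a' : A} {t : ℝ} (h : HasDerivAt a a' t) :
    HasDerivAt (fun t => constPath (a t)) (constPath a') t :=
  (constPath (A := A)).hasFDerivAt.comp_hasDerivAt t h

theorem hasDerivAt_pathMean {x : ℝ → PathAlgebra A} {x' : PathAlgebra A} {t : ℝ}
    (h : HasDerivAt x x' t) : HasDerivAt (fun t => pathMean (x t)) (pathMean x') t :=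
  (pathMean (A := A)).hasFDerivAt.comp_hasDerivAt t h

theorem HasDerivAt.ringInverse {R : Type*} [NormedRing R] [NormedAlgebra ℝ R] [CompleteSpace R]
    {f : ℝ → R} {f' : R} {t : ℝ} (h : HasDerivAt f f' t) (hu : IsUnit (f t)) :
    HasDerivAt (fun t => Ring.inverse (f t))
      (-(Ring.inverse (f t) * f' * Ring.inverse (f t))) t := by
  obtain ⟨w, hw⟩ := hu
  have h1 := hasFDerivAt_ringInverse (𝕜 := ℝ) w
  rw [hw] at h1
  have h2 := h1.comp_hasDerivAt t h
  simpa [← hw] using! h2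

/-- Derivative of an inverse; the scalar path `i s` is central and moves to the front. -/
theorem hasDerivAt_resolventPath {a : ℝ → A} {a' : A} {t : ℝ} (h : HasDerivAt a a' t)
    (ha : IsSelfAdjoint (a t)) :
    HasDerivAt (fun t => resolventPath (a t))
      (-(imaginaryPath A * (resolventPath (a t) * constPath a' * resolventPath (a t)))) t := by
  have h1 : HasDerivAt (fun t => pencil (a t)) (imaginaryPath A * constPath a') t :=
    ((hasDerivAt_constPath h).const_mul (imaginaryPath A)).const_add 1
  refine (h1.ringInverse (isUnit_pencil ha)).congr_deriv ?_
  rw [← resolventPath, ← mul_assoc, ← imaginaryPath_comm]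
  simp only [mul_assoc]

/-- The left side is the product-rule derivative of `r a`. Since `r c a = 1 - r`, it collapses to `r
b r`, which is the operator form of `∂ arctan = ½ ∫ r_s ⊗ r_s ds`. -/
theorem neg_mul_add_eq_of_commute {R : Type*} [Ring R] {c r a : R} (hc : ∀ x, c * x = x * c)
    (h : r * (1 + c * a) = 1) (b : R) : -(c * (r * b * r)) * a + r * b = r * b * r := by
  have h1 : r * b * (r * (1 + c * a)) = r * b := by rw [h, mul_one]
  have h2 : c * (r * b * r) * a = r * b * (r * (c * a)) := by
    rw [hc]
    simp only [mul_assoc]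
  rw [mul_add, mul_one, mul_add] at h1
  rw [neg_mul, h2]
  nth_rewrite 2 [← h1]
  abel

theorem hasDerivAt_arctanPath {a : ℝ → A} {a' : A} {t : ℝ} (h : HasDerivAt a a' t)
    (ha : IsSelfAdjoint (a t)) :
    HasDerivAt (fun t => arctanPath (a t))
      (pathMean (resolventPath (a t) * constPath a' * resolventPath (a t))) t := by
  have h1 := (hasDerivAt_resolventPath h ha).mul (hasDerivAt_constPath h)
  refine (hasDerivAt_pathMean h1).congr_deriv (congrArg _ ?_)
  exact neg_mul_add_eq_of_commute imaginaryPath_comm (resolventPath_mul_pencil ha) _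

theorem contDiff_constPath {n : WithTop ℕ∞} : ContDiff ℝ n (fun a : A => constPath a) :=
  ContinuousLinearMap.contDiff (constPath (A := A))

theorem contDiff_pencil {n : WithTop ℕ∞} : ContDiff ℝ n (pencil : A → PathAlgebra A) :=
  contDiff_const.add (contDiff_const.mul contDiff_constPath)

theorem contDiff_arctanPath {E : Type*} [NormedAddCommGroup E] [NormedSpace ℝ E] {n : WithTop ℕ∞}
    {f : E → A} (hf : ContDiff ℝ n f) (hsa : ∀ x, IsSelfAdjoint (f x)) :
    ContDiff ℝ n fun x => arctanPath (f x) := by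
  have h1 : ContDiff ℝ n fun x => resolventPath (f x) := by
    refine contDiff_iff_contDiffAt.2 fun x => ?_
    obtain ⟨w, hw⟩ := isUnit_pencil (hsa x)
    have h := contDiffAt_ringInverse ℝ w (n := n)
    rw [hw] at h
    exact h.comp x (contDiff_pencil.comp hf).contDiffAt
  exact (ContinuousLinearMap.contDiff (pathMean (A := A))).comp
    (h1.mul (contDiff_constPath.comp hf))

end ResolventPath

/-! ### Differentiation of non-commutative polynomials -/

namespace NCP

variable {d : ℕ}

theorem basisFreeMonoid_apply (w : FreeMonoid (Fin d)) :
    FreeAlgebra.basisFreeMonoid ℂ (Fin d) w = monomial w.toList := by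
  rw [FreeAlgebra.basisFreeMonoid, Module.Basis.map_apply]
  simp [FreeAlgebra.equivMonoidAlgebraFreeMonoid, monomial, FreeMonoid.lift_apply,
    MonoidAlgebra.lift_single]

theorem monomial_induction {P : NCP d → Prop} (h0 : P 0) (hadd : ∀ p q, P p → P q → P (p + q))
    (hsmul : ∀ (c : ℂ) p, P p → P (c • p)) (hm : ∀ w : List (Fin d), P (monomial w)) (p : NCP d) :
    P p := by
  have hp : p ∈ Submodule.span ℂ (Set.range (FreeAlgebra.basisFreeMonoid ℂ (Fin d))) := by
    rw [Module.Basis.span_eq]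
    trivial
  induction hp using Submodule.span_induction with
  | mem x hx =>
    obtain ⟨w, rfl⟩ := hx
    rw [basisFreeMonoid_apply]
    exact hm _
  | zero => exact h0
  | add x y _ _ hx hy => exact hadd x y hx hy
  | smul c x _ hx => exact hsmul c x hx

theorem eval_monomial {A : Type*} [Ring A] [Algebra ℂ A] (Y : Fin d → A) (w : List (Fin d)) :
    eval Y (monomial w) = (w.map Y).prod := by
  rw [monomial, map_list_prod, List.map_map]
  congr 2
  funext j
  exact FreeAlgebra.lift_ι_apply _ _

theorem freeDiff_monomial (j : Fin d) (w : List (Fin d)) :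
    freeDiff j (monomial w) = ∑ k : Fin w.length,
      if w.get k = j then monomial (w.take k) ⊗ₜ[ℂ] monomial (w.drop (k + 1)) else 0 := by
  have h := basisFreeMonoid_apply (FreeMonoid.ofList w)
  rw [FreeMonoid.toList_ofList] at h
  rw [← h, freeDiff, Module.Basis.constr_basis]
  rfl

theorem cyclicDeriv_monomial (j : Fin d) (w : List (Fin d)) :
    cyclicDeriv j (monomial w) = ∑ k : Fin w.length,
      if w.get k = j then monomial (w.drop (k + 1) ++ w.take k) else 0 := by
  have h := basisFreeMonoid_apply (FreeMonoid.ofList w)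
  rw [FreeMonoid.toList_ofList] at h
  rw [← h, cyclicDeriv, Module.Basis.constr_basis]
  rfl

/-- The map `a ⊗ b ↦ a(Y) h b(Y)`. -/
noncomputable def insert {A : Type*} [Ring A] [Algebra ℂ A] (Y : Fin d → A) (h : A) :
    NCP d ⊗[ℂ] NCP d →ₗ[ℂ] A :=
  LinearMap.mul' ℂ A ∘ₗ TensorProduct.map (LinearMap.mulRight ℂ h ∘ₗ (eval Y).toLinearMap)
    (eval Y).toLinearMap

theorem insert_tmul {A : Type*} [Ring A] [Algebra ℂ A] (Y : Fin d → A) (h : A) (p q : NCP d) :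
    insert Y h (p ⊗ₜ q) = eval Y p * h * eval Y q := by
  simp [insert]

/-- On a word this is the product rule: each occurrence of the letter `l` is replaced in turn by
`h`, and `freeDiff` records the prefix and the suffix. -/
theorem hasDerivAt_eval {A : Type*} [NormedRing A] [NormedAlgebra ℂ A] {Y : Fin d → ℝ → A}
    {l : Fin d} {h : A} {t : ℝ} (hl : HasDerivAt (Y l) h t)
    (hne : ∀ j, j ≠ l → HasDerivAt (Y j) 0 t) (p : NCP d) :
    HasDerivAt (fun t => eval (fun j => Y j t) p) (insert (fun j => Y j t) h (freeDiff l p)) t := by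
  induction p using monomial_induction with
  | h0 => simpa using hasDerivAt_const t (0 : A)
  | hadd p q hp hq =>
    simp only [map_add]
    exact hp.add hq
  | hsmul c p hp =>
    simp only [map_smul]
    exact hp.const_smul c
  | hm w =>
    have hY : ∀ j, HasDerivAt (Y j) (if j = l then h else 0) t := fun j => by
      split_ifs with hj
      · exact hj ▸ hl
      · exact hne j hj
    have h1 := (HasFDerivAt.list_prod' (l := w) (f := Y) fun j _ => (hY j).hasFDerivAt).hasDerivAt
    simp only [eval_monomial]
    refine h1.congr_deriv ?_
    rw [freeDiff_monomial, map_sum, sum_apply]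
    refine Finset.sum_congr rfl fun k _ => ?_
    have hk : w[k] = w.get k := rfl
    simp only [hk, smul_apply, ContinuousLinearMap.toSpanSingleton_apply, one_smul,
      MulOpposite.smul_eq_mul_unop, MulOpposite.unop_op, smul_eq_mul]
    split_ifs
    · rw [insert_tmul, eval_monomial, eval_monomial, mul_assoc]
    · simp

theorem contDiff_eval {A : Type*} [NormedRing A] [NormedAlgebra ℂ A] {E : Type*}
    [NormedAddCommGroup E] [NormedSpace ℝ E] {n : WithTop ℕ∞} {Y : Fin d → E → A}
    (hY : ∀ j, ContDiff ℝ n (Y j)) (p : NCP d) :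
    ContDiff ℝ n fun x => eval (fun j => Y j x) p := by
  induction p using FreeAlgebra.induction with
  | grade0 r =>
    simp only [AlgHom.commutes]
    exact contDiff_const
  | grade1 j =>
    simp only [eval, FreeAlgebra.lift_ι_apply]
    exact hY j
  | mul p q hp hq => simpa only [map_mul] using hp.mul hq
  | add p q hp hq => simpa only [map_add] using hp.add hq

/-- Cyclicity moves each prefix behind its suffix, which is how `cyclicDeriv` arises from
`freeDiff`. -/
theorem trace_insert_freeDiff {A : Type*} [Ring A] [Algebra ℂ A] (T : A →ₗ[ℂ] ℂ)
    (hT : ∀ a b, T (a * b) = T (b * a)) (Y : Fin d → A) (h : A) (l : Fin d) (p : NCP d) :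
    T (insert Y h (freeDiff l p)) = T (eval Y (cyclicDeriv l p) * h) := by
  induction p using monomial_induction with
  | h0 => simp
  | hadd p q hp hq => simp only [map_add, add_mul, hp, hq]
  | hsmul c p hp => simp only [map_smul, smul_mul_assoc, hp]
  | hm w =>
    simp only [freeDiff_monomial, cyclicDeriv_monomial, map_sum, Finset.sum_mul]
    refine Finset.sum_congr rfl fun k _ => ?_
    split_ifs
    · rw [insert_tmul, mul_assoc, hT, mul_assoc, hT, eval_monomial, eval_monomial, eval_monomial,
        List.map_append, List.prod_append]
    · simp

theorem star_eval_monomial {A : Type*} [Ring A] [StarRing A] [Algebra ℂ A] {Y : Fin d → A}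
    (hY : ∀ j, IsSelfAdjoint (Y j)) (w : List (Fin d)) :
    star (eval Y (monomial w)) = eval Y (monomial w.reverse) := by
  induction w with
  | nil => simp [monomial]
  | cons j w ih =>
    rw [eval_monomial] at *
    rw [List.map_cons, List.prod_cons, star_mul, ih, (hY j).star_eq, eval_monomial, eval_monomial,
      List.reverse_cons, List.map_append, List.prod_append]
    simp

/-- Word reversal permutes the support of the coefficients, and reindexing the adjoint along it
returns the original sum. -/
theorem SelfAdj.isSelfAdjoint_eval {A : Type*} [Ring A] [StarRing A] [Algebra ℂ A]
    [StarModule ℂ A] {Y : Fin d → A} (hY : ∀ j, IsSelfAdjoint (Y j)) {p : NCP d} (hp : p.SelfAdj) :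
    IsSelfAdjoint (eval Y p) := by
  set c := (FreeAlgebra.basisFreeMonoid ℂ (Fin d)).repr p with hc
  have hsum : eval Y p = ∑ w ∈ c.support, c w • eval Y (monomial w.toList) := by
    conv_lhs => rw [← (FreeAlgebra.basisFreeMonoid ℂ (Fin d)).linearCombination_repr p]
    simp only [Finsupp.linearCombination_apply, Finsupp.sum, map_sum, map_smul,
      basisFreeMonoid_apply]
    rfl
  have hmem : ∀ w, w ∈ c.support → w.reverse ∈ c.support := fun w hw => by
    rw [Finsupp.mem_support_iff] at *
    rw [hp w]
    exact star_ne_zero.2 hw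
  rw [IsSelfAdjoint]
  conv_rhs => rw [hsum]
  rw [hsum, star_sum]
  refine Finset.sum_nbij' FreeMonoid.reverse FreeMonoid.reverse hmem hmem
    (fun w _ => FreeMonoid.reverse_reverse) (fun w _ => FreeMonoid.reverse_reverse) fun w _ => ?_
  rw [star_smul, star_eval_monomial hY, hc, hp w]
  rfl

end NCP

/-! ### First and second derivatives of the trace of a polynomial in `arctan` -/

section TraceDerivatives

open Filter Topology MeasureTheory

variable {A : Type u} [CStarAlgebra A] {d : ℕ}

/-- The path `s ↦ r_s W r_s` with mean `𝒟°_{x_l}(φ ∘ arctan)(a)`. -/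
noncomputable def gradientPath (l : Fin d) (φ : NCP d) (a : Fin d → A) : PathAlgebra A :=
  resolventPath (a l) * constPath (NCP.eval (fun j => arctanPath (a j)) (NCP.cyclicDeriv l φ)) *
    resolventPath (a l)

/-- The derivative of `gradientPath` in the direction `e`. -/
noncomputable def hessianPath (l : Fin d) (φ : NCP d) (a : Fin d → A) (e : A) : PathAlgebra A :=
  let r := resolventPath (a l)
  let W := constPath (NCP.eval (fun j => arctanPath (a j)) (NCP.cyclicDeriv l φ))
  let W' := constPath (NCP.insert (fun j => arctanPath (a j)) (pathMean (r * constPath e * r))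
    (NCP.freeDiff l (NCP.cyclicDeriv l φ)))
  (-(imaginaryPath A * (r * constPath e * r)) * W + r * W') * r +
    r * W * -(imaginaryPath A * (r * constPath e * r))

theorem hasDerivAt_gradientPath {a : Fin d → ℝ → A} {l : Fin d} {e : A} {t : ℝ}
    (hsa : ∀ j, IsSelfAdjoint (a j t)) (hl : HasDerivAt (a l) e t)
    (hne : ∀ j, j ≠ l → HasDerivAt (a j) 0 t) (φ : NCP d) :
    HasDerivAt (fun t => gradientPath l φ fun j => a j t)
      (hessianPath l φ (fun j => a j t) e) t := by
  have hY := NCP.hasDerivAt_eval (Y := fun j t => arctanPath (a j t))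
    (hasDerivAt_arctanPath hl (hsa l)) (fun j hj => by
      have h := hasDerivAt_arctanPath (hne j hj) (hsa j)
      simpa using h) (NCP.cyclicDeriv l φ)
  have hr := hasDerivAt_resolventPath hl (hsa l)
  exact (hr.mul (hasDerivAt_constPath hY)).mul hr

/-- Lets the inserted element, itself a mean of a path, be pulled out of the insertion as an
integral. -/
theorem NCP.exists_insertCLM (Y : Fin d → A) (z : NCP d ⊗[ℂ] NCP d) :
    ∃ L : A →L[ℂ] A, ∀ h, L h = NCP.insert Y h z := by
  induction z with
  | zero => exact ⟨0, fun h => by simp⟩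
  | add x y hx hy =>
    obtain ⟨L, hL⟩ := hx
    obtain ⟨M, hM⟩ := hy
    exact ⟨L + M, fun h => by rw [map_add, ← hL, ← hM]; rfl⟩
  | tmul p q =>
    exact ⟨(ContinuousLinearMap.mul ℂ A).flip (NCP.eval Y q) ∘L
      ContinuousLinearMap.mul ℂ A (NCP.eval Y p), fun h => by simp [NCP.insert_tmul]⟩

variable [PartialOrder A] [StarOrderedRing A] {τ : A →ₚ[ℂ] ℂ}

theorem state_pathMean_mul_comm (h1 : τ 1 = 1) (ht : ∀ a b : A, τ (a * b) = τ (b * a))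
    (x y : PathAlgebra A) : τ (pathMean (x * y)) = τ (pathMean (y * x)) := by
  rw [← stateCLM_apply h1, ← stateCLM_apply h1,
    map_pathMean (stateCLM h1) (x := x * y)
      (f := fun s => (x * y) (Set.projIcc (-1) 1 (by norm_num) s)) (fun s => by rw [Set.projIcc_val]),
    map_pathMean (stateCLM h1) (x := y * x)
      (f := fun s => (y * x) (Set.projIcc (-1) 1 (by norm_num) s)) (fun s => by rw [Set.projIcc_val])]
  simp only [ContinuousMap.mul_apply, stateCLM_apply]
  simp only [ht (x _)]

theorem hasDerivAt_state (h1 : τ 1 = 1) {a : ℝ → A} {a' : A} {t : ℝ} (h : HasDerivAt a a' t) :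
    HasDerivAt (fun t => τ (a t)) (τ a') t :=
  ((stateCLM h1).restrictScalars ℝ).hasFDerivAt.comp_hasDerivAt t h

/-- The derivative is `τ(W · ½ ∫ r_s e r_s ds)`. Cyclicity under the integral moves the resolvents
from `e` to `W`, so the gradient is the mean of `r_s W r_s`. -/
theorem hasDerivAt_state_eval_arctan (h1 : τ 1 = 1) (ht : ∀ a b : A, τ (a * b) = τ (b * a))
    {a : Fin d → ℝ → A} {l : Fin d} {e : A} {t : ℝ}
    (hsa : ∀ j, IsSelfAdjoint (a j t)) (hl : HasDerivAt (a l) e t)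
    (hne : ∀ j, j ≠ l → HasDerivAt (a j) 0 t) (φ : NCP d) :
    HasDerivAt (fun t => τ (NCP.eval (fun j => arctanPath (a j t)) φ))
      (τ (pathMean (gradientPath l φ fun j => a j t) * e)) t := by
  have hY := NCP.hasDerivAt_eval (Y := fun j t => arctanPath (a j t))
    (hasDerivAt_arctanPath hl (hsa l)) (fun j hj => by
      have h := hasDerivAt_arctanPath (hne j hj) (hsa j)
      simpa using h) φ
  refine (hasDerivAt_state h1 hY).congr_deriv ?_
  have h2 := NCP.trace_insert_freeDiff τ.toLinearMap ht (fun j => arctanPath (a j t))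
    (pathMean (resolventPath (a l t) * constPath e * resolventPath (a l t))) l φ
  refine h2.trans ?_
  change τ _ = τ _
  rw [← pathMean_constPath_mul, ← pathMean_mul_constPath, gradientPath, ← mul_assoc,
    state_pathMean_mul_comm h1 ht]
  simp only [mul_assoc]

theorem hasDerivAt_state_gradientPath (h1 : τ 1 = 1)
    {a : Fin d → ℝ → A} {l : Fin d} {e : A} {t : ℝ}
    (hsa : ∀ j, IsSelfAdjoint (a j t)) (hl : HasDerivAt (a l) e t)
    (hne : ∀ j, j ≠ l → HasDerivAt (a j) 0 t) (φ : NCP d) :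
    HasDerivAt (fun t => τ (pathMean (gradientPath l φ fun j => a j t) * e))
      (τ (pathMean (hessianPath l φ (fun j => a j t) e) * e)) t :=
  hasDerivAt_state h1 ((hasDerivAt_pathMean (hasDerivAt_gradientPath hsa hl hne φ)).mul_const e)

variable {κ : Type*} [Fintype κ] {e : κ → A} {N : ℂ}

/-- On `p ⊗ q` this is `hE` with `a = r p(Y) ρ` and `b = ρ q(Y) r`. -/
theorem sum_state_insert (hE : ∀ a b : A, ∑ k, τ (a * e k * b * e k) = N * (τ a * τ b))
    (Y : Fin d → A) (r ρ : A) (z : NCP d ⊗[ℂ] NCP d) :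
    ∑ k, τ (r * NCP.insert Y (ρ * e k * ρ) z * r * e k) =
      N * tensorState τ (sandwichTensor Y r ρ z) := by
  induction z with
  | zero => simp
  | add x y hx hy =>
    simp only [map_add, mul_add, add_mul, Finset.sum_add_distrib, hx, hy]
  | tmul p q =>
    rw [sandwichTensor_tmul, tensorState_tmul, ← hE]
    refine Finset.sum_congr rfl fun k _ => ?_
    rw [NCP.insert_tmul]
    simp only [mul_assoc]

theorem sum_state_insert_pathMean (h1 : τ 1 = 1)
    (hE : ∀ a b : A, ∑ k, τ (a * e k * b * e k) = N * (τ a * τ b))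
    (Y : Fin d → A) (r : A) (ρ : PathAlgebra A) {f : ℝ → A}
    (hf : ∀ s : Set.Icc (-1 : ℝ) 1, f s = ρ s) (z : NCP d ⊗[ℂ] NCP d) :
    ∑ k, τ (r * NCP.insert Y (pathMean (ρ * constPath (e k) * ρ)) z * r * e k) =
      N * ((1 / 2 : ℂ) * ∫ v in (-1 : ℝ)..1, tensorState τ (sandwichTensor Y r (f v) z)) := by
  obtain ⟨L, hL⟩ := NCP.exists_insertCLM Y z
  let M : κ → A →L[ℂ] ℂ := fun k => stateCLM h1 ∘L (ContinuousLinearMap.mul ℂ A).flip (e k) ∘L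
    (ContinuousLinearMap.mul ℂ A).flip r ∘L ContinuousLinearMap.mul ℂ A r ∘L L
  have hM : ∀ k h, M k h = τ (r * NCP.insert Y h z * r * e k) := fun k h => by
    rw [← hL]
    rfl
  have hk : ∀ k, τ (r * NCP.insert Y (pathMean (ρ * constPath (e k) * ρ)) z * r * e k) =
      (1 / 2 : ℂ) * ∫ v in (-1 : ℝ)..1,
        M k ((ρ * constPath (e k) * ρ) (Set.projIcc (-1) 1 (by norm_num) v)) := fun k => by
    rw [← hM, ← smul_eq_mul]
    exact map_pathMean (M k) fun s => by rw [Set.projIcc_val]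
  simp only [hk]
  rw [← Finset.mul_sum, ← intervalIntegral.integral_finsetSum fun k _ =>
    (Continuous.intervalIntegrable (by fun_prop) _ _), mul_left_comm]
  refine congrArg _ (Eq.trans ?_ (intervalIntegral.integral_const_mul N _))
  refine intervalIntegral.integral_congr fun v hv => ?_
  rw [Set.uIcc_of_le (by norm_num)] at hv
  simp only [Set.projIcc_of_mem _ hv, hM]
  rw [← sum_state_insert hE, hf ⟨v, hv⟩]
  rfl

variable {a : Fin d → A}

theorem arctanTuple_toL2 (hf : ∀ a : A, τ (star a * a) = 0 → a = 0)
    (ha : ∀ j, IsSelfAdjoint (a j)) :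
    arctanTuple τ (fun j => toL2 τ (a j)) = fun j => arctanPath (a j) := by
  funext j
  rw [arctanTuple, arctanL2, funCalc_toL2 hf (ha j), selfAdjointCalculus_arctan]

theorem resolventL2_toL2 (hf : ∀ a : A, τ (star a * a) = 0 → a = 0) {a : A}
    (ha : IsSelfAdjoint a) (s : Set.Icc (-1 : ℝ) 1) :
    resolventL2 τ (toL2 τ a) s = resolventPath a s := by
  rw [resolventL2, funCalc_toL2 hf ha, resolventPath_apply ha]

theorem cyclicDerivArctan_toL2 (hf : ∀ a : A, τ (star a * a) = 0 → a = 0)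
    (ha : ∀ j, IsSelfAdjoint (a j)) (l : Fin d) (φ : NCP d) :
    cyclicDerivArctan τ l φ (fun j => toL2 τ (a j)) = toL2 τ (pathMean (gradientPath l φ a)) := by
  rw [← toL2CLM_apply, map_pathMean (toL2CLM τ) (x := gradientPath l φ a)
    (f := fun s => resolventL2 τ (toL2 τ (a l)) s *
      NCP.eval (arctanTuple τ fun j => toL2 τ (a j)) (NCP.cyclicDeriv l φ) *
      resolventL2 τ (toL2 τ (a l)) s)]
  · rfl
  · intro s
    rw [resolventL2_toL2 hf (ha l), arctanTuple_toL2 hf ha]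
    rfl

theorem sum_state_hessianPath (h1 : τ 1 = 1) (hf : ∀ a : A, τ (star a * a) = 0 → a = 0)
    (hE : ∀ a b : A, ∑ k, τ (a * e k * b * e k) = N * (τ a * τ b))
    (ha : ∀ j, IsSelfAdjoint (a j)) (l : Fin d) (φ : NCP d) :
    ∑ k, τ (pathMean (hessianPath l φ a (e k)) * e k) =
      N * ((1 / 2 : ℂ) * ∫ s in (-1 : ℝ)..1,
        laplacianDensity τ l φ (fun j => toL2 τ (a j)) s) := by
  have hk : ∀ k, τ (pathMean (hessianPath l φ a (e k)) * e k) =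
      (1 / 2 : ℂ) * ∫ v in (-1 : ℝ)..1, stateCLM h1
        ((hessianPath l φ a (e k) * constPath (e k)) (Set.projIcc (-1) 1 (by norm_num) v)) := by
    intro k
    rw [← pathMean_mul_constPath, ← smul_eq_mul, ← stateCLM_apply h1]
    exact map_pathMean (stateCLM h1) fun s => by rw [Set.projIcc_val]
  simp only [hk]
  rw [← Finset.mul_sum, ← intervalIntegral.integral_finsetSum fun k _ =>
    (Continuous.intervalIntegrable (by fun_prop) _ _), mul_left_comm]
  refine congrArg _ (Eq.trans ?_ (intervalIntegral.integral_const_mul N _))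
  refine intervalIntegral.integral_congr fun s hs => ?_
  rw [Set.uIcc_of_le (by norm_num)] at hs
  simp only [Set.projIcc_of_mem _ hs, stateCLM_apply]
  have hr := resolventL2_toL2 hf (ha l)
  rw [laplacianDensity, hr ⟨s, hs⟩, arctanTuple_toL2 hf ha]
  set r := resolventPath (a l) with hrdef
  set Y : Fin d → A := fun j => arctanPath (a j)
  set W := NCP.eval Y (NCP.cyclicDeriv l φ)
  set z := NCP.freeDiff l (NCP.cyclicDeriv l φ)
  -- The outer two terms have the shape `a e b e` with `(a, b) = (r, r W r)` and `(r W r, r)`, so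
  -- `hE` makes them equal; this is the factor `2` in `laplacianDensity`. The middle term, where `W`
  -- is differentiated, gives the inner integral.
  have hpt : ∀ k, (hessianPath l φ a (e k) * constPath (e k)) ⟨s, hs⟩ =
      (-(Complex.I * s)) • (r ⟨s, hs⟩ * e k * (r ⟨s, hs⟩ * W * r ⟨s, hs⟩) * e k) +
      r ⟨s, hs⟩ * NCP.insert Y (pathMean (r * constPath (e k) * r)) z * r ⟨s, hs⟩ * e k +
      (-(Complex.I * s)) • ((r ⟨s, hs⟩ * W * r ⟨s, hs⟩) * e k * r ⟨s, hs⟩ * e k) := by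
    intro k
    simp only [hessianPath, ContinuousMap.mul_apply, ContinuousMap.add_apply,
      ContinuousMap.neg_apply, imaginaryPath_apply, constPath_apply]
    simp only [add_mul, neg_mul, mul_neg, smul_mul_assoc, mul_smul_comm, neg_smul, mul_assoc,
      one_mul]
    rfl
  simp only [hpt, map_add, map_smul, smul_eq_mul, Finset.sum_add_distrib, ← Finset.mul_sum]
  rw [sum_state_insert_pathMean h1 hE Y _ r hr z, hE, hE]
  ring

end TraceDerivatives

/-! ### The Hessian of a cylindrical function on the self-adjoint part of a `C*`-algebra -/

section SecondDerivatives

open Filter Topology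

/-- The second derivative of a `C²` function is its second derivative along lines. -/
theorem fderiv_fderiv_apply_eq_of_hasDerivAt {E : Type*} [NormedAddCommGroup E] [NormedSpace ℝ E]
    {f : E → ℝ} (hf : ContDiff ℝ 2 f) {x v : E} {f' : ℝ → ℝ} {c : ℝ}
    (h : ∀ t, HasDerivAt (fun t : ℝ => f (x + t • v)) (f' t) t) (h' : HasDerivAt f' c 0) :
    fderiv ℝ (fderiv ℝ f) x v v = c := by
  have hline : ∀ t : ℝ, HasDerivAt (fun t : ℝ => x + t • v) v t := fun t => by
    simpa using ((hasDerivAt_id t).smul_const v).const_add x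
  have h1 : f' = fun t => fderiv ℝ f (x + t • v) v := funext fun t =>
    (h t).unique (((hf.differentiable two_ne_zero) _).hasFDerivAt.comp_hasDerivAt t (hline t))
  have h2 : ContDiff ℝ 1 (fderiv ℝ f) := hf.fderiv_right (by norm_num)
  have h3 : HasFDerivAt (fderiv ℝ f) (fderiv ℝ (fderiv ℝ f) x) (x + (0 : ℝ) • v) := by
    have h := ((h2.differentiable one_ne_zero) x).hasFDerivAt
    rwa [show x + (0 : ℝ) • v = x by rw [zero_smul, add_zero]]
  have h4 : HasDerivAt (fun t : ℝ => fderiv ℝ f (x + t • v)) (fderiv ℝ (fderiv ℝ f) x v) 0 :=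
    h3.comp_hasDerivAt (0 : ℝ) (hline 0)
  have h5 : HasDerivAt f' (fderiv ℝ (fderiv ℝ f) x v v) 0 := by
    rw [h1]
    exact (ContinuousLinearMap.apply ℝ ℝ v).hasFDerivAt.comp_hasDerivAt (0 : ℝ) h4
  exact h5.unique h'

theorem fderiv_apply_eq_sum {m : ℕ} (g : (Fin m → ℝ) → ℝ) (y v : Fin m → ℝ) :
    fderiv ℝ g y v = ∑ o, partialDeriv g o y * v o := by
  conv_lhs => rw [pi_eq_sum_univ' v]
  rw [map_sum]
  refine Finset.sum_congr rfl fun o _ => ?_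
  rw [map_smul, smul_eq_mul, mul_comm]
  rfl

theorem hasDerivAt_comp_partial {m : ℕ} {g : (Fin m → ℝ) → ℝ} (hg : Differentiable ℝ g)
    {F : ℝ → Fin m → ℝ} {F' : Fin m → ℝ} {t : ℝ} (hF : ∀ o, HasDerivAt (fun t => F t o) (F' o) t) :
    HasDerivAt (fun t => g (F t)) (∑ o, partialDeriv g o (F t) * F' o) t := by
  rw [← fderiv_apply_eq_sum]
  exact (hg _).hasFDerivAt.comp_hasDerivAt t (hasDerivAt_pi.2 hF)

theorem contDiff_partialDeriv {m : ℕ} {g : (Fin m → ℝ) → ℝ} (hg : ContDiff ℝ 2 g) (o : Fin m) :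
    ContDiff ℝ 1 (partialDeriv g o) :=
  (hg.fderiv_right (by norm_num)).clm_apply contDiff_const

theorem im_eq_zero_of_hasDerivAt {F : ℝ → ℂ} {z : ℂ} {t : ℝ} (h : HasDerivAt F z t)
    (hF : ∀ t, (F t).im = 0) : z.im = 0 := by
  have h1 := Complex.imCLM.hasFDerivAt.comp_hasDerivAt t h
  have h2 : (⇑Complex.imCLM ∘ F) = fun _ => 0 := funext hF
  rw [h2] at h1
  exact h1.unique (hasDerivAt_const t 0)

theorem hasDerivAt_re {F : ℝ → ℂ} {z : ℂ} {t : ℝ} (h : HasDerivAt F z t) :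
    HasDerivAt (fun t => (F t).re) z.re t :=
  Complex.reCLM.hasFDerivAt.comp_hasDerivAt t h

end SecondDerivatives

/-! ### Regularity and Hessians of cylindrical functions on self-adjoint tuples. -/

section SelfAdjointTuples

variable {A : Type u} [CStarAlgebra A] {d : ℕ}

/-- The inclusion of the self-adjoint part, as a real continuous linear map. -/
noncomputable def selfAdjointVal : selfAdjoint A →L[ℝ] A where
  toFun := Subtype.val
  map_add' _ _ := rfl
  map_smul' _ _ := rfl
  cont := continuous_subtype_val

theorem isSelfAdjoint_arctanPath {a : A} (ha : IsSelfAdjoint a) :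
    IsSelfAdjoint (arctanPath a) := by
  rw [← selfAdjointCalculus_arctan ha, IsSelfAdjoint, ← map_star, star_arctanBCF]

variable [PartialOrder A] [StarOrderedRing A] {τ : A →ₚ[ℂ] ℂ}

theorem cylArgs_toL2 (hf : ∀ a : A, τ (star a * a) = 0 → a = 0) {a : Fin d → A}
    (ha : ∀ j, IsSelfAdjoint (a j)) {m : ℕ} (φ : Fin m → NCP d) (o : Fin m) :
    cylArgs τ φ (fun j => toL2 τ (a j)) o =
      (τ (NCP.eval (fun j => arctanPath (a j)) (φ o))).re := by
  rw [cylArgs, arctanLaw, arctanTuple_toL2 hf ha]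

theorem state_im_eq_zero {a : A} (ha : IsSelfAdjoint a) : (τ a).im = 0 := by
  have h := map_star τ a
  rw [ha.star_eq] at h
  exact Complex.conj_eq_iff_im.1 h.symm

theorem contDiff_cylindrical (h1 : τ 1 = 1) (hf : ∀ a : A, τ (star a * a) = 0 → a = 0) {m : ℕ}
    {g : (Fin m → ℝ) → ℝ} {n : WithTop ℕ∞} (hg : ContDiff ℝ n g) (φ : Fin m → NCP d) :
    ContDiff ℝ n fun X : Fin d → selfAdjoint A =>
      cylindrical τ g φ fun j => toL2 τ (X j : A) := by
  refine hg.comp (contDiff_pi.2 fun o => ?_)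
  simp only [cylArgs_toL2 hf (fun j => (_ : selfAdjoint A).2)]
  refine Complex.reCLM.contDiff.comp
    (((stateCLM h1).restrictScalars ℝ).contDiff.comp (NCP.contDiff_eval (fun j => ?_) (φ o)))
  have hj : ContDiff ℝ n fun X : Fin d → selfAdjoint A => (X j : A) :=
    (selfAdjointVal (A := A)).contDiff.comp (contDiff_apply ℝ (selfAdjoint A) j)
  exact contDiff_arctanPath hj fun X => (X j).2

/-- The chain rule applied twice along the line `X + t e`. Real parts appear because `cylArgs` takes
them. -/
theorem hessian_cylindrical (h1 : τ 1 = 1) (hf : ∀ a : A, τ (star a * a) = 0 → a = 0)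
    (ht : ∀ a b : A, τ (a * b) = τ (b * a)) {m : ℕ} {g : (Fin m → ℝ) → ℝ} (hg : ContDiff ℝ 2 g)
    (φ : Fin m → NCP d) (X : Fin d → selfAdjoint A) (l : Fin d) (e : selfAdjoint A) :
    fderiv ℝ (fderiv ℝ fun X : Fin d → selfAdjoint A =>
      cylindrical τ g φ fun j => toL2 τ (X j : A)) X (Pi.single l e) (Pi.single l e) =
    ∑ o, ((∑ q, partialDeriv₂ g o q (cylArgs τ φ fun j => toL2 τ (X j : A)) *
        (τ (pathMean (gradientPath l (φ q) fun j => (X j : A)) * (e : A))).re) *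
        (τ (pathMean (gradientPath l (φ o) fun j => (X j : A)) * (e : A))).re +
      partialDeriv g o (cylArgs τ φ fun j => toL2 τ (X j : A)) *
        (τ (pathMean (hessianPath l (φ o) (fun j => (X j : A)) (e : A)) * (e : A))).re) := by
  let a : Fin d → ℝ → A := fun j t => ((X + t • (Pi.single l e : Fin d → selfAdjoint A)) j : A)
  have hsa : ∀ t j, IsSelfAdjoint (a j t) := fun t j =>
    ((X + t • (Pi.single l e : Fin d → selfAdjoint A)) j).2
  have haj : ∀ j t, HasDerivAt (a j) ((Pi.single l e : Fin d → selfAdjoint A) j : A) t :=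
    fun j t => by
      have h := ((hasDerivAt_id t).smul_const
        (((Pi.single l e : Fin d → selfAdjoint A) j : A))).const_add (X j : A)
      exact h.congr_deriv (one_smul ℝ _)
  have hl : ∀ t, HasDerivAt (a l) (e : A) t := fun t => by simpa using haj l t
  have hne : ∀ t j, j ≠ l → HasDerivAt (a j) 0 t := fun t j hj => by
    simpa [Pi.single_eq_of_ne hj] using haj j t
  have ha0 : (fun j => a j 0) = fun j => (X j : A) := by
    funext j
    simp [a]
  let F : ℝ → Fin m → ℝ := fun t => cylArgs τ φ fun j => toL2 τ (a j t)
  let F' : ℝ → Fin m → ℝ := fun t o =>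
    (τ (pathMean (gradientPath l (φ o) fun j => a j t) * (e : A))).re
  have hF : ∀ t o, HasDerivAt (fun t => F t o) (F' t o) t := fun t o => by
    have h := hasDerivAt_re (hasDerivAt_state_eval_arctan h1 ht (hsa t) (hl t) (hne t) (φ o))
    refine h.congr_of_eventuallyEq (Filter.Eventually.of_forall fun t => ?_)
    exact cylArgs_toL2 hf (hsa t) φ o
  have hF' : ∀ o, HasDerivAt (fun t => F' t o)
      (τ (pathMean (hessianPath l (φ o) (fun j => a j 0) (e : A)) * (e : A))).re 0 := fun o =>
    hasDerivAt_re (hasDerivAt_state_gradientPath h1 (hsa 0) (hl 0) (hne 0) (φ o))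
  have hu : ∀ t, HasDerivAt (fun t : ℝ => cylindrical τ g φ fun j =>
      toL2 τ ((X + t • (Pi.single l e : Fin d → selfAdjoint A)) j : A))
      (∑ o, partialDeriv g o (F t) * F' t o) t := fun t =>
    hasDerivAt_comp_partial (hg.differentiable two_ne_zero) (hF t)
  refine fderiv_fderiv_apply_eq_of_hasDerivAt (contDiff_cylindrical h1 hf hg φ) hu ?_
  refine (HasDerivAt.fun_sum fun o _ => (hasDerivAt_comp_partial
    ((contDiff_partialDeriv hg o).differentiable one_ne_zero) (hF 0)).mul (hF' o)).congr_deriv ?_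
  have haX : (fun j => toL2 τ (a j 0)) = fun j => toL2 τ (X j : A) :=
    funext fun j => congrArg (toL2 τ) (congrFun ha0 j)
  simp only [F, F', ha0, haX]
  rfl

/-- Both numbers are derivatives, of first and second order, of the real-valued function `t ↦
τ(φ(arctan(a + t e)))`. -/
theorem state_gradientPath_im_eq_zero (h1 : τ 1 = 1) (ht : ∀ a b : A, τ (a * b) = τ (b * a))
    {φ : NCP d} (hφ : φ.SelfAdj) {a : Fin d → A} (ha : ∀ j, IsSelfAdjoint (a j)) (l : Fin d)
    {e : A} (he : IsSelfAdjoint e) : (τ (pathMean (gradientPath l φ a) * e)).im = 0 ∧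
      (τ (pathMean (hessianPath l φ a e) * e)).im = 0 := by
  let c : Fin d → ℝ → A := fun j t => a j + t • (Pi.single l e : Fin d → A) j
  have hc : ∀ t j, IsSelfAdjoint (c j t) := fun t j => by
    refine (ha j).add (IsSelfAdjoint.smul (conj_trivial t) ?_)
    rcases eq_or_ne j l with rfl | hj
    · simpa using he
    · simp [Pi.single_eq_of_ne hj]
  have hcj : ∀ j t, HasDerivAt (c j) ((Pi.single l e : Fin d → A) j) t := fun j t =>
    (((hasDerivAt_id t).smul_const ((Pi.single l e : Fin d → A) j)).const_add (a j)).congr_deriv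
      (one_smul ℝ _)
  have hl : ∀ t, HasDerivAt (c l) e t := fun t => by simpa using hcj l t
  have hne : ∀ t j, j ≠ l → HasDerivAt (c j) 0 t := fun t j hj => by
    simpa [Pi.single_eq_of_ne hj] using hcj j t
  have hc0 : (fun j => c j 0) = a := by
    funext j
    simp [c]
  have him : ∀ t, (τ (pathMean (gradientPath l φ fun j => c j t) * e)).im = 0 := fun t =>
    im_eq_zero_of_hasDerivAt (hasDerivAt_state_eval_arctan h1 ht (hc t) (hl t) (hne t) φ)
      fun t => state_im_eq_zero (hφ.isSelfAdjoint_eval fun j => isSelfAdjoint_arctanPath (hc t j))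
  have h2 := im_eq_zero_of_hasDerivAt
    (hasDerivAt_state_gradientPath h1 (hc 0) (hl 0) (hne 0) φ) him
  have h3 := him 0
  rw [hc0] at h2 h3
  exact ⟨h3, h2⟩

theorem ofReal_re_of_im_eq_zero {z : ℂ} (h : z.im = 0) : (z.re : ℂ) = z :=
  Complex.ext rfl (by rw [h, Complex.ofReal_im])

variable {κ : Type*} [Fintype κ] {e : κ → selfAdjoint A} {N : ℂ}

/-- Only two properties of the basis enter: `hE`, which splits a trace into two, and the
Parseval-type identity `hP`, which turns products of first derivatives into inner products. -/
theorem sum_hessian_cylindrical (h1 : τ 1 = 1) (hf : ∀ a : A, τ (star a * a) = 0 → a = 0)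
    (ht : ∀ a b : A, τ (a * b) = τ (b * a))
    (hE : ∀ a b : A, ∑ k, τ (a * e k * b * e k) = N * (τ a * τ b))
    (hP : ∀ a b : A, ∑ k, τ (a * e k) * τ (b * e k) = τ (a * b))
    {m : ℕ} {g : (Fin m → ℝ) → ℝ} (hg : ContDiff ℝ 2 g)
    (φ : Fin m → NCP d) (hφ : ∀ o, (φ o).SelfAdj) (X : Fin d → selfAdjoint A) (l : Fin d) :
    ((∑ k, fderiv ℝ (fderiv ℝ fun X : Fin d → selfAdjoint A =>
      cylindrical τ g φ fun j => toL2 τ (X j : A)) X (Pi.single l (e k)) (Pi.single l (e k)) : ℝ)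
        : ℂ) =
    ∑ o, (N * ((partialDeriv g o (cylArgs τ φ fun j => toL2 τ (X j : A)) : ℂ) *
        ((1 / 2 : ℂ) * ∫ s in (-1 : ℝ)..1,
          laplacianDensity τ l (φ o) (fun j => toL2 τ (X j : A)) s)) +
      ∑ q, (partialDeriv₂ g o q (cylArgs τ φ fun j => toL2 τ (X j : A)) : ℂ) *
        inner ℂ (cyclicDerivArctan τ l (φ o) fun j => toL2 τ (X j : A))
          (cyclicDerivArctan τ l (φ q) fun j => toL2 τ (X j : A))) := by
  have hX : ∀ j, IsSelfAdjoint (X j : A) := fun j => (X j).2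
  have hre := fun o k => ofReal_re_of_im_eq_zero
    (state_gradientPath_im_eq_zero h1 ht (hφ o) hX l (e k).2).1
  have hre2 := fun o k => ofReal_re_of_im_eq_zero
    (state_gradientPath_im_eq_zero h1 ht (hφ o) hX l (e k).2).2
  have hinner : ∀ o q, inner ℂ (cyclicDerivArctan τ l (φ o) fun j => toL2 τ (X j : A))
      (cyclicDerivArctan τ l (φ q) fun j => toL2 τ (X j : A)) =
      ∑ k, τ (pathMean (gradientPath l (φ q) fun j => (X j : A)) * e k) *
        τ (pathMean (gradientPath l (φ o) fun j => (X j : A)) * e k) := by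
    intro o q
    rw [cyclicDerivArctan_toL2 hf hX, cyclicDerivArctan_toL2 hf hX, inner_toL2, ← hP]
    refine Finset.sum_congr rfl fun k _ => ?_
    -- The adjoint in the inner product is harmless: `τ(G* e)` is the conjugate of `τ(G e)`, which
    -- is real.
    have h2 : τ (star (pathMean (gradientPath l (φ o) fun j => (X j : A))) * e k) =
        τ (pathMean (gradientPath l (φ o) fun j => (X j : A)) * e k) := by
      have h3 := map_star τ (pathMean (gradientPath l (φ o) fun j => (X j : A)) * e k)
      rw [star_mul, (e k).2.star_eq, ht] at h3
      rw [h3, ← hre o k]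
      exact Complex.conj_ofReal _
    rw [h2, mul_comm]
  have hhess := sum_state_hessianPath h1 hf hE hX l
  simp only [hessian_cylindrical h1 hf ht hg φ X l]
  push_cast
  simp only [hre, hre2]
  rw [Finset.sum_comm]
  refine Finset.sum_congr rfl fun o _ => ?_
  rw [Finset.sum_add_distrib, ← Finset.mul_sum, hhess, add_comm]
  simp only [hinner, Finset.sum_mul, Finset.mul_sum]
  rw [Finset.sum_comm, mul_left_comm]
  simp only [mul_assoc]

end SelfAdjointTuples

/-! ### The normalized trace and the GUE basis -/

section NormalizedTrace

variable {n : ℕ}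

theorem normTrace_apply (a : Matrix (Fin n) (Fin n) ℂ) :
    normTrace n a = (n : ℂ)⁻¹ * a.trace := rfl

theorem normTrace_one (hn : 0 < n) : normTrace n 1 = 1 := by
  have : (n : ℂ) ≠ 0 := Nat.cast_ne_zero.2 hn.ne'
  rw [normTrace_apply, Matrix.trace_one, Fintype.card_fin, inv_mul_cancel₀ this]

theorem normTrace_mul_comm (a b : Matrix (Fin n) (Fin n) ℂ) :
    normTrace n (a * b) = normTrace n (b * a) := by
  rw [normTrace_apply, normTrace_apply, Matrix.trace_mul_comm]

theorem normTrace_faithful (hn : 0 < n) (a : Matrix (Fin n) (Fin n) ℂ)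
    (h : normTrace n (star a * a) = 0) : a = 0 := by
  have hn' : (n : ℂ) ≠ 0 := Nat.cast_ne_zero.2 hn.ne'
  rw [normTrace_apply, mul_eq_zero, or_iff_right (inv_ne_zero hn')] at h
  exact Matrix.trace_conjTranspose_mul_self_eq_zero_iff.1 h

/-- For `i < j` the pair contributes `(n/2)(e_ij + e_ji)^{⊗2} - (n/2)(e_ij - e_ji)^{⊗2}`. The
squares cancel and the cross terms remain. Both contraction identities below are bilinear in the
basis, so they follow from this one. -/
theorem sum_bilin_gueBasisMatrix
    (B : Matrix (Fin n) (Fin n) ℂ →ₗ[ℂ] Matrix (Fin n) (Fin n) ℂ →ₗ[ℂ] ℂ) :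
    ∑ i, ∑ j, B (gueBasisMatrix i j) (gueBasisMatrix i j) =
      n * ∑ i : Fin n, ∑ j : Fin n, B (Matrix.single i j 1) (Matrix.single j i 1) := by
  have hs : (Real.sqrt n : ℂ) * Real.sqrt n = n := by
    exact_mod_cast Real.mul_self_sqrt (Nat.cast_nonneg n)
  have hs2 : (((Real.sqrt n / Real.sqrt 2 : ℝ) : ℂ)) * ((Real.sqrt n / Real.sqrt 2 : ℝ) : ℂ) =
      n / 2 := by
    rw [← Complex.ofReal_mul, div_mul_div_comm, Real.mul_self_sqrt (Nat.cast_nonneg n),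
      Real.mul_self_sqrt zero_le_two]
    norm_num
  have hlt : ∀ i j : Fin n, i < j → B (gueBasisMatrix i j) (gueBasisMatrix i j) +
      B (gueBasisMatrix j i) (gueBasisMatrix j i) =
      n * (B (Matrix.single i j 1) (Matrix.single j i 1) +
        B (Matrix.single j i 1) (Matrix.single i j 1)) := by
    intro i j hij
    have e1 : gueBasisMatrix i j = ((Real.sqrt n / Real.sqrt 2 : ℝ) : ℂ) •
        (Matrix.single i j 1 + Matrix.single j i 1) := by
      rw [gueBasisMatrix, if_neg hij.ne, if_pos hij]
    have e2 : gueBasisMatrix j i = (Complex.I * ((Real.sqrt n / Real.sqrt 2 : ℝ) : ℂ)) •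
        (Matrix.single j i 1 - Matrix.single i j 1) := by
      rw [gueBasisMatrix, if_neg hij.ne', if_neg hij.asymm]
    rw [e1, e2]
    generalize ((Real.sqrt n / Real.sqrt 2 : ℝ) : ℂ) = c at *
    simp only [map_add, map_sub, map_smul, LinearMap.add_apply, LinearMap.sub_apply,
      LinearMap.smul_apply, smul_eq_mul]
    generalize B (Matrix.single i j 1) (Matrix.single i j 1) = p
    generalize B (Matrix.single j i 1) (Matrix.single j i 1) = q
    generalize B (Matrix.single i j 1) (Matrix.single j i 1) = r
    generalize B (Matrix.single j i 1) (Matrix.single i j 1) = s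
    linear_combination (2 * (r + s)) * hs2 + c ^ 2 * (p + q - r - s) * Complex.I_sq
  have hsymm : ∀ i j : Fin n, B (gueBasisMatrix i j) (gueBasisMatrix i j) +
      B (gueBasisMatrix j i) (gueBasisMatrix j i) =
      n * (B (Matrix.single i j 1) (Matrix.single j i 1) +
        B (Matrix.single j i 1) (Matrix.single i j 1)) := by
    intro i j
    rcases lt_trichotomy i j with h | rfl | h
    · exact hlt i j h
    · simp only [gueBasisMatrix, if_true, map_smul, LinearMap.smul_apply, smul_eq_mul]
      linear_combination (2 * B (Matrix.single i i 1) (Matrix.single i i 1)) * hs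
    · rw [add_comm, hlt j i h, add_comm (B (Matrix.single j i 1) _)]
  -- Summing the symmetrized identity over all ordered pairs counts each side twice, hence the final
  -- division by `2`.
  have hsum := Finset.sum_congr rfl fun i (_ : i ∈ Finset.univ) =>
    Finset.sum_congr rfl fun j (_ : j ∈ Finset.univ) => hsymm i j
  simp only [Finset.sum_add_distrib, ← Finset.mul_sum] at hsum
  rw [Finset.sum_comm (f := fun i j => B (gueBasisMatrix j i) (gueBasisMatrix j i)),
    Finset.sum_comm (f := fun i j => B (Matrix.single j i 1) (Matrix.single i j 1))] at hsum
  linear_combination hsum / 2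

/-- `Tr(a e_ij b e_ji) = a_ii b_jj`, so the double sum factors into `Tr a · Tr b`. -/
theorem sum_normTrace_mul_gueBasis_mul (hn : 0 < n) (a b : Matrix (Fin n) (Fin n) ℂ) :
    ∑ k : Fin n × Fin n, normTrace n (a * (gueBasis k.1 k.2 : Matrix (Fin n) (Fin n) ℂ) * b *
      (gueBasis k.1 k.2 : Matrix (Fin n) (Fin n) ℂ)) =
      (n : ℂ) ^ 2 * (normTrace n a * normTrace n b) := by
  have hn' : (n : ℂ) ≠ 0 := Nat.cast_ne_zero.2 hn.ne'
  have h := sum_bilin_gueBasisMatrix (n := n)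
    (LinearMap.mk₂ ℂ (fun x y => (n : ℂ)⁻¹ * (a * x * b * y).trace)
      (fun x y z => by simp [mul_add, add_mul]) (fun c x y => by simp [mul_left_comm])
      (fun x y z => by simp [mul_add]) (fun c x y => by simp [mul_left_comm]))
  rw [Fintype.sum_prod_type]
  refine h.trans ?_
  have hb : ∀ i j : Fin n, (a * Matrix.single i j 1 * b * Matrix.single j i 1).trace =
      a i i * b j j := by
    intro i j
    rw [Matrix.trace_mul_comm, ← mul_assoc, ← mul_assoc, Matrix.single_mul_mul_single,
      Matrix.trace_single_mul]
    simp
  simp only [LinearMap.mk₂_apply, hb, normTrace_apply]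
  simp only [Matrix.trace, Matrix.diag_apply, ← Finset.mul_sum, ← Finset.sum_mul]
  field_simp

/-- `Tr(a e_ij) = a_ji`, and `∑ a_ji b_ij = Tr(a b)`. -/
theorem sum_normTrace_mul_gueBasis (hn : 0 < n) (a b : Matrix (Fin n) (Fin n) ℂ) :
    ∑ k : Fin n × Fin n, normTrace n (a * (gueBasis k.1 k.2 : Matrix (Fin n) (Fin n) ℂ)) *
      normTrace n (b * (gueBasis k.1 k.2 : Matrix (Fin n) (Fin n) ℂ)) = normTrace n (a * b) := by
  have hn' : (n : ℂ) ≠ 0 := Nat.cast_ne_zero.2 hn.ne'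
  have h := sum_bilin_gueBasisMatrix (n := n)
    (LinearMap.mk₂ ℂ (fun x y => ((n : ℂ)⁻¹ * (a * x).trace) * ((n : ℂ)⁻¹ * (b * y).trace))
      (fun x y z => by simp [mul_add, add_mul]) (fun c x y => by simp; ring)
      (fun x y z => by simp [mul_add]) (fun c x y => by simp; ring))
  rw [Fintype.sum_prod_type]
  refine h.trans ?_
  have hb : ∀ (c : Matrix (Fin n) (Fin n) ℂ) (i j : Fin n),
      (c * Matrix.single i j 1).trace = c j i := by
    intro c i j
    rw [Matrix.trace_mul_comm, Matrix.trace_single_mul, one_smul]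
  have hc : ∀ i j : Fin n, ((n : ℂ)⁻¹ * a j i) * ((n : ℂ)⁻¹ * b i j) =
      (n : ℂ)⁻¹ * ((n : ℂ)⁻¹ * (a j i * b i j)) := fun i j => by ring
  simp only [LinearMap.mk₂_apply, hb, normTrace_apply, hc, ← Finset.mul_sum]
  simp only [Matrix.trace, Matrix.diag_apply, Matrix.mul_apply]
  rw [Finset.sum_comm, mul_inv_cancel_left₀ hn']

theorem hasCalculus_matL2 {d : ℕ} (X : SAMatrices n d) : HasCalculus (matL2 X) := fun j => by
  obtain ⟨Φ, -, h⟩ := exists_funCalc_eq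
    ⟨_, isFunctionalCalculus_selfAdjointCalculus (τ := normTrace n) (X j).2⟩
  exact ⟨Φ, h⟩

/-- With `N = n²` the prefactor `1 / n²` cancels on the free Laplacian and survives only on the
second derivatives of `g`. -/
theorem gueLaplacian_matCylindrical (hn : 0 < n) {d m : ℕ} {g : (Fin m → ℝ) → ℝ}
    (hg : ContDiff ℝ 2 g) (φ : Fin m → NCP d) (hφ : ∀ o, (φ o).SelfAdj) (X : SAMatrices n d) :
    (gueLaplacian (matCylindrical g φ n) X : ℂ) =
      freeLaplacian (normTrace n) g φ (matL2 X) +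
        1 / (n : ℂ) ^ 2 * ∑ l : Fin d, ∑ o : Fin m, ∑ q : Fin m,
          (partialDeriv₂ g o q (cylArgs (normTrace n) φ (matL2 X)) : ℂ) *
            inner ℂ (cyclicDerivArctan (normTrace n) l (φ o) (matL2 X))
              (cyclicDerivArctan (normTrace n) l (φ q) (matL2 X)) := by
  have hn' : (n : ℂ) ≠ 0 := Nat.cast_ne_zero.2 hn.ne'
  have key := sum_hessian_cylindrical (normTrace_one hn) (normTrace_faithful hn)
    normTrace_mul_comm (sum_normTrace_mul_gueBasis_mul hn) (sum_normTrace_mul_gueBasis hn)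
    hg φ hφ X
  have hl : ∀ l, ((∑ i : Fin n, ∑ j : Fin n, matHessian (matCylindrical g φ n) X
      (Pi.single l (gueBasis i j)) (Pi.single l (gueBasis i j)) : ℝ) : ℂ) = _ := fun l => by
    refine Eq.trans ?_ (key l)
    rw [Fintype.sum_prod_type]
    rfl
  rw [gueLaplacian, Complex.ofReal_mul, Complex.ofReal_sum]
  simp only [hl]
  rw [(hasCalculus_matL2 X).freeLaplacian_eq (normTrace_one hn)]
  simp only [Finset.sum_add_distrib, ← Finset.mul_sum, mul_add]
  push_cast
  rw [one_div, inv_mul_cancel_left₀ (pow_ne_zero 2 hn')]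
  rfl

end NormalizedTrace

/-! ### The correction term -/

/-- The bound is independent of the algebra, so the correction term is of order `n⁻²`. -/
theorem exists_norm_cyclicDerivArctan_le {d : ℕ} (l : Fin d) (φ : NCP d) :
    ∃ C : ℝ, 0 ≤ C ∧ ∀ (A : Type u) [CStarAlgebra A] [PartialOrder A] [StarOrderedRing A]
      (τ : A →ₚ[ℂ] ℂ), τ 1 = 1 → ∀ X : Fin d → τ.GNS, HasCalculus X →
        ‖cyclicDerivArctan τ l φ X‖ ≤ C := by
  obtain ⟨C, hC, h⟩ := NCP.exists_norm_eval_le.{u} (Real.pi / 2) (NCP.cyclicDeriv l φ)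
  refine ⟨C, hC, fun A _ _ _ τ h1 X hX => ?_⟩
  have := nontrivial_of_map_one h1
  have hr := hX.norm_resolventL2_le l
  have hW := h A _ hX.norm_arctanTuple_le
  rw [cyclicDerivArctan, norm_smul]
  refine (mul_le_mul_of_nonneg_left (intervalIntegral.norm_integral_le_of_norm_le_const
    (C := C) fun s _ => ?_) (norm_nonneg _)).trans_eq (by norm_num; ring)
  calc _ ≤ _ := norm_toL2_le h1 _
    _ ≤ (1 * C) * 1 := by
      refine (norm_mul_le _ _).trans (mul_le_mul ?_ (hr s) (norm_nonneg _) (by positivity))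
      exact (norm_mul_le _ _).trans (mul_le_mul (hr s) hW (norm_nonneg _) zero_le_one)
    _ = C := by ring

open Filter Topology in
theorem tendsto_inv_sq_mul_inner {H : ℕ → Type*} [∀ n, NormedAddCommGroup (H n)]
    [∀ n, InnerProductSpace ℂ (H n)] {x y : ∀ n, H n} {C D : ℝ} (hx : ∀ n, ‖x n‖ ≤ C)
    (hy : ∀ n, ‖y n‖ ≤ D) {c : ℕ → ℂ} {c₀ : ℂ} (hc : Tendsto c atTop (𝓝 c₀)) :
    Tendsto (fun n : ℕ => 1 / ((n + 1 : ℕ) : ℂ) ^ 2 * (c n * inner ℂ (x n) (y n))) atTop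
      (𝓝 0) := by
  have h0 : Tendsto (fun n : ℕ => 1 / ((n + 1 : ℕ) : ℂ)) atTop (𝓝 0) := by
    simpa using tendsto_one_div_add_atTop_nhds_zero_nat (𝕜 := ℂ)
  have h1 : Tendsto (fun n : ℕ => 1 / ((n + 1 : ℕ) : ℂ) ^ 2 * c n) atTop (𝓝 0) := by
    simpa [one_div, inv_pow] using (h0.pow 2).mul hc
  have h2 : Tendsto (fun n : ℕ => ‖1 / ((n + 1 : ℕ) : ℂ) ^ 2 * c n‖ * (C * D)) atTop (𝓝 0) := by
    simpa using h1.norm.mul_const (C * D)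
  refine squeeze_zero_norm (fun n => ?_) h2
  rw [← mul_assoc, norm_mul]
  refine mul_le_mul_of_nonneg_left ((norm_inner_le_norm _ _).trans ?_) (norm_nonneg _)
  exact mul_le_mul (hx n) (hy n) (norm_nonneg _) ((norm_nonneg _).trans (hx n))

theorem mainTheorem5 {d m : ℕ} (g : (Fin m → ℝ) → ℝ) (hg : ContDiff ℝ 2 g)
    (φ : Fin m → NCP d) (hφ : ∀ o, (φ o).SelfAdj) :
    (∀ n : ℕ, 0 < n →
      ContDiff ℝ 2 (matCylindrical g φ n) ∧
      ∀ X : SAMatrices n d,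
        (gueLaplacian (matCylindrical g φ n) X : ℂ) =
          freeLaplacian (normTrace n) g φ (matL2 X) +
            1 / (n : ℂ) ^ 2 * ∑ l : Fin d, ∑ o : Fin m, ∑ q : Fin m,
              (partialDeriv₂ g o q (cylArgs (normTrace n) φ (matL2 X)) : ℂ) *
                inner ℂ (cyclicDerivArctan (normTrace n) l (φ o) (matL2 X))
                  (cyclicDerivArctan (normTrace n) l (φ q) (matL2 X))) ∧
    (∀ (A : Type u) [CStarAlgebra A] [PartialOrder A] [StarOrderedRing A] (τ : A →ₚ[ℂ] ℂ),
      IsTracialWStar τ →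
      ∀ X : Fin d → τ.GNS, (∀ j, X j ∈ selfAdjointL2 τ) →
      ∀ Xn : (n : ℕ) → SAMatrices n d, MatConvergesInLaw τ Xn X →
        Filter.Tendsto (fun n => (gueLaplacian (matCylindrical g φ n) (Xn n) : ℂ)) Filter.atTop
          (nhds (freeLaplacian τ g φ X))) := by
  refine ⟨fun n hn => ⟨contDiff_cylindrical (normTrace_one hn) (normTrace_faithful hn) hg φ,
    gueLaplacian_matCylindrical hn hg φ hφ⟩, fun A _ _ _ τ hτ X hX Xn hlaw => ?_⟩
  have hXc : HasCalculus X := fun j => by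
    obtain ⟨Φ, -, h⟩ := exists_funCalc_eq (hτ.exists_isFunctionalCalculus (hX j))
    exact ⟨Φ, h⟩
  -- The shift discards `n = 0`, where the matrix algebra is zero and `normTrace` is not a state.
  rw [← Filter.tendsto_add_atTop_iff_nat 1]
  have hlaw' : ∀ p, Filter.Tendsto (fun n => arctanLaw (normTrace (n + 1)) (matL2 (Xn (n + 1))) p)
      Filter.atTop (nhds (arctanLaw τ X p)) := fun p =>
    (Filter.tendsto_add_atTop_iff_nat 1).2 (hlaw p)
  have hmain := tendsto_freeLaplacian (B := fun n => Matrix (Fin (n + 1)) (Fin (n + 1)) ℂ)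
    (σ := fun n => normTrace (n + 1)) (Z := fun n => matL2 (Xn (n + 1)))
    (fun n => normTrace_one n.succ_pos) hτ.map_one (fun n => normTrace_mul_comm) hτ.tracial
    (fun n => hasCalculus_matL2 _) hXc hlaw' (hg.of_le one_le_two) φ
  have hargs := tendsto_cylArgs (B := fun n => Matrix (Fin (n + 1)) (Fin (n + 1)) ℂ)
    (σ := fun n => normTrace (n + 1)) (Z := fun n => matL2 (Xn (n + 1))) φ hlaw'
  have hcorr : Filter.Tendsto (fun n : ℕ => ∑ l : Fin d, ∑ o : Fin m, ∑ q : Fin m,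
      1 / ((n + 1 : ℕ) : ℂ) ^ 2 *
        ((partialDeriv₂ g o q (cylArgs (normTrace (n + 1)) φ (matL2 (Xn (n + 1)))) : ℂ) *
          inner ℂ (cyclicDerivArctan (normTrace (n + 1)) l (φ o) (matL2 (Xn (n + 1))))
            (cyclicDerivArctan (normTrace (n + 1)) l (φ q) (matL2 (Xn (n + 1))))))
      Filter.atTop (nhds (∑ _l : Fin d, ∑ _o : Fin m, ∑ _q : Fin m, 0)) := by
    refine tendsto_finsetSum _ fun l _ => tendsto_finsetSum _ fun o _ =>
      tendsto_finsetSum _ fun q _ => ?_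
    obtain ⟨C, -, hC⟩ := exists_norm_cyclicDerivArctan_le.{0} l (φ o)
    obtain ⟨D, -, hD⟩ := exists_norm_cyclicDerivArctan_le.{0} l (φ q)
    exact tendsto_inv_sq_mul_inner
      (fun n => hC _ _ (normTrace_one n.succ_pos) _ (hasCalculus_matL2 (Xn (n + 1))))
      (fun n => hD _ _ (normTrace_one n.succ_pos) _ (hasCalculus_matL2 (Xn (n + 1))))
      ((Complex.continuous_ofReal.tendsto _).comp
        (((continuous_partialDeriv (contDiff_partialDeriv hg o) q).tendsto _).comp hargs))
  have hsum := hmain.add hcorr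
  simp only [Finset.sum_const_zero, add_zero] at hsum
  refine hsum.congr fun n => ?_
  rw [gueLaplacian_matCylindrical n.succ_pos hg φ hφ]
  simp only [Finset.mul_sum]
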